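/- Let $N\ge 1$ be an integer with $N\neq 4$, let $\epsilon=(\epsilon_1,\dots,\epsilon_N)\in\mathbb Z^N$ and $a\in\mathbb C$. All vector spaces are over $\mathbb C$; all modules over Lie superalgebras are $\mathbb Z/2$-graded, and submodules are graded. **The algebra.** Let $\mathcal A=\mathbb C[t^{\pm1}]\otimes\Lambda(N)$, where $\Lambda(N)$ is the Grassmann algebra in the odd variables $\xi_1,\dots,\xi_N$, and for $I=\{i_1<\dots<i_k\}\subseteq\{1,\dots,N\}$ put $\xi_I=\xi_{i_1}\cdots\xi_{i_k}$. Let $\mathcal W(N)$ be the Lie superalgebra of superderivations of $\mathcal A$, let $\omega_\epsilon=dt-\sum_{i}t^{\epsilon_i}\xi_i\,d\xi_i$ (the differential $d$ being odd), and let $$\mathcal K(N;\epsilon)=\{D\in\mathcal W(N)\mid D\omega_\epsilon=P\omega_\epsilon\text{ for some }P\in\mathcal A\}.$$ With $\Delta f=2f-\sum_i\xi_i\partial_i f$ and $D^\epsilon=\partial_t-\tfrac12t^{-1}\sum_i\epsilon_i\xi_i\partial_i$, the map $$f\mapsto D_f=(\Delta f)D^\epsilon+\sum_iD^\epsilon(f)\xi_i\partial_i+(-1)^{|f|}\sum_it^{-\epsilon_i}\partial_i(f)\partial_i$$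 is a linear bijection $\mathcal A\to\mathcal K(N;\epsilon)$. Let $\widetilde{\mathcal K}=\mathcal K(N;\epsilon)\ltimes\mathcal A$, with $\mathcal A$ abelian and $[D,f]=D(f)$. Put $s=2$ if $\epsilon=(1,\dots,1)$ and $s=1$ otherwise. The operators $D_t$ on $\mathcal A$ and $\operatorname{ad}D_t$ on $\mathcal K(N;\epsilon)$ are diagonalizable with eigenvalues in $s\mathbb Z$; write $\widetilde{\mathcal K}=\bigoplus_{r\in s\mathbb Z}\widetilde{\mathcal K}_r$ for the corresponding grading. **Jet modules.** An $\mathcal A\mathcal K(N;\epsilon)$ module is a $\widetilde{\mathcal K}$ module on which $\mathcal A$ acts as an associative unital algebra. The category $\mathscr J_a(\mathcal K(N;\epsilon),\mathcal A)$ consists of the $\mathcal A\mathcal K(N;\epsilon)$ modules on which $D_t$ acts diagonalizably, with finite-dimensional eigenspaces and all eigenvalues in $a+s\mathbb Z$. **Tensor modules.** Let $\mathcal K_0=\{D_f\mid f\in\sum_I(t-1)^{\max(1-\lfloor(|I|+1)/3\rfloor,\,0)}\xi_I\mathcal A\}$, a subalgebra of $\mathcal K(N;\epsilon)$. There is a surjective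 homomorphism $\mathcal K_0\to\mathbb Cz\oplus\mathfrak{so}_N$ with $D_t-D_1\mapsto z$, $D_{t\xi_i\xi_j}\mapsto E_{ji}-E_{ij}$ $(i<j)$, which kills $D_f$ for $f\in(t-1)^2\mathcal A+\sum_i(t-1)\xi_i\mathcal A+\sum_{i<j}(t-1)\xi_i\xi_j\mathcal A+\sum_{|I|\ge3}\xi_I\mathcal A$. Let $V$ be a simple finite-dimensional $\mathbb Cz\oplus\mathfrak{so}_N$ module on which $z$ acts as the scalar $c$, placed in a single parity. It becomes a $\mathcal K_0\ltimes\mathcal A$ module, with $\mathcal K_0$ acting through this homomorphism and $t^k\xi_I$ acting as $\delta_{|I|,0}$. The induced $\widetilde{\mathcal K}$ module $\mathrm{Ind}\,V=U(\widetilde{\mathcal K})\otimes_{U(\mathcal K_0\ltimes\mathcal A)}V$ is an $\mathcal A\mathcal K(N;\epsilon)$ module. For an $\mathcal A\mathcal K(N;\epsilon)$ module $P$, put $$\mathfrak W^{(a)}(P)=\bigoplus_{i\in s\mathbb Z}P/(D_t-a-i)P,$$ an $\mathcal A\mathcal K(N;\epsilon)$ module in which $x\in\widetilde{\mathcal K}_r$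 sends the class of $v$ in the component $i$ to the class of $xv$ in the component $i+r$. Define $\mathcal F_a(V,c)=\mathfrak W^{(a)}(\mathrm{Ind}\,V)$. **Theorem.** Every simple module in $\mathscr J_a(\mathcal K(N;\epsilon),\mathcal A)$ is isomorphic to a simple quotient of $\mathcal F_a(V,c)$ for some simple finite-dimensional $\mathbb Cz\oplus\mathfrak{so}_N$ module $V$ on which $z$ acts as a scalar $c\in\mathbb C$. -/

import Mathlib

open TensorProduct LaurentPolynomial

noncomputable section

namespace ContactSuper

/-- The sign `(-1)^p` of a parity `p`. -/
def sgn (p : ZMod 2) : ℂ := if p = 0 then 1 else -1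

/-- The Grassmann algebra `Λ(N)` in the odd variables `ξ_1, …, ξ_N`. -/
abbrev Grassmann (N : ℕ) : Type := ExteriorAlgebra ℂ (Fin N → ℂ)

/-- The associative superalgebra `𝒜 = ℂ[t, t⁻¹] ⊗ Λ(N)`. Since `t` is even, the
multiplication is that of the ordinary tensor product of algebras. -/
def SA (N : ℕ) : Type := ℂ[T;T⁻¹] ⊗[ℂ] Grassmann N

instance (N : ℕ) : Ring (SA N) := inferInstanceAs (Ring (ℂ[T;T⁻¹] ⊗[ℂ] Grassmann N))

instance (N : ℕ) : Algebra ℂ (SA N) := inferInstanceAs (Algebra ℂ (ℂ[T;T⁻¹] ⊗[ℂ] Grassmann N))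

variable {N : ℕ}

/-- The element `p ⊗ x` of `𝒜`. -/
def pure (p : ℂ[T;T⁻¹]) (x : Grassmann N) : SA N := p ⊗ₜ[ℂ] x

/-- The element `t ^ k` of `𝒜`. -/
def tpow (k : ℤ) : SA N := pure (T k) 1

/-- The odd generator `ξ_i` of `𝒜`. -/
def xi (i : Fin N) : SA N := pure 1 (ExteriorAlgebra.ι ℂ (Pi.single i (1 : ℂ)))

/-- The parity automorphism `f ↦ (-1)^{|f|} f` of `𝒜`. -/
def parity : SA N →ₐ[ℂ] SA N :=
  (Algebra.TensorProduct.map (AlgHom.id ℂ ℂ[T;T⁻¹])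
    (CliffordAlgebra.involute (Q := (0 : QuadraticForm ℂ (Fin N → ℂ)))) :
    ℂ[T;T⁻¹] ⊗[ℂ] Grassmann N →ₐ[ℂ] ℂ[T;T⁻¹] ⊗[ℂ] Grassmann N)

/-- The power `σ ^ p` of the parity automorphism `σ`. -/
def parityPow (p : ZMod 2) : SA N →ₐ[ℂ] SA N := if p = 0 then AlgHom.id ℂ (SA N) else parity

/-- The homogeneous elements of `𝒜` of parity `p`. -/
def homog (p : ZMod 2) : Submodule ℂ (SA N) where
  carrier := {f | parity f = sgn p • f}
  add_mem' := by intro f g hf hg; simp_all [smul_add]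
  zero_mem' := by simp
  smul_mem' := by intro c f hf; simp_all [smul_comm c]

/-- `d/dt` on Laurent polynomials. -/
def laurentDeriv : ℂ[T;T⁻¹] →ₗ[ℂ] ℂ[T;T⁻¹] :=
  (AddMonoidAlgebra.basis ℤ ℂ).constr ℂ fun k => (k : ℂ) • T (k - 1)

/-- `∂_t` on `𝒜`. -/
def pdt : Module.End ℂ (SA N) :=
  (LinearMap.rTensor (Grassmann N) laurentDeriv :
    ℂ[T;T⁻¹] ⊗[ℂ] Grassmann N →ₗ[ℂ] ℂ[T;T⁻¹] ⊗[ℂ] Grassmann N)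

/-- `∂_i = ∂/∂ξ_i` on `𝒜` (the left derivative). -/
def pdxi (i : Fin N) : Module.End ℂ (SA N) :=
  (LinearMap.lTensor ℂ[T;T⁻¹]
    (CliffordAlgebra.contractLeft (Q := (0 : QuadraticForm ℂ (Fin N → ℂ))) (LinearMap.proj i)) :
    ℂ[T;T⁻¹] ⊗[ℂ] Grassmann N →ₗ[ℂ] ℂ[T;T⁻¹] ⊗[ℂ] Grassmann N)

/-! ### Elementary facts on `𝒜` -/

theorem parity_cases (p : ZMod 2) : p = 0 ∨ p = 1 := by
  revert p; decide

theorem sgn_zero : sgn 0 = 1 := by simp [sgn]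
theorem sgn_one : sgn 1 = -1 := by simp [sgn]
theorem sgn_add (p q : ZMod 2) : sgn (p + q) = sgn p * sgn q := by
  rcases parity_cases p with rfl | rfl <;> rcases parity_cases q with rfl | rfl <;>
    simp [sgn, show (1 : ZMod 2) + 1 = 0 from rfl]
theorem sgn_mul_self (p : ZMod 2) : sgn p * sgn p = 1 := by
  rcases parity_cases p with rfl | rfl <;> simp [sgn]

theorem pure_mul (p q : ℂ[T;T⁻¹]) (x y : Grassmann N) :
    pure p x * pure q y = pure (p * q) (x * y) := Algebra.TensorProduct.tmul_mul_tmul p q x y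

theorem pure_add (p : ℂ[T;T⁻¹]) (x y : Grassmann N) : pure p (x + y) = pure p x + pure p y :=
  TensorProduct.tmul_add p x y

theorem add_pure (p q : ℂ[T;T⁻¹]) (x : Grassmann N) : pure (p + q) x = pure p x + pure q x :=
  TensorProduct.add_tmul p q x

theorem pure_smul (c : ℂ) (p : ℂ[T;T⁻¹]) (x : Grassmann N) : pure p (c • x) = c • pure p x :=
  TensorProduct.tmul_smul c p x

theorem smul_pure (c : ℂ) (p : ℂ[T;T⁻¹]) (x : Grassmann N) : pure (c • p) x = c • pure p x :=
  (TensorProduct.smul_tmul' c p x).symm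

theorem pure_zero (p : ℂ[T;T⁻¹]) : pure p (0 : Grassmann N) = 0 := TensorProduct.tmul_zero _ p

theorem zero_pure (x : Grassmann N) : pure 0 x = 0 := TensorProduct.zero_tmul _ x

theorem pure_one_one : (pure 1 1 : SA N) = 1 := rfl

theorem pure_induction {P : SA N → Prop} (h0 : P 0) (hp : ∀ p x, P (pure p x))
    (hadd : ∀ f g, P f → P g → P (f + g)) (f : SA N) : P f :=
  TensorProduct.induction_on (motive := P) f h0 hp hadd

theorem parity_pure (p : ℂ[T;T⁻¹]) (x : Grassmann N) :
    parity (pure p x) = pure p (CliffordAlgebra.involute x) := rfl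

theorem pdt_pure (p : ℂ[T;T⁻¹]) (x : Grassmann N) :
    pdt (pure p x) = pure (laurentDeriv p) x := rfl

theorem pdxi_pure (i : Fin N) (p : ℂ[T;T⁻¹]) (x : Grassmann N) :
    pdxi i (pure p x) = pure p (CliffordAlgebra.contractLeft (LinearMap.proj i) x) := rfl

theorem tpow_zero : (tpow 0 : SA N) = 1 := rfl

theorem tpow_add (k l : ℤ) : (tpow (k + l) : SA N) = tpow k * tpow l := by
  rw [tpow, tpow, tpow, pure_mul, T_add, mul_one]

theorem SA_induction {P : SA N → Prop} (hc : ∀ c : ℂ, P (algebraMap ℂ _ c))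
    (ht : ∀ k, P (tpow k)) (hx : ∀ i, P (xi i))
    (hadd : ∀ f g, P f → P g → P (f + g)) (hmul : ∀ f g, P f → P g → P (f * g)) (f : SA N) :
    P f := by
  have h0 : P 0 := by simpa using hc 0
  have hsmul : ∀ (c : ℂ) f, P f → P (c • f) := fun c f hf => by
    rw [Algebra.smul_def]; exact hmul _ _ (hc c) hf
  have h1 : ∀ x : Grassmann N, P (pure 1 x) := by
    intro x
    induction x using ExteriorAlgebra.induction with
    | algebraMap r =>
      rw [Algebra.algebraMap_eq_smul_one, pure_smul, pure_one_one]
      exact hsmul _ _ (by simpa using hc 1)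
    | ι v =>
      have hv : v = ∑ i, v i • (Pi.single i (1 : ℂ) : Fin N → ℂ) := by
        ext j; simp [Finset.sum_apply, Pi.single_apply]
      rw [hv, map_sum]
      have key : ∀ s : Finset (Fin N), P (pure 1 (∑ i ∈ s,
          (ExteriorAlgebra.ι ℂ (v i • (Pi.single i (1 : ℂ) : Fin N → ℂ))))) := by
        intro s
        induction s using Finset.induction_on with
        | empty => simpa [pure_zero] using h0
        | insert a s ha ih =>
          rw [Finset.sum_insert ha, pure_add, map_smul, pure_smul]
          exact hadd _ _ (hsmul _ _ (hx a)) ih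
      exact key _
    | mul a b ha hb =>
      have := hmul _ _ ha hb
      rwa [pure_mul, one_mul] at this
    | add a b ha hb => rw [pure_add]; exact hadd _ _ ha hb
  refine pure_induction h0 (fun p x => ?_) hadd f
  induction p using LaurentPolynomial.induction_on' with
  | add p q hp hq => rw [add_pure]; exact hadd _ _ hp hq
  | C_mul_T n a =>
    have h2 : pure (C a * T n : ℂ[T;T⁻¹]) x = a • ((tpow n : SA N) * pure 1 x) := by
      rw [tpow, pure_mul, mul_one, one_mul, ← LaurentPolynomial.smul_eq_C_mul, smul_pure]
    rw [h2]
    exact hsmul _ _ (hmul _ _ (ht n) (h1 x))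

theorem parity_tpow (k : ℤ) : parity (tpow k : SA N) = tpow k := by simp [tpow, parity_pure]

theorem parity_xi (i : Fin N) : parity (xi i) = - xi i := by
  rw [xi, parity_pure]
  refine (congrArg _ (CliffordAlgebra.involute_ι _)).trans ?_
  rw [← neg_one_smul ℂ, pure_smul, neg_one_smul]

theorem parity_parity (f : SA N) : parity (parity f) = f := by
  induction f using SA_induction with
  | hc c => simp only [AlgHom.commutes]
  | ht k => simp [parity_tpow]
  | hx i => simp [parity_xi]
  | hadd f g hf hg => simp [hf, hg]
  | hmul f g hf hg => simp [hf, hg]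

theorem laurentDeriv_T (k : ℤ) : laurentDeriv (T k) = (k : ℂ) • T (k - 1) :=
  (AddMonoidAlgebra.basis ℤ ℂ).constr_basis ℂ _ k

theorem laurentDeriv_mul (p q : ℂ[T;T⁻¹]) :
    laurentDeriv (p * q) = laurentDeriv p * q + p * laurentDeriv q := by
  induction p using LaurentPolynomial.induction_on' with
  | add p p' hp hp' => simp only [add_mul, map_add, hp, hp']; abel
  | C_mul_T n a =>
    induction q using LaurentPolynomial.induction_on' with
    | add p p' hp hp' => simp only [mul_add, map_add, hp, hp']; abel
    | C_mul_T m b =>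
      simp only [← LaurentPolynomial.smul_eq_C_mul, smul_mul_assoc, mul_smul_comm, map_smul,
        ← T_add, laurentDeriv_T]
      rw [show n - 1 + m = n + m - 1 by ring, show n + (m - 1) = n + m - 1 by ring]
      push_cast
      module

theorem contractLeft_mul (d : Module.Dual ℂ (Fin N → ℂ)) (x y : Grassmann N) :
    CliffordAlgebra.contractLeft d (x * y) = CliffordAlgebra.contractLeft d x * y
      + CliffordAlgebra.involute x * CliffordAlgebra.contractLeft d y := by
  induction x using CliffordAlgebra.left_induction with
  | algebraMap r =>
    simp [CliffordAlgebra.contractLeft_algebraMap_mul, CliffordAlgebra.contractLeft_algebraMap]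
  | add x y hx hy => simp only [add_mul, map_add, hx, hy]; abel
  | ι_mul x m hx =>
    simp only [mul_assoc, CliffordAlgebra.contractLeft_ι_mul, hx, map_mul,
      CliffordAlgebra.involute_ι, sub_mul, smul_mul_assoc, mul_add, neg_mul]
    abel

theorem pdt_mul (f g : SA N) : pdt (f * g) = pdt f * g + f * pdt g := by
  induction f using pure_induction with
  | h0 => simp
  | hadd a b ha hb => simp only [add_mul, map_add, ha, hb]; abel
  | hp p x =>
    induction g using pure_induction with
    | h0 => simp
    | hadd a b ha hb => simp only [mul_add, map_add, ha, hb]; abel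
    | hp q y => simp only [pure_mul, pdt_pure, laurentDeriv_mul, add_pure]

theorem pdxi_mul (i : Fin N) (f g : SA N) :
    pdxi i (f * g) = pdxi i f * g + parity f * pdxi i g := by
  induction f using pure_induction with
  | h0 => simp
  | hadd a b ha hb => simp only [add_mul, map_add, ha, hb]; abel
  | hp p x =>
    induction g using pure_induction with
    | h0 => simp
    | hadd a b ha hb => simp only [mul_add, map_add, ha, hb]; abel
    | hp q y => simp only [pure_mul, pdxi_pure, parity_pure, contractLeft_mul, pure_add]

theorem pdt_tpow (k : ℤ) : pdt (tpow k : SA N) = (k : ℂ) • tpow (k - 1) := by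
  simp only [tpow, pdt_pure, laurentDeriv_T, smul_pure]

theorem pdt_xi (i : Fin N) : pdt (xi i) = 0 := by
  have : laurentDeriv 1 = 0 := by
    have := laurentDeriv_T 0
    simpa using this
  simp only [xi, pdt_pure, this, zero_pure]

theorem pdxi_tpow (i : Fin N) (k : ℤ) : pdxi i (tpow k) = 0 := by
  simp only [tpow, pdxi_pure, CliffordAlgebra.contractLeft_one, pure_zero]

theorem pdxi_xi (i j : Fin N) : pdxi i (xi j) = if i = j then 1 else 0 := by
  rw [xi, pdxi_pure]
  refine (congrArg (pure 1) (CliffordAlgebra.contractLeft_ι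
    (Q := (0 : QuadraticForm ℂ (Fin N → ℂ))) (LinearMap.proj i) _)).trans ?_
  simp only [LinearMap.proj_apply, Pi.single_apply]
  split_ifs
  · simp [pure_one_one]
  · simp [pure_zero]

theorem pdt_algebraMap (c : ℂ) : pdt (algebraMap ℂ (SA N) c) = 0 := by
  rw [Algebra.algebraMap_eq_smul_one, map_smul, ← tpow_zero, pdt_tpow]; simp

theorem pdxi_algebraMap (i : Fin N) (c : ℂ) : pdxi i (algebraMap ℂ (SA N) c) = 0 := by
  rw [Algebra.algebraMap_eq_smul_one, map_smul, ← tpow_zero, pdxi_tpow]; simp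

theorem parity_pdt (f : SA N) : parity (pdt f) = pdt (parity f) := by
  induction f using SA_induction with
  | hc c => simp only [AlgHom.commutes, pdt_algebraMap, map_zero]
  | ht k => simp [parity_tpow, pdt_tpow]
  | hx i => simp [parity_xi, pdt_xi]
  | hadd f g hf hg => simp [hf, hg]
  | hmul f g hf hg => simp [hf, hg, pdt_mul]

theorem parity_pdxi (i : Fin N) (f : SA N) : parity (pdxi i f) = - pdxi i (parity f) := by
  induction f using SA_induction with
  | hc c => simp only [AlgHom.commutes, pdxi_algebraMap, map_zero, neg_zero]
  | ht k => simp [parity_tpow, pdxi_tpow]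
  | hx j => simp only [parity_xi, pdxi_xi, map_neg, neg_neg]; split_ifs <;> simp
  | hadd f g hf hg => simp only [map_add, hf, hg, neg_add]
  | hmul f g hf hg =>
    simp only [map_mul, pdxi_mul, map_add, hf, hg, parity_parity, neg_mul, mul_neg, neg_add]

theorem tpow_mul_comm (k : ℤ) (f : SA N) : tpow k * f = f * tpow k := by
  induction f using pure_induction with
  | h0 => simp
  | hadd a b ha hb => simp only [mul_add, add_mul, ha, hb]
  | hp p x => simp only [tpow, pure_mul, mul_comm, mul_one, one_mul]

theorem xi_mul_xi (i j : Fin N) : xi i * xi j = - (xi j * xi i) := by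
  refine eq_neg_of_add_eq_zero_left ?_
  simp only [xi, pure_mul, ← pure_add]
  rw [ExteriorAlgebra.ι_add_mul_swap, pure_zero]

theorem xi_mul_self (i : Fin N) : xi i * xi i = 0 := by
  rw [xi, pure_mul, ExteriorAlgebra.ι_sq_zero, pure_zero]

theorem xi_mul_comm (i : Fin N) (f : SA N) : xi i * f = parity f * xi i := by
  induction f using SA_induction with
  | hc c => simp only [AlgHom.commutes, Algebra.commutes]
  | ht k => simp [parity_tpow, tpow_mul_comm]
  | hx j => rw [parity_xi, xi_mul_xi, neg_mul]
  | hadd f g hf hg => simp [hf, hg, mul_add, add_mul]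
  | hmul f g hf hg => rw [← mul_assoc, hf, mul_assoc, hg, map_mul, mul_assoc]

theorem parityPow_of_mem {p q : ZMod 2} {f : SA N} (hf : f ∈ homog q) :
    parityPow p f = sgn (p * q) • f := by
  have hf' : parity f = sgn q • f := hf
  rcases parity_cases p with rfl | rfl
  · simp [parityPow, sgn_zero]
  · simp [parityPow, hf']

theorem parityPow_tpow (p : ZMod 2) (k : ℤ) : parityPow p (tpow k : SA N) = tpow k := by
  rcases parity_cases p with rfl | rfl <;> simp [parityPow, parity_tpow]

theorem parityPow_xi (p : ZMod 2) (i : Fin N) : parityPow p (xi i) = sgn p • xi i := by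
  rcases parity_cases p with rfl | rfl <;> simp [parityPow, parity_xi, sgn]

theorem supercomm {q : ZMod 2} {h : SA N} (hh : h ∈ homog q) (g : SA N) :
    h * g = parityPow q g * h := by
  induction g using SA_induction with
  | hc c => simp only [AlgHom.commutes, Algebra.commutes]
  | ht k => rw [parityPow_tpow, tpow_mul_comm]
  | hx j =>
    have hh' : parity h = sgn q • h := hh
    rw [parityPow_xi, smul_mul_assoc, xi_mul_comm, hh', smul_mul_assoc, smul_smul, sgn_mul_self,
      one_smul]
  | hadd f g hf hg => simp [hf, hg, mul_add, add_mul]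
  | hmul f g hf hg => rw [← mul_assoc, hf, mul_assoc, hg, map_mul, mul_assoc]

/-! ### Superderivations, differential forms and the contact algebra -/

/-- `𝒲(N)_p`: the superderivations of `𝒜` of parity `p`, i.e. `D (f g) = D(f) g + (-1)^{p|f|} f D(g)`. -/
def superDer (N : ℕ) (p : ZMod 2) : Submodule ℂ (Module.End ℂ (SA N)) where
  carrier := {D | (∀ f, parity (D f) = sgn p • D (parity f)) ∧
    ∀ f g, D (f * g) = D f * g + parityPow p f * D g}
  add_mem' := by
    rintro D E ⟨hD, hD'⟩ ⟨hE, hE'⟩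
    refine ⟨fun f => by simp [hD, hE], fun f g => ?_⟩
    simp only [LinearMap.add_apply, hD', hE', add_mul, mul_add]
    abel
  zero_mem' := by simp
  smul_mem' := by
    rintro c D ⟨hD, hD'⟩
    refine ⟨fun f => by simp [hD, smul_comm c], fun f g => ?_⟩
    simp only [LinearMap.smul_apply, hD', smul_add, smul_mul_assoc, mul_smul_comm]

/-- One-forms `f dt + ∑ g_i dξ_i` over `𝒜`, as the free left `𝒜`-module on `dt, dξ_1, …, dξ_N`. -/
abbrev Form (N : ℕ) : Type := SA N × (Fin N → SA N)

/-- The (odd) differential `df = (dt) ∂_t f + ∑ (dξ_i) ∂_i f`. As `d` is odd, `dt` is odd and the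
`dξ_i` are even, whence the sign when the coefficient of `dt` is moved to the left. -/
def dform (f : SA N) : Form N := (parity (pdt f), fun i => pdxi i f)

/-- The action of a superderivation `D` of parity `p` on one-forms (Lie derivative):
`D (f dx) = D(f) dx + (-1)^{p|f|} f D(dx)` with `D(dx) = (-1)^p d(D x)` for `x = t, ξ_i`. -/
def lieForm (p : ZMod 2) (D : Module.End ℂ (SA N)) (η : Form N) : Form N :=
  ((D η.1, fun i => D (η.2 i)) : Form N) + sgn p • (parityPow p η.1 • dform (D (tpow 1))
    + ∑ i, parityPow p (η.2 i) • dform (D (xi i)))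

/-- The contact form `ω_ε = dt - ∑ t^{ε_i} ξ_i dξ_i`. -/
def contactForm (ε : Fin N → ℤ) : Form N :=
  dform (tpow 1) - ∑ i, (tpow (ε i) * xi i) • dform (xi i)

theorem dform_add (f g : SA N) : dform (f + g) = dform f + dform g := by
  simp [dform, Prod.ext_iff, funext_iff]

theorem dform_smul (c : ℂ) (f : SA N) : dform (c • f) = c • dform f := by
  simp [dform, Prod.ext_iff, funext_iff]

theorem dform_tpow_one : dform (tpow 1 : SA N) = (1, 0) := by
  simp [dform, pdt_tpow, pdxi_tpow, tpow_zero, funext_iff]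

theorem dform_xi (i : Fin N) : dform (xi i) = (0, Pi.single i 1) := by
  simp only [dform, pdt_xi, map_zero, Prod.mk.injEq, true_and]
  ext j : 1
  rw [pdxi_xi, Pi.single_apply]

theorem contactForm_eq (ε : Fin N → ℤ) :
    contactForm ε = (1, fun i => (-1 : ℂ) • (tpow (ε i) * xi i)) := by
  simp only [contactForm, dform_tpow_one, dform_xi]
  refine Prod.ext ?_ ?_
  · simp [Prod.fst_sum]
  · ext j : 1
    simp [Prod.snd_sum, Finset.sum_apply, Pi.single_apply, mul_ite]

theorem lieForm_add (p : ZMod 2) (D E : Module.End ℂ (SA N)) (η : Form N) :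
    lieForm p (D + E) η = lieForm p D η + lieForm p E η := by
  simp only [lieForm, LinearMap.add_apply, dform_add, smul_add, Finset.sum_add_distrib]
  rw [show ((D η.1 + E η.1, fun i => D (η.2 i) + E (η.2 i)) : Form N)
    = (D η.1, fun i => D (η.2 i)) + (E η.1, fun i => E (η.2 i)) from rfl]
  abel

theorem lieForm_smul (p : ZMod 2) (c : ℂ) (D : Module.End ℂ (SA N)) (η : Form N) :
    lieForm p (c • D) η = c • lieForm p D η := by
  simp only [lieForm, LinearMap.smul_apply, dform_smul, smul_add, Finset.smul_sum]
  rw [show ((c • D η.1, fun i => c • D (η.2 i)) : Form N)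
    = c • (D η.1, fun i => D (η.2 i)) from rfl]
  have h : ∀ (f : SA N) (ζ : Form N), f • c • ζ = c • f • ζ := fun f ζ => smul_comm f c ζ
  simp only [h, smul_comm (sgn p) c]

/-- The parity `p` part of `𝒦(N; ε)`: superderivations `D` with `D ω_ε = P ω_ε` for some
`P ∈ 𝒜`. -/
def contactPart (ε : Fin N → ℤ) (p : ZMod 2) : Submodule ℂ (Module.End ℂ (SA N)) where
  carrier := {D | D ∈ superDer N p ∧ ∃ P : SA N, lieForm p D (contactForm ε) = P • contactForm ε}
  add_mem' := by
    rintro D E ⟨hD, P, hP⟩ ⟨hE, Q, hQ⟩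
    exact ⟨add_mem hD hE, P + Q, by rw [lieForm_add, hP, hQ, add_smul]⟩
  zero_mem' := by
    refine ⟨zero_mem _, 0, ?_⟩
    have := lieForm_smul p 0 (0 : Module.End ℂ (SA N)) (contactForm ε)
    rwa [zero_smul, zero_smul, ← zero_smul (SA N) (contactForm ε)] at this
  smul_mem' := by
    rintro c D ⟨hD, P, hP⟩
    exact ⟨Submodule.smul_mem _ c hD, c • P, by rw [lieForm_smul, hP, smul_assoc]⟩

/-- The contact superconformal algebra `𝒦(N; ε)`, as a space of operators on `𝒜`. -/
def contactAlgebra (ε : Fin N → ℤ) : Submodule ℂ (Module.End ℂ (SA N)) :=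
  contactPart ε 0 ⊔ contactPart ε 1

theorem contactPart_le (ε : Fin N → ℤ) (p : ZMod 2) : contactPart ε p ≤ contactAlgebra ε := by
  rcases parity_cases p with rfl | rfl
  · exact le_sup_left
  · exact le_sup_right

/-- The operator `D^ε = ∂_t - (1/2) t⁻¹ ∑ ε_i ξ_i ∂_i`. -/
def Deps (ε : Fin N → ℤ) : Module.End ℂ (SA N) :=
  pdt - ∑ i, ((1 / 2 : ℂ) * (ε i : ℂ)) • (LinearMap.mulLeft ℂ (tpow (-1) * xi i) * pdxi i)

/-- The operator `Δ`, `Δ f = 2 f - ∑ ξ_i ∂_i f`. -/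
def Delta : Module.End ℂ (SA N) :=
  (2 : ℂ) • LinearMap.id - ∑ i, LinearMap.mulLeft ℂ (xi i) * pdxi i

/-- The contact vector field
`D_f = (Δ f) D^ε + ∑ D^ε(f) ξ_i ∂_i + (-1)^{|f|} ∑ t^{-ε_i} ∂_i(f) ∂_i`. -/
def contactField (ε : Fin N → ℤ) : SA N →ₗ[ℂ] Module.End ℂ (SA N) :=
  LinearMap.mk₂ ℂ (fun f g => Delta f * Deps ε g + ∑ i, Deps ε f * xi i * pdxi i g
      + ∑ i, tpow (-ε i) * pdxi i (parity f) * pdxi i g)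
    (by
      intro f f' g
      simp only [map_add, mul_add, add_mul, Finset.sum_add_distrib]
      abel)
    (by
      intro c f g
      simp only [map_smul, mul_smul_comm, smul_mul_assoc, smul_add, Finset.smul_sum])
    (by
      intro f g g'
      simp only [map_add, mul_add, Finset.sum_add_distrib]
      abel)
    (by
      intro c f g
      simp only [map_smul, mul_smul_comm, smul_add, Finset.smul_sum])

theorem Deps_apply (ε : Fin N → ℤ) (f : SA N) : Deps ε f = pdt f
    - ∑ i, ((1 / 2 : ℂ) * (ε i : ℂ)) • (tpow (-1) * xi i * pdxi i f) := by
  simp only [Deps, LinearMap.sub_apply, LinearMap.sum_apply, LinearMap.smul_apply,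
    Module.End.mul_apply, LinearMap.mulLeft_apply]

theorem Delta_apply (f : SA N) : Delta f = (2 : ℂ) • f - ∑ i, xi i * pdxi i f := by
  simp only [Delta, LinearMap.sub_apply, LinearMap.sum_apply, LinearMap.smul_apply,
    Module.End.mul_apply, LinearMap.mulLeft_apply, LinearMap.id_apply]

theorem contactField_apply (ε : Fin N → ℤ) (f g : SA N) :
    contactField ε f g = Delta f * Deps ε g + ∑ i, Deps ε f * xi i * pdxi i g
      + ∑ i, tpow (-ε i) * pdxi i (parity f) * pdxi i g := rfl

/-! ### `f ↦ D_f` is a bijection from `𝒜` onto `𝒦(N; ε)` -/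

theorem one_mem_homog : (1 : SA N) ∈ homog 0 := by
  show parity 1 = _; simp [sgn]

theorem tpow_mem_homog (k : ℤ) : (tpow k : SA N) ∈ homog 0 := by
  show parity _ = _; simp [parity_tpow, sgn]

theorem xi_mem_homog (i : Fin N) : (xi i) ∈ homog 1 := by
  show parity _ = _; simp [parity_xi, sgn]

theorem mul_mem_homog {p q : ZMod 2} {f g : SA N} (hf : f ∈ homog p) (hg : g ∈ homog q) :
    f * g ∈ homog (p + q) := by
  have hf' : parity f = sgn p • f := hf
  have hg' : parity g = sgn q • g := hg
  show parity _ = _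
  rw [map_mul, hf', hg', smul_mul_assoc, mul_smul_comm, smul_smul, sgn_add]

theorem apply_mem_homog {p q : ZMod 2} {D : Module.End ℂ (SA N)} {f : SA N}
    (hD : D ∈ superDer N p) (hf : f ∈ homog q) : D f ∈ homog (p + q) := by
  have hf' : parity f = sgn q • f := hf
  show parity _ = _
  rw [hD.1, hf', map_smul, smul_smul, sgn_add]

theorem pdt_mem_superDer : (pdt : Module.End ℂ (SA N)) ∈ superDer N 0 := by
  refine ⟨fun f => by simp [sgn, parity_pdt], fun f g => ?_⟩
  simp [parityPow, pdt_mul]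

theorem pdxi_mem_superDer (i : Fin N) : (pdxi i : Module.End ℂ (SA N)) ∈ superDer N 1 := by
  refine ⟨fun f => by simp [sgn, parity_pdxi], fun f g => ?_⟩
  simp [parityPow, pdxi_mul]

theorem parityPow_add (p q : ZMod 2) (f : SA N) :
    parityPow (p + q) f = parityPow p (parityPow q f) := by
  rcases parity_cases p with rfl | rfl <;> rcases parity_cases q with rfl | rfl <;>
    simp [parityPow, show (1 : ZMod 2) + 1 = 0 from rfl, parity_parity]

theorem mul_mem_superDer {p q : ZMod 2} {h : SA N} {D : Module.End ℂ (SA N)} (hh : h ∈ homog q)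
    (hD : D ∈ superDer N p) : LinearMap.mulLeft ℂ h * D ∈ superDer N (q + p) := by
  have hh' : parity h = sgn q • h := hh
  refine ⟨fun f => ?_, fun f g => ?_⟩
  · simp only [Module.End.mul_apply, LinearMap.mulLeft_apply, map_mul, hh', hD.1, smul_mul_assoc,
      mul_smul_comm, smul_smul, sgn_add, mul_comm (sgn p)]
  · simp only [Module.End.mul_apply, LinearMap.mulLeft_apply, hD.2, mul_add, parityPow_add,
      ← mul_assoc]
    rw [supercomm hh (parityPow p f)]

theorem Delta_mem_superDer_aux (i : Fin N) :
    LinearMap.mulLeft ℂ (xi i) * pdxi i ∈ superDer N 0 := by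
  have := mul_mem_superDer (xi_mem_homog i) (pdxi_mem_superDer i)
  rwa [show (1 : ZMod 2) + 1 = 0 from rfl] at this

theorem Delta_mem {p : ZMod 2} {f : SA N} (hf : f ∈ homog p) : Delta f ∈ homog p := by
  rw [Delta_apply]
  refine sub_mem (Submodule.smul_mem _ _ hf) (sum_mem fun i _ => ?_)
  have := apply_mem_homog (Delta_mem_superDer_aux i) hf
  rwa [zero_add] at this

theorem Deps_mem_superDer (ε : Fin N → ℤ) : Deps ε ∈ superDer N 0 := by
  refine sub_mem pdt_mem_superDer (sum_mem fun i _ => Submodule.smul_mem _ _ ?_)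
  have := mul_mem_superDer (mul_mem_homog (tpow_mem_homog (-1)) (xi_mem_homog i))
    (pdxi_mem_superDer i)
  rwa [zero_add, show (1 : ZMod 2) + 1 = 0 from rfl] at this

theorem Deps_mem {ε : Fin N → ℤ} {p : ZMod 2} {f : SA N} (hf : f ∈ homog p) :
    Deps ε f ∈ homog p := by
  have := apply_mem_homog (Deps_mem_superDer ε) hf
  rwa [zero_add] at this

theorem contactField_mem_superDer {ε : Fin N → ℤ} {p : ZMod 2} {f : SA N} (hf : f ∈ homog p) :
    contactField ε f ∈ superDer N p := by
  have e11 : (1 : ZMod 2) + 1 = 0 := rfl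
  have h1 := mul_mem_superDer (Delta_mem hf) (Deps_mem_superDer ε)
  rw [add_zero] at h1
  have h2 : ∀ i, LinearMap.mulLeft ℂ (Deps ε f * xi i) * pdxi i ∈ superDer N p := fun i => by
    have := mul_mem_superDer (mul_mem_homog (Deps_mem (ε := ε) hf) (xi_mem_homog i))
      (pdxi_mem_superDer i)
    rwa [add_assoc, e11, add_zero] at this
  have hf' : parity f ∈ homog p := by
    rw [show parity f = sgn p • f from hf]; exact Submodule.smul_mem _ _ hf
  have h3 : ∀ i, LinearMap.mulLeft ℂ (tpow (-ε i) * pdxi i (parity f)) * pdxi i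
      ∈ superDer N p := fun i => by
    have := mul_mem_superDer (mul_mem_homog (tpow_mem_homog (-ε i))
      (apply_mem_homog (pdxi_mem_superDer i) hf')) (pdxi_mem_superDer i)
    rwa [zero_add, add_comm 1 p, add_assoc, e11, add_zero] at this
  have := add_mem (add_mem h1 (sum_mem fun i (_ : i ∈ Finset.univ) => h2 i))
    (sum_mem fun i (_ : i ∈ Finset.univ) => h3 i)
  convert this using 1
  refine LinearMap.ext fun g => ?_
  simp only [contactField_apply, LinearMap.add_apply, LinearMap.sum_apply, Module.End.mul_apply,
    LinearMap.mulLeft_apply]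

theorem superDer_one {p : ZMod 2} {D : Module.End ℂ (SA N)} (hD : D ∈ superDer N p) : D 1 = 0 := by
  have := hD.2 1 1
  simpa using this

theorem superDer_tpow {p : ZMod 2} {D : Module.End ℂ (SA N)} (hD : D ∈ superDer N p) (k : ℤ) :
    D (tpow k) = (k : ℂ) • (tpow (k - 1) * D (tpow 1)) := by
  have hstep : ∀ k : ℤ, D (tpow (k + 1)) = D (tpow k) * tpow 1 + tpow k * D (tpow 1) := fun k => by
    rw [tpow_add, hD.2, parityPow_tpow]
  have hback : ∀ k : ℤ, D (tpow (k - 1)) = (D (tpow k) - tpow (k - 1) * D (tpow 1)) * tpow (-1) :=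
      fun k => by
    have h := hstep (k - 1)
    rw [sub_add_cancel] at h
    rw [h, add_sub_cancel_right, mul_assoc, ← tpow_add, add_neg_cancel, tpow_zero, mul_one]
  induction k using Int.induction_on with
  | zero => simp [tpow_zero, superDer_one hD]
  | succ n ih =>
    rw [hstep, ih, smul_mul_assoc, mul_assoc, ← tpow_mul_comm, ← mul_assoc, ← tpow_add,
      sub_add_cancel, add_sub_cancel_right]
    push_cast
    module
  | pred n ih =>
    rw [hback, ih, sub_mul, smul_mul_assoc, mul_assoc, ← tpow_mul_comm, ← mul_assoc, ← tpow_add,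
      ← sub_eq_add_neg]
    push_cast
    module

theorem superDer_ext {p : ZMod 2} {D E : Module.End ℂ (SA N)} (hD : D ∈ superDer N p)
    (hE : E ∈ superDer N p) (ht : D (tpow 1) = E (tpow 1)) (hx : ∀ i, D (xi i) = E (xi i)) :
    D = E := by
  refine LinearMap.ext fun f => ?_
  induction f using SA_induction with
  | hc c => rw [Algebra.algebraMap_eq_smul_one, map_smul, map_smul, superDer_one hD, superDer_one hE]
  | ht k => rw [superDer_tpow hD, superDer_tpow hE, ht]
  | hx i => exact hx i
  | hadd f g hf hg => simp [hf, hg]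
  | hmul f g hf hg => rw [hD.2, hE.2, hf, hg]

/-- Twice the generating function of a contact field of parity `p`. -/
def twiceHam (ε : Fin N → ℤ) (p : ZMod 2) (D : Module.End ℂ (SA N)) : SA N :=
  D (tpow 1) + sgn p • ∑ i, tpow (ε i) * xi i * D (xi i)

theorem contactField_tpow_one (ε : Fin N → ℤ) (f : SA N) :
    contactField ε f (tpow 1) = Delta f := by
  simp [contactField_apply, Deps_apply, pdt_tpow, pdxi_tpow, tpow_zero]

theorem contactField_xi (ε : Fin N → ℤ) (f : SA N) (j : Fin N) :
    contactField ε f (xi j) = -((1 / 2 : ℂ) * (ε j : ℂ)) • (tpow (-1) * Delta f * xi j)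
      + Deps ε f * xi j + tpow (-ε j) * pdxi j (parity f) := by
  simp only [contactField_apply, Deps_apply (f := xi j), pdt_xi, pdxi_xi, mul_ite, mul_one,
    mul_zero, smul_ite, smul_zero, Finset.sum_ite_eq', Finset.mem_univ, if_true, zero_sub,
    mul_neg, mul_smul_comm, neg_smul]
  rw [← mul_assoc, ← tpow_mul_comm]

theorem lieForm_fst {ε : Fin N → ℤ} {p : ZMod 2} {D : Module.End ℂ (SA N)}
    (hD : D ∈ superDer N p) : (lieForm p D (contactForm ε)).1 = pdt (twiceHam ε p D)
      - sgn p • ∑ i, (ε i : ℂ) • (tpow (ε i - 1) * xi i * D (xi i)) := by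
  have h1 : parity (pdt (D (tpow 1))) = sgn p • pdt (D (tpow 1)) := by
    rw [parity_pdt, hD.1, parity_tpow, map_smul]
  have h2 : ∀ i, parity (pdt (D (xi i))) = - sgn p • pdt (D (xi i)) := fun i => by
    rw [parity_pdt, hD.1, parity_xi, map_neg, smul_neg, map_neg, map_smul, neg_smul]
  rw [contactForm_eq]
  simp only [lieForm, Prod.fst_add, Prod.smul_fst, Prod.fst_sum, dform, superDer_one hD, h1, h2,
    map_one, one_smul, map_smul, map_mul, parityPow_tpow, parityPow_xi, twiceHam, map_add, map_sum,
    pdt_mul, pdt_tpow, pdt_xi, smul_add, smul_smul, sgn_mul_self, smul_eq_mul, mul_smul_comm,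
    smul_mul_assoc, Finset.smul_sum, mul_zero, add_zero, zero_add, Finset.sum_add_distrib]
  have h3 : sgn p * (-sgn p * (-1 * sgn p)) = sgn p := by
    linear_combination sgn p * sgn_mul_self p
  simp only [h3]
  abel

theorem lieForm_snd {ε : Fin N → ℤ} {p : ZMod 2} {D : Module.End ℂ (SA N)}
    (hD : D ∈ superDer N p) (j : Fin N) : (lieForm p D (contactForm ε)).2 j
      = sgn p • pdxi j (twiceHam ε p D) - (2 : ℂ) • (tpow (ε j) * D (xi j))
        - (ε j : ℂ) • (tpow (ε j - 1) * D (tpow 1) * xi j) := by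
  rw [contactForm_eq]
  simp only [lieForm, Prod.snd_add, Prod.smul_snd, Prod.snd_sum, dform, Pi.add_apply,
    Pi.smul_apply, Finset.sum_apply, map_smul, hD.2, superDer_tpow hD (ε j), parityPow_tpow,
    map_one, one_smul, map_mul, parityPow_xi, twiceHam, map_add, map_sum, pdxi_mul, pdxi_tpow,
    pdxi_xi, parity_tpow, parity_xi, smul_add, smul_smul, sgn_mul_self, smul_eq_mul, mul_smul_comm,
    smul_mul_assoc, Finset.smul_sum, zero_mul, zero_add, mul_ite, mul_one, mul_zero, ite_mul,
    mul_neg, neg_mul, Finset.sum_add_distrib, Finset.sum_ite_eq, Finset.mem_univ, if_true,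
    smul_neg]
  simp only [sgn_mul_self, one_smul, one_mul, neg_smul, Finset.sum_neg_distrib]
  module

theorem xi_mul_mul_xi (i : Fin N) (f : SA N) : xi i * (f * xi i) = 0 := by
  rw [← mul_assoc, xi_mul_comm, mul_assoc, xi_mul_self, mul_zero]

theorem tpow_mul_tpow_mul (k l : ℤ) (f : SA N) : tpow k * (tpow l * f) = tpow (k + l) * f := by
  rw [← mul_assoc, ← tpow_add]

theorem xi_tpow_mul (i : Fin N) (k : ℤ) (f : SA N) :
    xi i * (tpow k * f) = tpow k * (xi i * f) := by
  rw [← mul_assoc, ← tpow_mul_comm, mul_assoc]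

theorem xi_mul_contactField {p : ZMod 2} (ε : Fin N → ℤ) {f : SA N} (hf : f ∈ homog p)
    (i : Fin N) :
    xi i * contactField ε f (xi i) = sgn p • (tpow (-ε i) * (xi i * pdxi i f)) := by
  rw [contactField_xi, show parity f = sgn p • f from hf]
  simp only [mul_add, mul_smul_comm, xi_mul_mul_xi, smul_zero, zero_add, map_smul, xi_tpow_mul]

theorem twiceHam_contactField {p : ZMod 2} (ε : Fin N → ℤ) {f : SA N} (hf : f ∈ homog p) :
    twiceHam ε p (contactField ε f) = (2 : ℂ) • f := by
  simp only [twiceHam, contactField_tpow_one, mul_assoc, xi_mul_contactField ε hf, mul_smul_comm,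
    tpow_mul_tpow_mul, add_neg_cancel, tpow_zero, one_mul, Finset.smul_sum, smul_smul,
    sgn_mul_self, one_smul, Delta_apply, sub_add_cancel]

theorem contactField_mem_part {p : ZMod 2} (ε : Fin N → ℤ) {f : SA N} (hf : f ∈ homog p) :
    contactField ε f ∈ contactPart ε p := by
  have hD := contactField_mem_superDer (ε := ε) hf
  refine ⟨hD, (2 : ℂ) • Deps ε f, Prod.ext ?_ (funext fun j => ?_)⟩
  · rw [lieForm_fst hD, twiceHam_contactField ε hf, contactForm_eq]
    simp only [mul_assoc, xi_mul_contactField ε hf, map_smul, Prod.smul_fst, Finset.smul_sum,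
      smul_eq_mul, mul_one, Deps_apply, smul_sub, mul_smul_comm, smul_smul, tpow_mul_tpow_mul]
    congr 1
    refine Finset.sum_congr rfl fun i _ => ?_
    rw [show ε i - 1 + -ε i = -1 by ring]
    congr 1
    linear_combination (ε i : ℂ) * sgn_mul_self p
  · rw [lieForm_snd hD, twiceHam_contactField ε hf, contactForm_eq, contactField_xi,
      contactField_tpow_one, show parity f = sgn p • f from hf]
    simp only [map_smul, Prod.smul_snd, Pi.smul_apply, smul_eq_mul, mul_add, mul_smul_comm,
      smul_mul_assoc, mul_assoc, tpow_mul_tpow_mul, add_neg_cancel, tpow_zero, one_mul, smul_add,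
      smul_smul]
    rw [← mul_assoc (Deps ε f), ← tpow_mul_comm, mul_assoc, ← sub_eq_add_neg]
    module

theorem eq_contactField {p : ZMod 2} {ε : Fin N → ℤ} {D : Module.End ℂ (SA N)}
    (hD : D ∈ contactPart ε p) : (1 / 2 : ℂ) • twiceHam ε p D ∈ homog p ∧
      D = contactField ε ((1 / 2 : ℂ) • twiceHam ε p D) := by
  obtain ⟨hD, P, hP⟩ := hD
  have hh : twiceHam ε p D ∈ homog p := by
    refine add_mem ?_ (Submodule.smul_mem _ _ (sum_mem fun i _ => ?_))
    · simpa using apply_mem_homog hD (tpow_mem_homog 1)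
    · have := mul_mem_homog (mul_mem_homog (tpow_mem_homog (ε i)) (xi_mem_homog i))
        (apply_mem_homog hD (xi_mem_homog i))
      rwa [zero_add, add_comm p, ← add_assoc, show (1 : ZMod 2) + 1 = 0 from rfl, zero_add] at this
  have hh2 : (1 / 2 : ℂ) • twiceHam ε p D ∈ homog p := Submodule.smul_mem _ _ hh
  refine ⟨hh2, ?_⟩
  obtain ⟨f, hf⟩ : ∃ f, f = (1 / 2 : ℂ) • twiceHam ε p D := ⟨_, rfl⟩
  rw [← hf] at hh2 ⊢
  have hu : twiceHam ε p D = (2 : ℂ) • f := by rw [hf, smul_smul]; norm_num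
  have hfst : P = (2 : ℂ) • pdt f
      - sgn p • ∑ i, (ε i : ℂ) • (tpow (ε i - 1) * xi i * D (xi i)) := by
    have := congrArg Prod.fst hP
    rw [lieForm_fst hD, contactForm_eq, hu] at this
    simpa using this.symm
  have hsnd : ∀ j, tpow (ε j) * D (xi j) = sgn p • pdxi j f
      - ((1 / 2 : ℂ) * (ε j : ℂ)) • (tpow (ε j - 1) * D (tpow 1) * xi j)
      + (1 / 2 : ℂ) • (P * (tpow (ε j) * xi j)) := fun j => by
    have := congrFun (congrArg Prod.snd hP) j
    rw [lieForm_snd hD, contactForm_eq, hu] at this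
    simp only [map_smul, Prod.smul_snd, Pi.smul_apply, smul_eq_mul, mul_neg] at this
    have h2 := congrArg (fun x => (1 / 2 : ℂ) • x) this
    simp only [smul_sub, smul_smul, smul_neg] at h2
    norm_num at h2
    rw [show (1 / 2 : ℂ) * (sgn p * 2) = sgn p by ring] at h2
    rw [add_comm, ← sub_eq_iff_eq_add, ← neg_eq_iff_eq_neg.2 h2]
    abel
  have hxi : ∀ j, D (xi j) = sgn p • (tpow (-ε j) * pdxi j f)
      - ((1 / 2 : ℂ) * (ε j : ℂ)) • (tpow (-1) * D (tpow 1) * xi j)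
      + (1 / 2 : ℂ) • (P * xi j) := fun j => by
    have h1 : D (xi j) = tpow (-ε j) * (tpow (ε j) * D (xi j)) := by
      rw [tpow_mul_tpow_mul, neg_add_cancel, tpow_zero, one_mul]
    rw [h1, hsnd j]
    simp only [mul_add, mul_sub, mul_smul_comm, mul_assoc, tpow_mul_tpow_mul]
    rw [← mul_assoc P, ← tpow_mul_comm (ε j) P, mul_assoc, tpow_mul_tpow_mul, neg_add_cancel,
      tpow_zero, one_mul, show -ε j + (ε j - 1) = -1 by ring]
  have hxx : ∀ j, xi j * D (xi j) = sgn p • (tpow (-ε j) * (xi j * pdxi j f)) := fun j => by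
    rw [hxi j]
    simp only [mul_add, mul_sub, mul_smul_comm, xi_mul_mul_xi, smul_zero, sub_zero, add_zero,
      xi_tpow_mul]
  have ht : D (tpow 1) = Delta f := by
    have h1 : D (tpow 1) = twiceHam ε p D - sgn p • ∑ i, tpow (ε i) * xi i * D (xi i) := by
      rw [twiceHam, add_sub_cancel_right]
    rw [h1, hu, Delta_apply]
    simp only [mul_assoc, hxx, mul_smul_comm, tpow_mul_tpow_mul, add_neg_cancel, tpow_zero,
      one_mul, Finset.smul_sum, smul_smul, sgn_mul_self, one_smul]
  have hPD : P = (2 : ℂ) • Deps ε f := by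
    rw [hfst, Deps_apply]
    simp only [mul_assoc, hxx, Finset.smul_sum, smul_sub, mul_smul_comm, smul_smul,
      tpow_mul_tpow_mul]
    congr 1
    refine Finset.sum_congr rfl fun i _ => ?_
    rw [show ε i - 1 + -ε i = -1 by ring]
    congr 1
    linear_combination (ε i : ℂ) * sgn_mul_self p
  refine superDer_ext hD (contactField_mem_superDer hh2) ?_ fun j => ?_
  · rw [contactField_tpow_one, ht]
  · rw [contactField_xi, hxi, hPD, ht, show parity f = sgn p • f from hh2]
    simp only [map_smul, smul_mul_assoc, mul_smul_comm, smul_smul]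
    module

theorem parity_mem_homog {p : ZMod 2} {f : SA N} (hf : f ∈ homog p) : parity f ∈ homog p := by
  rw [show parity f = sgn p • f from hf]; exact Submodule.smul_mem _ _ hf

theorem exists_homog (f : SA N) : ∃ f₀ ∈ homog (N := N) 0, ∃ f₁ ∈ homog (N := N) 1, f = f₀ + f₁ := by
  refine ⟨(1 / 2 : ℂ) • (f + parity f), ?_, (1 / 2 : ℂ) • (f - parity f), ?_, ?_⟩
  · show parity _ = _
    simp only [map_smul, map_add, parity_parity, sgn_zero, one_smul, add_comm]
  · show parity _ = _
    simp only [map_smul, map_sub, parity_parity, sgn_one]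
    module
  · module

theorem contactField_mem (ε : Fin N → ℤ) (f : SA N) : contactField ε f ∈ contactAlgebra ε := by
  obtain ⟨f₀, h₀, f₁, h₁, rfl⟩ := exists_homog f
  rw [map_add]
  exact add_mem (contactPart_le ε 0 (contactField_mem_part ε h₀))
    (contactPart_le ε 1 (contactField_mem_part ε h₁))

theorem parity_Delta (f : SA N) : parity (Delta f) = Delta (parity f) := by
  rw [Delta_apply, Delta_apply]
  simp only [map_sub, map_sum, map_smul, map_mul, parity_xi, parity_pdxi, neg_mul, mul_neg, neg_neg]

theorem contactField_injective (ε : Fin N → ℤ) : Function.Injective (contactField ε) := by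
  refine (injective_iff_map_eq_zero (contactField ε)).2 fun f hf => ?_
  have hD : Delta f = 0 := by rw [← contactField_tpow_one ε, hf]; rfl
  have hx : ∀ j, xi j * pdxi j (parity f) = 0 := fun j => by
    have h := contactField_xi ε f j
    rw [hf, hD, LinearMap.zero_apply] at h
    have h2 := congrArg (fun x => tpow (ε j) * (xi j * x)) h
    simp only [mul_zero, zero_mul, smul_zero, zero_add, mul_add, xi_mul_mul_xi, xi_tpow_mul,
      tpow_mul_tpow_mul, add_neg_cancel, tpow_zero, one_mul] at h2
    exact h2.symm
  have h3 := parity_Delta f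
  rw [hD, map_zero, Delta_apply, Finset.sum_eq_zero (fun j _ => hx j), sub_zero] at h3
  have h4 : parity f = 0 := by
    have := congrArg (fun x => (1 / 2 : ℂ) • x) h3
    simpa [smul_smul] using this.symm
  rw [← parity_parity f, h4, map_zero]

/-- The one-to-one correspondence `f ↔ D_f` between `𝒜` and `𝒦(N; ε)`. -/
def contactEquiv (ε : Fin N → ℤ) : SA N ≃ₗ[ℂ] contactAlgebra ε :=
  LinearEquiv.ofBijective ((contactField ε).codRestrict _ (contactField_mem ε)) <| by
    constructor
    · intro f g h
      exact contactField_injective ε (congrArg Subtype.val h)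
    · rintro ⟨D, hD⟩
      obtain ⟨D₀, h₀, D₁, h₁, rfl⟩ := Submodule.mem_sup.1 hD
      refine ⟨(1 / 2 : ℂ) • twiceHam ε 0 D₀ + (1 / 2 : ℂ) • twiceHam ε 1 D₁, Subtype.ext ?_⟩
      rw [LinearMap.codRestrict_apply, map_add, ← (eq_contactField h₀).2,
        ← (eq_contactField h₁).2]

theorem contactEquiv_coe (ε : Fin N → ℤ) (f : SA N) :
    (contactEquiv ε f : Module.End ℂ (SA N)) = contactField ε f := rfl

/-! ### Closure of `𝒦(N; ε)` under the superbracket -/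

/-- The superbracket `[D, E] = D E - (-1)^{pq} E D` of operators of parities `p` and `q`. -/
def superBracket (p q : ZMod 2) (D E : Module.End ℂ (SA N)) : Module.End ℂ (SA N) :=
  D * E - sgn (p * q) • (E * D)

theorem parity_parityPow (p : ZMod 2) (f : SA N) :
    parity (parityPow p f) = parityPow p (parity f) := by
  rcases parity_cases p with rfl | rfl <;> simp [parityPow]

theorem parityPow_pdxi (p : ZMod 2) (i : Fin N) (f : SA N) :
    parityPow p (pdxi i f) = sgn p • pdxi i (parityPow p f) := by
  rcases parity_cases p with rfl | rfl <;> simp [parityPow, sgn, parity_pdxi]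

theorem parityPow_pdt (p : ZMod 2) (f : SA N) :
    parityPow p (pdt f) = pdt (parityPow p f) := by
  rcases parity_cases p with rfl | rfl <;> simp [parityPow, parity_pdt]

theorem superDer_parityPow {p : ZMod 2} {D : Module.End ℂ (SA N)} (hD : D ∈ superDer N p)
    (q : ZMod 2) (f : SA N) : parityPow q (D f) = sgn (p * q) • D (parityPow q f) := by
  rcases parity_cases q with rfl | rfl <;> simp [parityPow, sgn_zero, hD.1]

theorem superBracket_mem_superDer {p q : ZMod 2} {D E : Module.End ℂ (SA N)}
    (hD : D ∈ superDer N p) (hE : E ∈ superDer N q) : superBracket p q D E ∈ superDer N (p + q) := by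
  refine ⟨fun f => ?_, fun f g => ?_⟩
  · simp only [superBracket, LinearMap.sub_apply, LinearMap.smul_apply, Module.End.mul_apply,
      map_sub, map_smul, hD.1, hE.1, sgn_add, smul_sub, smul_smul]
    congr 2 <;> ring
  · have h1 := superDer_parityPow hE p f
    have h2 := superDer_parityPow hD q f
    simp only [superBracket, LinearMap.sub_apply, LinearMap.smul_apply, Module.End.mul_apply,
      hD.2, hE.2, map_add, h1, h2, sub_mul, mul_sub, smul_add, smul_mul_assoc, mul_smul_comm,
      smul_smul, sgn_mul_self, one_smul, parityPow_add, mul_comm q p]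
    rw [← parityPow_add p q, ← parityPow_add q p, add_comm q p]
    abel

/-- Right multiplication of one-forms by functions. -/
def rmul (η : Form N) (g : SA N) : Form N := (η.1 * parity g, fun i => η.2 i * g)

theorem dform_mul (f g : SA N) : dform (f * g) = rmul (dform f) g + parity f • dform g := by
  refine Prod.ext ?_ (funext fun i => ?_)
  · simp [dform, rmul, pdt_mul]
  · simp [dform, rmul, pdxi_mul]

theorem rmul_dform {q : ZMod 2} {h : SA N} (hh : h ∈ homog q) (g : SA N) :
    rmul (dform h) g = parityPow (q + 1) g • dform h := by
  refine Prod.ext ?_ (funext fun i => ?_)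
  · have h1 : parity (pdt h) ∈ homog q := by
      have := apply_mem_homog pdt_mem_superDer hh
      rw [zero_add] at this
      exact parity_mem_homog this
    simp only [rmul, dform, Prod.smul_fst, smul_eq_mul]
    rw [supercomm h1, parityPow_add]
    simp [parityPow]
  · have h1 := apply_mem_homog (pdxi_mem_superDer i) hh
    simp only [rmul, dform, Prod.smul_snd, Pi.smul_apply, smul_eq_mul]
    rw [supercomm h1, add_comm]

theorem lieForm_form_add (p : ZMod 2) (D : Module.End ℂ (SA N)) (η ζ : Form N) :
    lieForm p D (η + ζ) = lieForm p D η + lieForm p D ζ := by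
  simp only [lieForm, Prod.fst_add, Prod.snd_add, Pi.add_apply, map_add, add_smul,
    Finset.sum_add_distrib, smul_add]
  rw [show ((D η.1 + D ζ.1, fun i => D (η.2 i) + D (ζ.2 i)) : Form N)
    = (D η.1, fun i => D (η.2 i)) + (D ζ.1, fun i => D (ζ.2 i)) from rfl]
  abel

theorem form_smul_comm (c : ℂ) (f : SA N) (η : Form N) : f • c • η = c • f • η := by
  refine Prod.ext ?_ (funext fun i => ?_) <;> simp [mul_smul_comm]

theorem lieForm_fun_smul {p : ZMod 2} {D : Module.End ℂ (SA N)} (hD : D ∈ superDer N p) (f : SA N)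
    (η : Form N) : lieForm p D (f • η) = D f • η + parityPow p f • lieForm p D η := by
  have h : ((D (f • η).1, fun i => D ((f • η).2 i)) : Form N)
      = D f • η + parityPow p f • ((D η.1, fun i => D (η.2 i)) : Form N) := by
    refine Prod.ext ?_ (funext fun i => ?_) <;> simp [hD.2]
  unfold lieForm
  rw [h]
  simp only [Prod.smul_fst, Prod.smul_snd, Pi.smul_apply, smul_eq_mul, map_mul,
    smul_add, form_smul_comm, Finset.smul_sum, smul_smul, add_assoc]

theorem lieForm_form_smul (p : ZMod 2) (D : Module.End ℂ (SA N)) (c : ℂ) (η : Form N) :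
    lieForm p D (c • η) = c • lieForm p D η := by
  have h : ((D (c • η).1, fun i => D ((c • η).2 i)) : Form N)
      = c • ((D η.1, fun i => D (η.2 i)) : Form N) := by
    refine Prod.ext ?_ (funext fun i => ?_) <;> simp
  unfold lieForm
  rw [h]
  simp only [Prod.smul_fst, Prod.smul_snd, Pi.smul_apply, map_smul,
    smul_add, Finset.smul_sum, smul_assoc, smul_comm c (sgn p)]

theorem rmul_add (η ζ : Form N) (g : SA N) : rmul (η + ζ) g = rmul η g + rmul ζ g := by
  refine Prod.ext ?_ (funext fun i => ?_) <;> simp [rmul, add_mul]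

theorem rmul_smul (c : ℂ) (η : Form N) (g : SA N) : rmul (c • η) g = c • rmul η g := by
  refine Prod.ext ?_ (funext fun i => ?_) <;> simp [rmul]

theorem rmul_fun_smul (f : SA N) (η : Form N) (g : SA N) : rmul (f • η) g = f • rmul η g := by
  refine Prod.ext ?_ (funext fun i => ?_) <;> simp [rmul, mul_assoc]

theorem rmul_sum (s : Finset (Fin N)) (η : Fin N → Form N) (g : SA N) :
    rmul (∑ i ∈ s, η i) g = ∑ i ∈ s, rmul (η i) g := by
  induction s using Finset.induction_on with
  | empty => refine Prod.ext ?_ (funext fun i => ?_) <;> simp [rmul]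
  | insert a s ha ih => rw [Finset.sum_insert ha, Finset.sum_insert ha, rmul_add, ih]

theorem lieForm_rmul {p : ZMod 2} {D : Module.End ℂ (SA N)} (hD : D ∈ superDer N p) (η : Form N)
    (g : SA N) : lieForm p D (rmul η g) = rmul (lieForm p D η) g
      + rmul (sgn p • parityPow p η.1, fun i => parityPow p (η.2 i)) (D g) := by
  have ht : D (tpow 1) ∈ homog p := by simpa using apply_mem_homog hD (tpow_mem_homog 1)
  have hx : ∀ i, D (xi i) ∈ homog (p + 1) := fun i => apply_mem_homog hD (xi_mem_homog i)
  have h : ((D (rmul η g).1, fun i => D ((rmul η g).2 i)) : Form N)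
      = rmul ((D η.1, fun i => D (η.2 i)) : Form N) g
        + rmul (sgn p • parityPow p η.1, fun i => parityPow p (η.2 i)) (D g) := by
    refine Prod.ext ?_ (funext fun i => ?_)
    · simp only [rmul, hD.2, Prod.fst_add, hD.1, smul_mul_assoc, mul_smul_comm, smul_smul,
        sgn_mul_self, one_smul]
    · simp only [rmul, hD.2, Prod.snd_add, Pi.add_apply]
  have e : p + 1 + 1 = p := by rw [add_assoc, show (1 : ZMod 2) + 1 = 0 from rfl, add_zero]
  simp only [lieForm, h, rmul_add, rmul_smul, rmul_sum, rmul_fun_smul, rmul_dform ht,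
    fun i => rmul_dform (hx i), e]
  have h2 : parityPow (p + 1) g = parityPow p (parity g) := by
    rw [parityPow_add]; simp [parityPow]
  simp only [rmul, map_mul, h2, smul_smul]
  abel

theorem lieForm_dform {p : ZMod 2} {D : Module.End ℂ (SA N)} (hD : D ∈ superDer N p) (f : SA N) :
    lieForm p D (dform f) = sgn p • dform (D f) := by
  have ht : lieForm p D (dform (tpow 1)) = sgn p • dform (D (tpow 1)) := by
    rw [dform_tpow_one]
    simp only [lieForm, superDer_one hD, map_one, one_smul, Pi.zero_apply, map_zero, zero_smul,
      Finset.sum_const_zero, add_zero]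
    exact zero_add _
  induction f using SA_induction with
  | hc c =>
    have h0 : dform (algebraMap ℂ (SA N) c) = 0 := by
      refine Prod.ext ?_ (funext fun i => ?_) <;> simp [dform, pdt_algebraMap, pdxi_algebraMap]
    have h1 : D (algebraMap ℂ (SA N) c) = 0 := by
      rw [Algebra.algebraMap_eq_smul_one, map_smul, superDer_one hD, smul_zero]
    have h2 : dform (0 : SA N) = 0 := by simpa using dform_smul 0 (0 : SA N)
    have h3 := lieForm_form_smul p D 0 0
    rw [h0, h1, h2, smul_zero]
    simpa using h3
  | ht k =>
    have hd : ∀ k : ℤ, dform (tpow k : SA N) = (k : ℂ) • ((tpow (k - 1) : SA N) • dform (tpow 1 : SA N)) := fun k => by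
      rw [dform_tpow_one]
      refine Prod.ext ?_ (funext fun i => ?_)
      · rw [Prod.smul_fst, Prod.smul_fst]
        simp [dform, pdt_tpow, parity_tpow]
      · rw [Prod.smul_snd, Prod.smul_snd]
        simp [dform, pdxi_tpow]
    have hDt : parity (D (tpow 1)) = sgn p • D (tpow 1) := by rw [hD.1, parity_tpow]
    rw [superDer_tpow hD k, hd k, lieForm_form_smul, lieForm_fun_smul hD, ht, dform_smul, dform_mul,
      rmul_dform (tpow_mem_homog (k - 1)), parity_tpow, parityPow_tpow, superDer_tpow hD (k - 1),
      hd (k - 1), smul_comm (sgn p) (k : ℂ), smul_add (sgn p), form_smul_comm (sgn p)]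
    congr 2
    rw [zero_add, show parityPow 1 (D (tpow 1)) = parity (D (tpow 1)) by simp [parityPow], hDt,
      smul_assoc (sgn p), smul_smul (sgn p), sgn_mul_self, one_smul, form_smul_comm, smul_smul,
      ← tpow_mul_comm, smul_assoc]
  | hx i =>
    have h1 : ∀ j, parityPow p ((Pi.single i 1 : Fin N → SA N) j) • dform (D (xi j))
        = if j = i then dform (D (xi j)) else 0 := fun j => by
      rw [Pi.single_apply]; split_ifs <;> simp
    have h2 : (((D 0, fun j => D ((Pi.single i 1 : Fin N → SA N) j)) : Form N)) = 0 := by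
      refine Prod.ext (map_zero D) (funext fun j => ?_)
      simp only [Pi.single_apply]
      split_ifs <;> simp [superDer_one hD]
    rw [dform_xi]
    simp only [lieForm, h1, map_zero, zero_smul, zero_add, Finset.sum_ite_eq', Finset.mem_univ,
      if_true]
    rw [← map_zero D, h2, zero_add]
  | hadd f g hf hg => rw [dform_add, lieForm_form_add, hf, hg, map_add, dform_add, smul_add]
  | hmul f g hf hg =>
    have h1 : ((sgn p • parityPow p (dform f).1, fun i => parityPow p ((dform f).2 i)) : Form N)
        = sgn p • dform (parityPow p f) := by
      refine Prod.ext ?_ (funext fun i => ?_)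
      · simp [dform, ← parity_parityPow, parityPow_pdt]
      · simp [dform, parityPow_pdxi]
    rw [dform_mul, lieForm_form_add, lieForm_rmul hD, lieForm_fun_smul hD, hf, hg, hD.2, dform_add,
      dform_mul, dform_mul, h1, rmul_smul, rmul_smul, hD.1, form_smul_comm, parity_parityPow]
    have h2 : sgn p • ((sgn p • D (parity f)) • dform g) = D (parity f) • dform g := by
      rw [smul_assoc, smul_smul, sgn_mul_self, one_smul]
    rw [smul_add, smul_add, smul_add, h2]
    abel

theorem lieForm_superBracket {p q : ZMod 2} {D E : Module.End ℂ (SA N)}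
    (hD : D ∈ superDer N p) (hE : E ∈ superDer N q) (f x : SA N) :
    lieForm (p + q) (superBracket p q D E) (f • dform x)
      = lieForm p D (lieForm q E (f • dform x))
        - sgn (p * q) • lieForm q E (lieForm p D (f • dform x)) := by
  have hB := superBracket_mem_superDer hD hE
  rw [lieForm_fun_smul hB, lieForm_dform hB, lieForm_fun_smul hE, lieForm_dform hE,
    lieForm_fun_smul hD, lieForm_dform hD, lieForm_form_add, lieForm_form_add, lieForm_fun_smul hD,
    lieForm_fun_smul hD, lieForm_fun_smul hE, lieForm_fun_smul hE, lieForm_form_smul,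
    lieForm_form_smul, lieForm_dform hD, lieForm_dform hD, lieForm_dform hE, lieForm_dform hE,
    superDer_parityPow hE, superDer_parityPow hD, ← parityPow_add, ← parityPow_add, add_comm q p]
  have h1 : dform (superBracket p q D E x) = dform (D (E x)) - sgn (p * q) • dform (E (D x)) := by
    have := dform_add (superBracket p q D E x) (sgn (p * q) • E (D x))
    rw [dform_smul] at this
    rw [← sub_eq_iff_eq_add.2 this]
    simp [superBracket]
  rw [h1]
  simp only [superBracket, LinearMap.sub_apply, LinearMap.smul_apply, Module.End.mul_apply,
    sub_smul, smul_sub, smul_add, form_smul_comm, smul_assoc, smul_smul, mul_comm q p, sgn_add]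
  rw [show sgn (p * q) * (sgn (p * q) * sgn q) = sgn q by rw [← mul_assoc, sgn_mul_self, one_mul]]
  generalize D (E f) • dform x = a1
  generalize E (D f) • dform x = a2
  generalize parityPow (p + q) f • dform (D (E x)) = a3
  generalize parityPow (p + q) f • dform (E (D x)) = a4
  generalize E (parityPow p f) • dform (D x) = a5
  generalize D (parityPow q f) • dform (E x) = a6
  module

theorem lieForm_superBracket_form {p q : ZMod 2} {D E : Module.End ℂ (SA N)}
    (hD : D ∈ superDer N p) (hE : E ∈ superDer N q) (η : Form N) :
    lieForm (p + q) (superBracket p q D E) η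
      = lieForm p D (lieForm q E η) - sgn (p * q) • lieForm q E (lieForm p D η) := by
  have hη : η = η.1 • dform (tpow 1) + ∑ i, η.2 i • dform (xi i) := by
    simp only [dform_tpow_one, dform_xi]
    refine Prod.ext ?_ (funext fun j => ?_)
    · simp [Prod.fst_sum]
    · simp [Prod.snd_sum, Finset.sum_apply, Pi.single_apply]
  let Lm : ∀ (r : ZMod 2) (B : Module.End ℂ (SA N)), Form N →+ Form N := fun r B =>
    AddMonoidHom.mk' (lieForm r B) (lieForm_form_add r B)
  suffices h : ∀ ζ : Form N, ζ = η → Lm (p + q) (superBracket p q D E) ζ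
      = Lm p D (Lm q E ζ) - sgn (p * q) • Lm q E (Lm p D ζ) from h η rfl
  intro ζ hζ
  have key : ∀ f x : SA N, Lm (p + q) (superBracket p q D E) (f • dform x)
      = Lm p D (Lm q E (f • dform x)) - sgn (p * q) • Lm q E (Lm p D (f • dform x)) :=
    lieForm_superBracket hD hE
  rw [hζ, hη]
  simp only [map_add, map_sum, key, smul_add, Finset.smul_sum, Finset.sum_sub_distrib]
  abel

theorem superBracket_mem {ε : Fin N → ℤ} {p q : ZMod 2} {D E : Module.End ℂ (SA N)}
    (hD : D ∈ contactPart ε p) (hE : E ∈ contactPart ε q) :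
    superBracket p q D E ∈ contactPart ε (p + q) := by
  obtain ⟨hD, P, hP⟩ := hD
  obtain ⟨hE, Q, hQ⟩ := hE
  refine ⟨superBracket_mem_superDer hD hE, (D Q + parityPow p Q * P)
    - sgn (p * q) • (E P + parityPow q P * Q), ?_⟩
  rw [lieForm_superBracket_form hD hE, hQ, hP, lieForm_fun_smul hD, lieForm_fun_smul hE, hP, hQ,
    sub_smul, add_smul, smul_assoc, add_smul, mul_smul, mul_smul]

/-! ### The `D_t`-gradings of `𝒜` and `𝒦(N; ε)` -/

/-- The step `1 + δ_{ε, 𝟏}` of the weight lattice. -/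
def step (ε : Fin N → ℤ) : ℤ := if ε = 1 then 2 else 1

theorem step_ne_zero (ε : Fin N → ℤ) : (step ε : ℂ) ≠ 0 := by
  unfold step; split_ifs <;> norm_num

/-- The eigenspace of `T` with eigenvalue `(1 + δ_{ε, 𝟏}) s`. -/
def weightPart {X : Type*} [AddCommGroup X] [Module ℂ X] (ε : Fin N → ℤ) (T : Module.End ℂ X)
    (s : ℤ) : Submodule ℂ X := T.eigenspace ((step ε : ℂ) * s)

theorem mem_weightPart {X : Type*} [AddCommGroup X] [Module ℂ X] {ε : Fin N → ℤ}
    {T : Module.End ℂ X} {s : ℤ} {x : X} :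
    x ∈ weightPart ε T s ↔ T x = ((step ε : ℂ) * s) • x := Module.End.mem_eigenspace_iff

theorem weightPart_isInternal {X : Type*} [AddCommGroup X] [Module ℂ X] (ε : Fin N → ℤ)
    (T : Module.End ℂ X) (h : ⨆ s, weightPart ε T s = ⊤) :
    DirectSum.IsInternal (weightPart ε T) := by
  refine (DirectSum.isInternal_submodule_iff_iSupIndep_and_iSup_eq_top _).2 ⟨?_, h⟩
  refine T.eigenspaces_iSupIndep.comp (f := fun s : ℤ => (step ε : ℂ) * s) fun s r hsr => ?_
  exact_mod_cast mul_left_cancel₀ (step_ne_zero ε) hsr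

/-- The operator `D_t`. -/
def Dt (ε : Fin N → ℤ) : Module.End ℂ (SA N) := contactField ε (tpow 1)

theorem Dt_mem (ε : Fin N → ℤ) : Dt ε ∈ contactPart ε 0 :=
  contactField_mem_part ε (tpow_mem_homog 1)

theorem Dt_tpow (ε : Fin N → ℤ) (k : ℤ) : Dt ε (tpow k) = (2 * k : ℂ) • tpow k := by
  rw [superDer_tpow (Dt_mem ε).1, Dt, contactField_tpow_one, Delta_apply]
  simp only [pdxi_tpow, mul_zero, Finset.sum_const_zero, sub_zero, mul_smul_comm, ← tpow_add,
    sub_add_cancel, smul_smul, mul_comm]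

theorem Dt_xi (ε : Fin N → ℤ) (i : Fin N) : Dt ε (xi i) = (1 - ε i : ℂ) • xi i := by
  rw [Dt, contactField_xi, parity_tpow, pdxi_tpow, Delta_apply, Deps_apply, pdt_tpow]
  simp only [pdxi_tpow, mul_zero, Finset.sum_const_zero, sub_zero, smul_zero, add_zero,
    mul_smul_comm, ← tpow_add, smul_mul_assoc, smul_smul, neg_add_cancel, tpow_zero, one_mul,
    sub_self, Int.cast_one, one_smul]
  module

theorem Dt_mul (ε : Fin N → ℤ) {c d : ℂ} {f g : SA N} (hf : Dt ε f = c • f) (hg : Dt ε g = d • g) :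
    Dt ε (f * g) = (c + d) • (f * g) := by
  rw [(Dt_mem ε).1.2, hf, hg]
  simp only [parityPow, if_true, AlgHom.id_apply, smul_mul_assoc, mul_smul_comm, add_smul]

theorem exists_step (ε : Fin N → ℤ) (i : Fin N) : ∃ s : ℤ, (1 - ε i : ℂ) = (step ε : ℂ) * s := by
  unfold step
  split_ifs with h
  · exact ⟨0, by simp [h]⟩
  · exact ⟨1 - ε i, by simp⟩

theorem exists_step_two (ε : Fin N → ℤ) : ∃ s : ℤ, (2 : ℂ) = (step ε : ℂ) * s := by
  unfold step
  split_ifs with h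
  · exact ⟨1, by simp⟩
  · exact ⟨2, by simp⟩

theorem iSup_weightPart_SA (ε : Fin N → ℤ) : ⨆ s, weightPart ε (Dt ε) s = ⊤ := by
  have hmem : ∀ {c : ℂ} {f : SA N}, (∃ s : ℤ, c = (step ε : ℂ) * s) → Dt ε f = c • f →
      f ∈ ⨆ s, weightPart ε (Dt ε) s := by
    rintro c f ⟨s, rfl⟩ hf
    exact Submodule.mem_iSup_of_mem s (mem_weightPart.2 hf)
  refine (Submodule.eq_top_iff').2 fun f => ?_
  induction f using SA_induction with
  | hc c =>
    refine hmem ⟨0, rfl⟩ ?_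
    rw [Algebra.algebraMap_eq_smul_one, map_smul, superDer_one (Dt_mem ε).1]
    simp
  | ht k =>
    obtain ⟨s, hs⟩ := exists_step_two ε
    exact hmem ⟨s * k, by rw [hs]; push_cast; ring⟩ (Dt_tpow ε k)
  | hx i => exact hmem (exists_step ε i) (Dt_xi ε i)
  | hadd f g hf hg => exact add_mem hf hg
  | hmul f g hf hg =>
    refine Submodule.iSup_induction _ (motive := fun f => f * g ∈ ⨆ s, weightPart ε (Dt ε) s) hf
      (fun s f hs => ?_) (by simp) (fun f f' h h' => by rw [add_mul]; exact add_mem h h')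
    refine Submodule.iSup_induction _ (motive := fun g => f * g ∈ ⨆ s, weightPart ε (Dt ε) s) hg
      (fun r g hr => ?_) (by simp) (fun f f' h h' => by rw [mul_add]; exact add_mem h h')
    exact hmem ⟨s + r, by push_cast; ring⟩
      (Dt_mul ε (mem_weightPart.1 hs) (mem_weightPart.1 hr))

/-- `ad D_t` on `𝒦(N; ε)`. -/
def adDt (ε : Fin N → ℤ) : Module.End ℂ (contactAlgebra ε) where
  toFun x := ⟨Dt ε * x.1 - x.1 * Dt ε, by
    obtain ⟨x, hx⟩ := x
    obtain ⟨x₀, h₀, x₁, h₁, rfl⟩ := Submodule.mem_sup.1 hx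
    have e : Dt ε * (x₀ + x₁) - (x₀ + x₁) * Dt ε
        = superBracket 0 0 (Dt ε) x₀ + superBracket 0 1 (Dt ε) x₁ := by
      simp only [superBracket, zero_mul, sgn_zero, one_smul]
      noncomm_ring
    simp only [e]
    have m₀ := superBracket_mem (Dt_mem ε) h₀
    have m₁ := superBracket_mem (Dt_mem ε) h₁
    exact add_mem (contactPart_le _ _ m₀) (contactPart_le _ _ m₁)⟩
  map_add' x y := Subtype.ext (by simp only [Submodule.coe_add]; noncomm_ring)
  map_smul' c x := Subtype.ext (by
    simp only [Submodule.coe_smul, mul_smul_comm, smul_mul_assoc, smul_sub, RingHom.id_apply])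

theorem commutator_mem {p : ZMod 2} {D E : Module.End ℂ (SA N)} (hD : D ∈ superDer N 0)
    (hE : E ∈ superDer N p) : D * E - E * D ∈ superDer N p := by
  have := superBracket_mem_superDer hD hE
  rwa [superBracket, zero_mul, sgn_zero, one_smul, zero_add] at this

theorem Dt_pdxi (ε : Fin N → ℤ) (j : Fin N) :
    Dt ε * pdxi j - pdxi j * Dt ε = (-(1 - ε j : ℂ)) • pdxi j := by
  refine superDer_ext (commutator_mem (Dt_mem ε).1 (pdxi_mem_superDer j))
    (Submodule.smul_mem _ _ (pdxi_mem_superDer j)) ?_ fun i => ?_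
  · simp only [LinearMap.sub_apply, Module.End.mul_apply, LinearMap.smul_apply, Dt_tpow, pdxi_tpow,
      map_smul, map_zero, smul_zero, sub_zero]
  · simp only [LinearMap.sub_apply, Module.End.mul_apply, LinearMap.smul_apply, Dt_xi, pdxi_xi,
      map_smul]
    split_ifs with h
    · subst h
      rw [superDer_one (Dt_mem ε).1]
      module
    · simp

theorem Dt_Deps (ε : Fin N → ℤ) : Dt ε * Deps ε - Deps ε * Dt ε = (-2 : ℂ) • Deps ε := by
  have ht : Deps ε (tpow 1) = 1 := by simp [Deps_apply, pdt_tpow, pdxi_tpow, tpow_zero]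
  have hx : ∀ i, Deps ε (xi i) = -((1 / 2 : ℂ) * (ε i : ℂ)) • (tpow (-1) * xi i) := fun i => by
    simp [Deps_apply, pdt_xi, pdxi_xi]
  refine superDer_ext (commutator_mem (Dt_mem ε).1 (Deps_mem_superDer ε))
    (Submodule.smul_mem _ _ (Deps_mem_superDer ε)) ?_ fun i => ?_
  · simp only [LinearMap.sub_apply, Module.End.mul_apply, LinearMap.smul_apply, Dt_tpow, ht,
      map_smul, superDer_one (Dt_mem ε).1]
    push_cast
    module
  · simp only [LinearMap.sub_apply, Module.End.mul_apply, LinearMap.smul_apply, Dt_xi, hx,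
      map_smul, Dt_mul ε (Dt_tpow ε (-1)) (Dt_xi ε i)]
    push_cast
    module

theorem Dt_euler (ε : Fin N → ℤ) (j : Fin N) (f : SA N) :
    Dt ε (xi j * pdxi j f) = xi j * pdxi j (Dt ε f) := by
  have h := LinearMap.congr_fun (Dt_pdxi ε j) f
  simp only [LinearMap.sub_apply, Module.End.mul_apply, LinearMap.smul_apply] at h
  rw [(Dt_mem ε).1.2, Dt_xi, eq_add_of_sub_eq h]
  simp only [parityPow, if_true, AlgHom.id_apply, smul_mul_assoc, mul_add, mul_smul_comm]
  module

theorem Dt_Delta (ε : Fin N → ℤ) (f : SA N) : Dt ε (Delta f) = Delta (Dt ε f) := by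
  simp only [Delta_apply, map_sub, map_smul, map_sum, Dt_euler]

theorem parity_Dt (ε : Fin N → ℤ) (f : SA N) : parity (Dt ε f) = Dt ε (parity f) := by
  rw [(Dt_mem ε).1.1, sgn_zero, one_smul]

theorem commutator_Dt_contactField (ε : Fin N → ℤ) {p : ZMod 2} {f : SA N} (hp : f ∈ homog p)
    {c : ℂ} (hf : Dt ε f = c • f) :
    Dt ε * contactField ε f - contactField ε f * Dt ε = (c - 2) • contactField ε f := by
  have hD := contactField_mem_superDer (ε := ε) hp
  have h1 : Dt ε (Delta f) = c • Delta f := by rw [Dt_Delta, hf, map_smul]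
  have h2 : Dt ε (Deps ε f) = (c - 2) • Deps ε f := by
    have h := LinearMap.congr_fun (Dt_Deps ε) f
    simp only [LinearMap.sub_apply, Module.End.mul_apply, LinearMap.smul_apply] at h
    rw [eq_add_of_sub_eq h, hf, map_smul]
    module
  have h3 : ∀ j, Dt ε (pdxi j (parity f)) = (c - (1 - ε j)) • pdxi j (parity f) := fun j => by
    have h := LinearMap.congr_fun (Dt_pdxi ε j) (parity f)
    simp only [LinearMap.sub_apply, Module.End.mul_apply, LinearMap.smul_apply] at h
    rw [eq_add_of_sub_eq h, ← parity_Dt, hf, map_smul, map_smul]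
    module
  refine superDer_ext (commutator_mem (Dt_mem ε).1 hD) (Submodule.smul_mem _ _ hD) ?_ fun j => ?_
  · simp only [LinearMap.sub_apply, Module.End.mul_apply, LinearMap.smul_apply, Dt_tpow, map_smul,
      contactField_tpow_one, h1]
    push_cast
    module
  · simp only [LinearMap.sub_apply, Module.End.mul_apply, LinearMap.smul_apply, Dt_xi, map_smul,
      contactField_xi, map_add, Dt_mul ε (Dt_mul ε (Dt_tpow ε (-1)) h1) (Dt_xi ε j),
      Dt_mul ε h2 (Dt_xi ε j), Dt_mul ε (Dt_tpow ε (-ε j)) (h3 j)]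
    push_cast
    module

theorem homog_le_iSup (ε : Fin N → ℤ) (p : ZMod 2) :
    homog p ≤ ⨆ s, (homog p ⊓ weightPart ε (Dt ε) s) := by
  intro f hf
  have hf' : (1 / 2 : ℂ) • (f + sgn p • parity f) = f := by
    rw [show parity f = sgn p • f from hf, smul_smul, sgn_mul_self]; module
  rw [← hf']
  refine Submodule.iSup_induction (weightPart ε (Dt ε))
    (motive := fun f => (1 / 2 : ℂ) • (f + sgn p • parity f) ∈
      ⨆ s, (homog p ⊓ weightPart ε (Dt ε) s)) (iSup_weightPart_SA ε ▸ Submodule.mem_top)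
      (fun s f hs => ?_) (by simp) (fun f g hf hg => ?_)
  · refine Submodule.smul_mem _ _ (Submodule.mem_iSup_of_mem s ⟨?_, ?_⟩)
    · show parity _ = _
      rw [map_add, map_smul, parity_parity, smul_add, smul_smul, sgn_mul_self]
      module
    · have := mem_weightPart.1 hs
      refine mem_weightPart.2 ?_
      rw [map_add, map_smul, ← parity_Dt, this, map_smul]
      module
  · have := add_mem hf hg
    convert this using 1
    rw [map_add]
    module

theorem contactPart_le_iSup (ε : Fin N → ℤ) (p : ZMod 2) : contactPart ε p ≤ ⨆ s,
    (contactPart ε p ⊓ (weightPart (X := contactAlgebra ε) ε (adDt ε) s).map (contactAlgebra ε).subtype) := by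
  intro D hD
  obtain ⟨hf, hD'⟩ := eq_contactField hD
  rw [hD']
  refine Submodule.iSup_induction (fun s => homog p ⊓ weightPart ε (Dt ε) s)
    (motive := fun f => contactField ε f ∈ ⨆ s, (contactPart ε p ⊓
      (weightPart (X := contactAlgebra ε) ε (adDt ε) s).map (contactAlgebra ε).subtype)) (homog_le_iSup ε p hf)
      (fun s f hs => ?_) (by simp) (fun f g hf hg => by rw [map_add]; exact add_mem hf hg)
  obtain ⟨r, hr⟩ := exists_step_two ε
  refine Submodule.mem_iSup_of_mem (s - r) ⟨contactField_mem_part ε hs.1,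
    contactEquiv ε f, mem_weightPart.2 (Subtype.ext ?_), rfl⟩
  have := commutator_Dt_contactField ε hs.1 (mem_weightPart.1 hs.2)
  refine this.trans ?_
  rw [Submodule.coe_smul, contactEquiv_coe, hr]
  push_cast
  rw [mul_sub]

theorem iSup_weightPart_contact (ε : Fin N → ℤ) : ⨆ s, weightPart (X := contactAlgebra ε) ε (adDt ε) s = ⊤ := by
  have h : ∀ p, contactPart ε p ≤
      (⨆ s, weightPart (X := contactAlgebra ε) ε (adDt ε) s).map (contactAlgebra ε).subtype := fun p => by
    refine (contactPart_le_iSup ε p).trans ?_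
    rw [Submodule.map_iSup]
    exact iSup_mono fun s => inf_le_right
  refine (Submodule.eq_top_iff').2 fun x => ?_
  obtain ⟨y, hy, hxy⟩ := (sup_le (h 0) (h 1) : contactAlgebra ε ≤ _) x.2
  rwa [← show y = x from Subtype.ext hxy]

/-- The decomposition of `𝒜` into homogeneous components. -/
def gradeSA (ε : Fin N → ℤ) : SA N ≃ₗ[ℂ] DirectSum ℤ fun s => weightPart ε (Dt ε) s :=
  (LinearEquiv.ofBijective (DirectSum.coeLinearMap (weightPart ε (Dt ε)))
    (weightPart_isInternal ε _ (iSup_weightPart_SA ε))).symm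

/-- The decomposition of `𝒦(N; ε)` into homogeneous components. -/
def gradeContact (ε : Fin N → ℤ) :
    contactAlgebra ε ≃ₗ[ℂ] DirectSum ℤ fun s => weightPart (X := contactAlgebra ε) ε (adDt ε) s :=
  (LinearEquiv.ofBijective (DirectSum.coeLinearMap (weightPart (X := contactAlgebra ε) ε (adDt ε)))
    (weightPart_isInternal ε _ (iSup_weightPart_contact ε))).symm

theorem gradeSA_coe (ε : Fin N → ℤ) {s : ℤ} (f : weightPart ε (Dt ε) s) :
    gradeSA ε (f : SA N) = DirectSum.lof ℂ ℤ (fun s => weightPart ε (Dt ε) s) s f := by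
  rw [gradeSA, LinearEquiv.symm_apply_eq]
  exact (DirectSum.coeLinearMap_lof _ _ f).symm

theorem gradeContact_coe (ε : Fin N → ℤ) {s : ℤ} (x : weightPart (X := contactAlgebra ε) ε (adDt ε) s) :
    gradeContact ε (x : contactAlgebra ε)
      = DirectSum.lof ℂ ℤ (fun s => weightPart (X := contactAlgebra ε) ε (adDt ε) s) s x := by
  rw [gradeContact, LinearEquiv.symm_apply_eq]
  exact (DirectSum.coeLinearMap_lof _ _ x).symm

/-! ### `𝒜𝒦(N; ε)` modules -/

/-- A homogeneous element of `𝒦(N; ε)`. -/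
def toK {ε : Fin N → ℤ} {p : ZMod 2} {D : Module.End ℂ (SA N)} (hD : D ∈ contactPart ε p) :
    contactAlgebra ε := ⟨D, contactPart_le ε p hD⟩

/-- The element `D_t` of `𝒦(N; ε)`. -/
def DtK (ε : Fin N → ℤ) : contactAlgebra ε := toK (Dt_mem ε)

/-- The structure of an `𝒜𝒦(N; ε)` module on `M`: a module over the Lie superalgebra
`𝒦(N; ε) ⋉ 𝒜` on which `𝒜` acts associatively (with `1` acting as the identity). The
`ℤ/2`-grading of `M` is recorded by its parity operator `v ↦ (-1)^{|v|} v`. -/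
structure AKModule (ε : Fin N → ℤ) (M : Type*) [AddCommGroup M] [Module ℂ M] where
  /-- the parity operator -/
  par : Module.End ℂ M
  /-- the action of `𝒜` -/
  fn : SA N →ₐ[ℂ] Module.End ℂ M
  /-- the action of `𝒦(N; ε)` -/
  lie : contactAlgebra ε →ₗ[ℂ] Module.End ℂ M
  par_par : ∀ v, par (par v) = v
  par_fn : ∀ {p : ZMod 2} {f : SA N}, f ∈ homog p → ∀ v, par (fn f v) = sgn p • fn f (par v)
  par_lie : ∀ {p : ZMod 2} {D : Module.End ℂ (SA N)} (hD : D ∈ contactPart ε p) (v : M),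
    par (lie (toK hD) v) = sgn p • lie (toK hD) (par v)
  lie_lie : ∀ {p q : ZMod 2} {D E : Module.End ℂ (SA N)} (hD : D ∈ contactPart ε p)
    (hE : E ∈ contactPart ε q) (v : M), lie (toK (superBracket_mem hD hE)) v
      = lie (toK hD) (lie (toK hE) v) - sgn (p * q) • lie (toK hE) (lie (toK hD) v)
  lie_fn : ∀ {p q : ZMod 2} {D : Module.End ℂ (SA N)} {f : SA N} (hD : D ∈ contactPart ε p),
    f ∈ homog q → ∀ v : M,
      fn (D f) v = lie (toK hD) (fn f v) - sgn (p * q) • fn f (lie (toK hD) v)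

namespace AKModule

variable {ε : Fin N → ℤ} {M : Type*} [AddCommGroup M] [Module ℂ M]

/-- `S` is an `𝒜𝒦(N; ε)` submodule (in particular, a graded subspace). -/
structure IsSub (P : AKModule ε M) (S : Submodule ℂ M) : Prop where
  par : ∀ v ∈ S, P.par v ∈ S
  fn : ∀ f, ∀ v ∈ S, P.fn f v ∈ S
  lie : ∀ x, ∀ v ∈ S, P.lie x v ∈ S

/-- Simple `𝒜𝒦(N; ε)` modules. -/
def IsSimple (P : AKModule ε M) : Prop :=
  Nontrivial M ∧ ∀ S : Submodule ℂ M, P.IsSub S → S = ⊥ ∨ S = ⊤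

/-- The weight space of weight `μ` with respect to `D_t`. -/
def weightSpace (P : AKModule ε M) (μ : ℂ) : Submodule ℂ M := (P.lie (DtK ε)).eigenspace μ

/-- Membership in the category `𝒥_a(𝒦(N; ε), 𝒜)`: `D_t` acts diagonalizably with
finite-dimensional weight spaces, and the support lies in `a + (1 + δ_{ε, 𝟏}) ℤ`. -/
structure IsJet (P : AKModule ε M) (a : ℂ) : Prop where
  diagonalizable : ⨆ μ : ℂ, P.weightSpace μ = ⊤
  quasifinite : ∀ μ : ℂ, FiniteDimensional ℂ (P.weightSpace μ)
  support : ∀ μ : ℂ, P.weightSpace μ ≠ ⊥ → ∃ m : ℤ, μ = a + (step ε : ℂ) * m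

/-- Isomorphism of `𝒜𝒦(N; ε)` modules. -/
def Isomorphic {M' : Type*} [AddCommGroup M'] [Module ℂ M'] (P : AKModule ε M)
    (Q : AKModule ε M') : Prop :=
  ∃ e : M ≃ₗ[ℂ] M', (∀ v, e (P.par v) = Q.par (e v)) ∧ (∀ f v, e (P.fn f v) = Q.fn f (e v)) ∧
    ∀ x v, e (P.lie x v) = Q.lie x (e v)

/-- The quotient of an `𝒜𝒦(N; ε)` module by a submodule. -/
def quotient (P : AKModule ε M) (S : Submodule ℂ M) (hS : P.IsSub S) : AKModule ε (M ⧸ S) where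
  par := S.mapQ S P.par hS.par
  fn := AlgHom.ofLinearMap
    { toFun := fun f => S.mapQ S (P.fn f) (hS.fn f)
      map_add' := fun f g => by
        refine Submodule.linearMap_qext _ (LinearMap.ext fun v => ?_)
        simp
      map_smul' := fun c f => by
        refine Submodule.linearMap_qext _ (LinearMap.ext fun v => ?_)
        simp }
    (by
      refine Submodule.linearMap_qext _ (LinearMap.ext fun v => ?_)
      simp)
    (fun f g => by
      refine Submodule.linearMap_qext _ (LinearMap.ext fun v => ?_)
      simp)
  lie :=
    { toFun := fun x => S.mapQ S (P.lie x) (hS.lie x)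
      map_add' := fun f g => by
        refine Submodule.linearMap_qext _ (LinearMap.ext fun v => ?_)
        simp
      map_smul' := fun c f => by
        refine Submodule.linearMap_qext _ (LinearMap.ext fun v => ?_)
        simp }
  par_par := by
    rintro ⟨v⟩
    exact congrArg S.mkQ (P.par_par v)
  par_fn := by
    rintro p f hf ⟨v⟩
    exact congrArg S.mkQ (P.par_fn hf v)
  par_lie := by
    rintro p D hD ⟨v⟩
    exact congrArg S.mkQ (P.par_lie hD v)
  lie_lie := by
    rintro p q D E hD hE ⟨v⟩
    exact congrArg S.mkQ (P.lie_lie hD hE v)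
  lie_fn := by
    rintro p q D f hD hf ⟨v⟩
    exact congrArg S.mkQ (P.lie_fn hD hf v)

/-! ### The weighting functor -/

/-- The subspace `(D_t - a - (1 + δ_{ε, 𝟏}) m) P`. -/
def wsub (P : AKModule ε M) (a : ℂ) (m : ℤ) : Submodule ℂ M :=
  LinearMap.range (P.lie (DtK ε) - (a + (step ε : ℂ) * m) • LinearMap.id)

/-- The space `𝔚^{(a)}(P) = ⨁_m P / (D_t - a - (1 + δ_{ε, 𝟏}) m) P`. -/
def Weighted (P : AKModule ε M) (a : ℂ) : Type _ :=
  DirectSum ℤ fun m => M ⧸ P.wsub a m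

instance (P : AKModule ε M) (a : ℂ) : AddCommGroup (P.Weighted a) :=
  inferInstanceAs (AddCommGroup (DirectSum ℤ fun m => M ⧸ P.wsub a m))

instance (P : AKModule ε M) (a : ℂ) : Module ℂ (P.Weighted a) :=
  inferInstanceAs (Module ℂ (DirectSum ℤ fun m => M ⧸ P.wsub a m))

/-- The inclusion of the component of index `m`. -/
def wincl (P : AKModule ε M) (a : ℂ) (m : ℤ) : (M ⧸ P.wsub a m) →ₗ[ℂ] P.Weighted a :=
  (DirectSum.lof ℂ ℤ (fun m => M ⧸ P.wsub a m) m :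
    (M ⧸ P.wsub a m) →ₗ[ℂ] DirectSum ℤ fun m => M ⧸ P.wsub a m)

/-- The linear map on `𝔚^{(a)}(P)` with given components. -/
def wlift (P : AKModule ε M) (a : ℂ) {X : Type*} [AddCommGroup X] [Module ℂ X]
    (F : ∀ m, (M ⧸ P.wsub a m) →ₗ[ℂ] X) : P.Weighted a →ₗ[ℂ] X :=
  (DirectSum.toModule ℂ ℤ X F : (DirectSum ℤ fun m => M ⧸ P.wsub a m) →ₗ[ℂ] X)

theorem wlift_wincl (P : AKModule ε M) (a : ℂ) {X : Type*} [AddCommGroup X] [Module ℂ X]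
    (F : ∀ m, (M ⧸ P.wsub a m) →ₗ[ℂ] X) (m : ℤ) (x : M ⧸ P.wsub a m) :
    P.wlift a F (P.wincl a m x) = F m x := by
  have := DirectSum.toModule_lof (ι := ℤ) (M := fun m => M ⧸ P.wsub a m) ℂ (φ := F) m x
  exact this

/-- The class of `v` in the component of index `m` of `𝔚^{(a)}(P)`. -/
def wmk (P : AKModule ε M) (a : ℂ) (m : ℤ) : M →ₗ[ℂ] P.Weighted a :=
  P.wincl a m ∘ₗ (P.wsub a m).mkQ

theorem weighted_ext {P : AKModule ε M} {a : ℂ} {X : Type*} [AddCommGroup X] [Module ℂ X]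
    {F G : P.Weighted a →ₗ[ℂ] X} (h : ∀ m v, F (P.wmk a m v) = G (P.wmk a m v)) : F = G := by
  refine DirectSum.linearMap_ext ℂ fun m => Submodule.linearMap_qext _ (LinearMap.ext fun v => ?_)
  exact h m v

theorem wmk_congr (P : AKModule ε M) (a : ℂ) {m m' : ℤ} (h : m = m') (v : M) :
    P.wmk a m v = P.wmk a m' v := by rw [h]

/-- The operators on `P` that are homogeneous of degree `(1 + δ_{ε, 𝟏}) s` with respect
to `D_t`. -/
def homogOps (P : AKModule ε M) (s : ℤ) : Submodule ℂ (Module.End ℂ M) where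
  carrier := {T | P.lie (DtK ε) * T - T * P.lie (DtK ε) = ((step ε : ℂ) * s) • T}
  add_mem' := by
    intro T T' h h'
    simp only [Set.mem_ofPred_eq] at *
    rw [smul_add, ← h, ← h']
    noncomm_ring
  zero_mem' := by simp
  smul_mem' := by
    intro c T h
    simp only [Set.mem_ofPred_eq] at *
    rw [smul_comm, ← h, smul_sub, mul_smul_comm, smul_mul_assoc]

theorem wsub_le (P : AKModule ε M) (a : ℂ) {s : ℤ} {T : Module.End ℂ M} (hT : T ∈ P.homogOps s)
    (m : ℤ) : P.wsub a m ≤ (P.wsub a (m + s)).comap T := by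
  rintro _ ⟨v, rfl⟩
  refine ⟨T v, ?_⟩
  have h := LinearMap.congr_fun (show P.lie (DtK ε) * T - T * P.lie (DtK ε)
    = ((step ε : ℂ) * s) • T from hT) v
  simp only [LinearMap.sub_apply, Module.End.mul_apply, LinearMap.smul_apply] at h
  simp only [LinearMap.sub_apply, LinearMap.smul_apply, LinearMap.id_apply, map_sub, map_smul]
  rw [eq_add_of_sub_eq h]
  push_cast
  module

/-- The operator on `𝔚^{(a)}(P)` induced by a homogeneous operator on `P`: it sends the class of
`v` in the component of index `m` to the class of `T v` in the component of index `m + s`. -/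
def shift (P : AKModule ε M) (a : ℂ) (s : ℤ) :
    P.homogOps s →ₗ[ℂ] Module.End ℂ (P.Weighted a) where
  toFun T := P.wlift a fun m => P.wincl a (m + s) ∘ₗ
      (P.wsub a m).mapQ (P.wsub a (m + s)) T.1 (P.wsub_le a T.2 m)
  map_add' T T' := by
    refine weighted_ext fun m v => ?_
    simp [wmk, wlift_wincl]
  map_smul' c T := by
    refine weighted_ext fun m v => ?_
    simp [wmk, wlift_wincl]

theorem shift_wmk (P : AKModule ε M) (a : ℂ) (s : ℤ) (T : P.homogOps s) (m : ℤ) (v : M) :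
    P.shift a s T (P.wmk a m v) = P.wmk a (m + s) (T.1 v) := by
  simp [shift, wmk, wlift_wincl]

theorem lie_DtK_lie (P : AKModule ε M) {p : ZMod 2} {D : Module.End ℂ (SA N)}
    (hD : D ∈ contactPart ε p) : P.lie (DtK ε) * P.lie (toK hD) - P.lie (toK hD) * P.lie (DtK ε)
      = P.lie (adDt ε (toK hD)) := by
  have e : adDt ε (toK hD) = toK (superBracket_mem (Dt_mem ε) hD) := Subtype.ext <| by
    show Dt ε * D - D * Dt ε = superBracket 0 p (Dt ε) D
    rw [superBracket, zero_mul, sgn_zero, one_smul]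
  refine LinearMap.ext fun v => ?_
  have h := P.lie_lie (Dt_mem ε) hD v
  rw [zero_mul, sgn_zero, one_smul] at h
  rw [e, h]
  rfl

theorem lie_comm_adDt (P : AKModule ε M) (x : contactAlgebra ε) :
    P.lie (DtK ε) * P.lie x - P.lie x * P.lie (DtK ε) = P.lie (adDt ε x) := by
  obtain ⟨x, hx⟩ := x
  obtain ⟨x₀, h₀, x₁, h₁, rfl⟩ := Submodule.mem_sup.1 hx
  rw [show (⟨x₀ + x₁, hx⟩ : contactAlgebra ε) = toK h₀ + toK h₁ from rfl]
  simp only [map_add, ← P.lie_DtK_lie h₀, ← P.lie_DtK_lie h₁]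
  noncomm_ring

theorem lie_mem_homogOps (P : AKModule ε M) {s : ℤ} {x : contactAlgebra ε}
    (hx : x ∈ weightPart (X := contactAlgebra ε) ε (adDt ε) s) : P.lie x ∈ P.homogOps s := by
  show _ = _
  rw [P.lie_comm_adDt, mem_weightPart.1 hx, map_smul]

theorem fn_mem_homogOps (P : AKModule ε M) {s : ℤ} {f : SA N}
    (hf : f ∈ weightPart ε (Dt ε) s) : P.fn f ∈ P.homogOps s := by
  have key : ∀ f : SA N, P.lie (DtK ε) * P.fn f - P.fn f * P.lie (DtK ε) = P.fn (Dt ε f) := by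
    have h : ∀ {q : ZMod 2} {f : SA N}, f ∈ homog q →
        P.lie (DtK ε) * P.fn f - P.fn f * P.lie (DtK ε) = P.fn (Dt ε f) := fun {q f} hf => by
      refine LinearMap.ext fun v => ?_
      have h := P.lie_fn (Dt_mem ε) hf v
      rw [zero_mul, sgn_zero, one_smul] at h
      rw [h]
      rfl
    intro f
    obtain ⟨f₀, h₀, f₁, h₁, rfl⟩ := exists_homog f
    simp only [map_add, ← h h₀, ← h h₁]
    noncomm_ring
  show _ = _
  rw [key, mem_weightPart.1 hf, map_smul]

/-- The action of `𝒜` on `𝔚^{(a)}(P)`. -/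
def wfn (P : AKModule ε M) (a : ℂ) : SA N →ₗ[ℂ] Module.End ℂ (P.Weighted a) :=
  DirectSum.toModule ℂ ℤ _ (fun s => P.shift a s ∘ₗ
    (P.fn.toLinearMap.restrict (p := weightPart ε (Dt ε) s) (q := P.homogOps s)
      fun _ hf => P.fn_mem_homogOps hf)) ∘ₗ (gradeSA ε).toLinearMap

/-- The action of `𝒦(N; ε)` on `𝔚^{(a)}(P)`. -/
def wlie (P : AKModule ε M) (a : ℂ) : contactAlgebra ε →ₗ[ℂ] Module.End ℂ (P.Weighted a) :=
  DirectSum.toModule ℂ ℤ _ (fun s => P.shift a s ∘ₗ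
    (P.lie.restrict (p := weightPart (X := contactAlgebra ε) ε (adDt ε) s) (q := P.homogOps s)
      fun _ hx => P.lie_mem_homogOps hx)) ∘ₗ (gradeContact ε).toLinearMap

theorem wfn_wmk (P : AKModule ε M) (a : ℂ) {s : ℤ} {f : SA N} (hf : f ∈ weightPart ε (Dt ε) s)
    (m : ℤ) (v : M) : P.wfn a f (P.wmk a m v) = P.wmk a (m + s) (P.fn f v) := by
  have := gradeSA_coe ε ⟨f, hf⟩
  simp only [wfn, LinearMap.comp_apply, LinearEquiv.coe_coe]
  rw [this, DirectSum.toModule_lof]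
  exact P.shift_wmk a s _ m v

theorem wlie_wmk (P : AKModule ε M) (a : ℂ) {s : ℤ} {x : contactAlgebra ε}
    (hx : x ∈ weightPart (X := contactAlgebra ε) ε (adDt ε) s) (m : ℤ) (v : M) :
    P.wlie a x (P.wmk a m v) = P.wmk a (m + s) (P.lie x v) := by
  have := gradeContact_coe ε ⟨x, hx⟩
  simp only [wlie, LinearMap.comp_apply, LinearEquiv.coe_coe]
  rw [this, DirectSum.toModule_lof]
  exact P.shift_wmk a s _ m v

theorem par_mem_homogOps (P : AKModule ε M) : P.par ∈ P.homogOps 0 := by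
  show _ = _
  refine LinearMap.ext fun v => ?_
  have := P.par_lie (Dt_mem ε) v
  rw [sgn_zero, one_smul] at this
  simp only [LinearMap.sub_apply, Module.End.mul_apply, Int.cast_zero, mul_zero, zero_smul,
    LinearMap.zero_apply]
  rw [DtK, this, sub_self]

/-- The parity operator of `𝔚^{(a)}(P)`. -/
def wpar (P : AKModule ε M) (a : ℂ) : Module.End ℂ (P.Weighted a) :=
  P.shift a 0 ⟨P.par, P.par_mem_homogOps⟩

theorem wpar_wmk (P : AKModule ε M) (a : ℂ) (m : ℤ) (v : M) :
    P.wpar a (P.wmk a m v) = P.wmk a m (P.par v) := by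
  rw [wpar, shift_wmk]
  exact P.wmk_congr a (add_zero m) _

/-- Linear identities in a homogeneous element of `𝒜` may be checked on weight vectors. -/
theorem homog_induction {p : ZMod 2} {C : SA N → Prop} (h0 : C 0)
    (hadd : ∀ f g, f ∈ homog p → g ∈ homog p → C f → C g → C (f + g))
    (hC : ∀ s, ∀ f ∈ homog p, f ∈ weightPart ε (Dt ε) s → C f) {f : SA N} (hf : f ∈ homog p) :
    C f := by
  have : f ∈ homog p ∧ C f :=
    Submodule.iSup_induction (fun s => homog p ⊓ weightPart ε (Dt ε) s)
      (motive := fun f => f ∈ homog p ∧ C f)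
      (homog_le_iSup ε p hf) (fun s f hs => ⟨hs.1, hC s f hs.1 hs.2⟩) ⟨zero_mem _, h0⟩
      (fun f g hf hg => ⟨add_mem hf.1 hg.1, hadd f g hf.1 hg.1 hf.2 hg.2⟩)
  exact this.2

/-- Linear identities in a homogeneous element of `𝒦(N; ε)` may be checked on weight vectors. -/
theorem contactPart_induction {p : ZMod 2} {C : ∀ D, D ∈ contactPart ε p → Prop}
    (h0 : C 0 (zero_mem _))
    (hadd : ∀ D E (hD : D ∈ contactPart ε p) (hE : E ∈ contactPart ε p), C D hD → C E hE →
      C (D + E) (add_mem hD hE))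
    (hC : ∀ s D (hD : D ∈ contactPart ε p), toK hD ∈ weightPart (X := contactAlgebra ε) ε (adDt ε) s → C D hD)
    {D : Module.End ℂ (SA N)} (hD : D ∈ contactPart ε p) : C D hD := by
  obtain ⟨h1, h2⟩ : ∃ hD : D ∈ contactPart ε p, C D hD := by
    have h := contactPart_le_iSup ε p hD
    clear hD
    induction h using Submodule.iSup_induction' with
    | mem s D hs =>
      obtain ⟨h1, y, hy, rfl⟩ := hs
      exact ⟨h1, hC s _ h1 hy⟩
    | zero => exact ⟨zero_mem _, h0⟩
    | add f g _ _ hf hg =>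
      obtain ⟨hf1, hf2⟩ := hf
      obtain ⟨hg1, hg2⟩ := hg
      exact ⟨add_mem hf1 hg1, hadd f g hf1 hg1 hf2 hg2⟩
  exact h2

theorem toK_superBracket_mem {p q : ZMod 2} {D E : Module.End ℂ (SA N)}
    {hD : D ∈ contactPart ε p} {hE : E ∈ contactPart ε q} {s r : ℤ}
    (hs : toK hD ∈ weightPart (X := contactAlgebra ε) ε (adDt ε) s) (hr : toK hE ∈ weightPart (X := contactAlgebra ε) ε (adDt ε) r) :
    toK (superBracket_mem hD hE) ∈ weightPart (X := contactAlgebra ε) ε (adDt ε) (s + r) := by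
  have h1 : Dt ε * D - D * Dt ε = ((step ε : ℂ) * s) • D :=
    congrArg Subtype.val (mem_weightPart.1 hs)
  have h2 : Dt ε * E - E * Dt ε = ((step ε : ℂ) * r) • E :=
    congrArg Subtype.val (mem_weightPart.1 hr)
  refine mem_weightPart.2 (Subtype.ext ?_)
  show Dt ε * superBracket p q D E - superBracket p q D E * Dt ε
    = ((step ε : ℂ) * ((s + r : ℤ) : ℂ)) • superBracket p q D E
  have e1 : Dt ε * (D * E) - (D * E) * Dt ε
      = (Dt ε * D - D * Dt ε) * E + D * (Dt ε * E - E * Dt ε) := by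
    simp only [sub_mul, mul_sub, mul_assoc]; abel
  have e2 : Dt ε * (E * D) - (E * D) * Dt ε
      = (Dt ε * E - E * Dt ε) * D + E * (Dt ε * D - D * Dt ε) := by
    simp only [sub_mul, mul_sub, mul_assoc]; abel
  have e3 : Dt ε * superBracket p q D E - superBracket p q D E * Dt ε
      = (Dt ε * (D * E) - (D * E) * Dt ε) - sgn (p * q) • (Dt ε * (E * D) - (E * D) * Dt ε) := by
    simp only [superBracket, mul_sub, sub_mul, mul_smul_comm, smul_mul_assoc, smul_sub]
    abel
  rw [e3, e1, e2, h1, h2]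
  simp only [superBracket, mul_smul_comm, smul_mul_assoc]
  push_cast
  module

theorem apply_mem_weightPart {p : ZMod 2} {D : Module.End ℂ (SA N)} {hD : D ∈ contactPart ε p}
    {f : SA N} {s r : ℤ} (hs : toK hD ∈ weightPart (X := contactAlgebra ε) ε (adDt ε) s)
    (hr : f ∈ weightPart ε (Dt ε) r) : D f ∈ weightPart ε (Dt ε) (s + r) := by
  have h1 : Dt ε * D - D * Dt ε = ((step ε : ℂ) * s) • D :=
    congrArg Subtype.val (mem_weightPart.1 hs)
  have h2 := LinearMap.congr_fun h1 f
  simp only [LinearMap.sub_apply, Module.End.mul_apply, LinearMap.smul_apply] at h2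
  refine mem_weightPart.2 ?_
  rw [eq_add_of_sub_eq h2, mem_weightPart.1 hr, map_smul]
  push_cast
  module

theorem mul_mem_weightPart {f g : SA N} {s r : ℤ} (hs : f ∈ weightPart ε (Dt ε) s)
    (hr : g ∈ weightPart ε (Dt ε) r) : f * g ∈ weightPart ε (Dt ε) (s + r) := by
  refine mem_weightPart.2 ?_
  rw [Dt_mul ε (mem_weightPart.1 hs) (mem_weightPart.1 hr)]
  push_cast
  rw [mul_add]

theorem wfn_one (P : AKModule ε M) (a : ℂ) : P.wfn a 1 = 1 := by
  refine weighted_ext fun m v => ?_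
  have h1 : (1 : SA N) ∈ weightPart ε (Dt ε) 0 := mem_weightPart.2 (by
    rw [superDer_one (Dt_mem ε).1]; simp)
  rw [P.wfn_wmk a h1, map_one]
  exact P.wmk_congr a (add_zero m) _

theorem SA_weight_induction {C : SA N → Prop} (h0 : C 0) (hadd : ∀ f g, C f → C g → C (f + g))
    (hC : ∀ s, ∀ f ∈ weightPart ε (Dt ε) s, C f) (f : SA N) : C f :=
  Submodule.iSup_induction (weightPart ε (Dt ε)) (motive := C)
    (iSup_weightPart_SA ε ▸ Submodule.mem_top) hC h0 hadd

theorem wfn_mul (P : AKModule ε M) (a : ℂ) (f g : SA N) :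
    P.wfn a (f * g) = P.wfn a f * P.wfn a g := by
  revert g
  refine SA_weight_induction (ε := ε) (C := fun f => ∀ g, P.wfn a (f * g) = P.wfn a f * P.wfn a g)
    (by simp) (fun f f' h h' g => by rw [add_mul, map_add, h, h', map_add, add_mul])
    (fun s f hs g => ?_) f
  refine SA_weight_induction (ε := ε) (C := fun g => P.wfn a (f * g) = P.wfn a f * P.wfn a g)
    (by simp) (fun g g' h h' => by rw [mul_add, map_add, h, h', map_add, mul_add])
    (fun r g hr => ?_) g
  refine weighted_ext fun m v => ?_
  rw [P.wfn_wmk a (mul_mem_weightPart hs hr), Module.End.mul_apply, P.wfn_wmk a hr,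
    P.wfn_wmk a hs, map_mul]
  exact P.wmk_congr a (by ring) _

theorem toK_add {p : ZMod 2} {D E : Module.End ℂ (SA N)} (hD : D ∈ contactPart ε p)
    (hE : E ∈ contactPart ε p) : toK (add_mem hD hE) = toK hD + toK hE := rfl

theorem toK_zero {p : ZMod 2} : toK (zero_mem (contactPart ε p)) = 0 := rfl

/-- The weighting functor `P ↦ 𝔚^{(a)}(P)`: an element `x` of degree `(1 + δ_{ε, 𝟏}) s` sends the
class of `v` in the component of index `m` to the class of `x v` in the component of index
`m + s`. -/
def weighting (P : AKModule ε M) (a : ℂ) : AKModule ε (P.Weighted a) where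
  par := P.wpar a
  fn := AlgHom.ofLinearMap (P.wfn a) (P.wfn_one a) (P.wfn_mul a)
  lie := P.wlie a
  par_par w := by
    have : P.wpar a * P.wpar a = 1 := weighted_ext fun m v => by
      rw [Module.End.mul_apply, wpar_wmk, wpar_wmk, P.par_par]; rfl
    exact LinearMap.congr_fun this w
  par_fn {p f} hf w := by
    suffices h : P.wpar a * P.wfn a f = sgn p • (P.wfn a f * P.wpar a) from LinearMap.congr_fun h w
    refine homog_induction (ε := ε) (C := fun f =>
      P.wpar a * P.wfn a f = sgn p • (P.wfn a f * P.wpar a)) (by simp) (fun f g _ _ h h' => ?_)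
      (fun s f hf hs => ?_) hf
    · rw [map_add, mul_add, h, h', add_mul, smul_add]
    · refine weighted_ext fun m v => ?_
      rw [Module.End.mul_apply, P.wfn_wmk a hs, wpar_wmk, LinearMap.smul_apply,
        Module.End.mul_apply, wpar_wmk, P.wfn_wmk a hs, P.par_fn hf, map_smul]
  par_lie {p D} hD w := by
    suffices h : P.wpar a * P.wlie a (toK hD) = sgn p • (P.wlie a (toK hD) * P.wpar a) from
      LinearMap.congr_fun h w
    refine contactPart_induction (ε := ε) (C := fun D hD =>
      P.wpar a * P.wlie a (toK hD) = sgn p • (P.wlie a (toK hD) * P.wpar a)) (by simp [toK_zero])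
      (fun D E hD hE h h' => ?_) (fun s D hD hs => ?_) hD
    · rw [toK_add, map_add, mul_add, h, h', add_mul, smul_add]
    · refine weighted_ext fun m v => ?_
      rw [Module.End.mul_apply, P.wlie_wmk a hs, wpar_wmk, LinearMap.smul_apply,
        Module.End.mul_apply, wpar_wmk, P.wlie_wmk a hs, P.par_lie hD, map_smul]
  lie_lie {p q D E} hD hE w := by
    suffices h : P.wlie a (toK (superBracket_mem hD hE))
        = P.wlie a (toK hD) * P.wlie a (toK hE)
          - sgn (p * q) • (P.wlie a (toK hE) * P.wlie a (toK hD)) from LinearMap.congr_fun h w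
    revert E
    refine contactPart_induction (ε := ε) (C := fun D hD => ∀ {E} (hE : E ∈ contactPart ε q),
      P.wlie a (toK (superBracket_mem hD hE)) = P.wlie a (toK hD) * P.wlie a (toK hE)
        - sgn (p * q) • (P.wlie a (toK hE) * P.wlie a (toK hD)))
      (fun {E} hE => ?_) (fun D D' hD hD' h h' {E} hE => ?_) (fun s D hD hs {E} hE => ?_) hD
    · have : toK (superBracket_mem (zero_mem (contactPart ε p)) hE) = 0 :=
        Subtype.ext (by simp [toK, superBracket])
      rw [this, toK_zero]
      simp only [map_zero, zero_mul, mul_zero, smul_zero]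
      exact (sub_zero _).symm
    · have : toK (superBracket_mem (add_mem hD hD') hE)
          = toK (superBracket_mem hD hE) + toK (superBracket_mem hD' hE) :=
        Subtype.ext (by
          simp only [toK, superBracket, Submodule.coe_add, add_mul, mul_add, smul_add]; abel)
      rw [this, map_add, h hE, h' hE, toK_add hD hD', map_add]
      simp only [add_mul, mul_add, smul_add]
      abel
    · refine contactPart_induction (ε := ε) (C := fun E hE =>
        P.wlie a (toK (superBracket_mem hD hE)) = P.wlie a (toK hD) * P.wlie a (toK hE)
          - sgn (p * q) • (P.wlie a (toK hE) * P.wlie a (toK hD)))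
        ?_ (fun E E' hE hE' h h' => ?_) (fun r E hE hr => ?_) hE
      · have : toK (superBracket_mem hD (zero_mem (contactPart ε q))) = 0 :=
          Subtype.ext (by simp [toK, superBracket])
        rw [this, toK_zero]
        simp only [map_zero, zero_mul, mul_zero, smul_zero]
        exact (sub_zero _).symm
      · have : toK (superBracket_mem hD (add_mem hE hE'))
            = toK (superBracket_mem hD hE) + toK (superBracket_mem hD hE') :=
          Subtype.ext (by
            simp only [toK, superBracket, Submodule.coe_add, add_mul, mul_add, smul_add]; abel)
        rw [this, map_add, h, h', toK_add hE hE', map_add]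
        simp only [add_mul, mul_add, smul_add]
        abel
      · refine weighted_ext fun m v => ?_
        rw [P.wlie_wmk a (toK_superBracket_mem hs hr), LinearMap.sub_apply, LinearMap.smul_apply,
          Module.End.mul_apply, Module.End.mul_apply, P.wlie_wmk a hr, P.wlie_wmk a hs,
          P.wlie_wmk a hs, P.wlie_wmk a hr, P.lie_lie hD hE, map_sub, map_smul,
          P.wmk_congr a (show m + r + s = m + (s + r) by ring),
          P.wmk_congr a (show m + s + r = m + (s + r) by ring)]
  lie_fn {p q D f} hD hf w := by
    suffices h : P.wfn a (D f) = P.wlie a (toK hD) * P.wfn a f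
          - sgn (p * q) • (P.wfn a f * P.wlie a (toK hD)) from LinearMap.congr_fun h w
    revert f
    refine contactPart_induction (ε := ε) (C := fun D hD => ∀ {f} (hf : f ∈ homog q),
      P.wfn a (D f) = P.wlie a (toK hD) * P.wfn a f
          - sgn (p * q) • (P.wfn a f * P.wlie a (toK hD)))
      (fun {E} hE => ?_) (fun D D' hD hD' h h' {E} hE => ?_) (fun s D hD hs {f} hf => ?_) hD
    · rw [toK_zero]
      simp only [map_zero, zero_mul, mul_zero, smul_zero, LinearMap.zero_apply]
      exact (sub_zero _).symm
    · rw [LinearMap.add_apply, map_add, h hE, h' hE, toK_add hD hD', map_add]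
      simp only [add_mul, mul_add, smul_add]
      abel
    · refine homog_induction (ε := ε) (C := fun f =>
        P.wfn a (D f) = P.wlie a (toK hD) * P.wfn a f
          - sgn (p * q) • (P.wfn a f * P.wlie a (toK hD)))
        (by
          simp only [map_zero, zero_mul, mul_zero, smul_zero]
          exact (sub_zero _).symm)
        (fun E E' hE hE' h h' => ?_) (fun r f hf hr => ?_) hf
      · rw [map_add, map_add, h, h', map_add]
        simp only [add_mul, mul_add, smul_add]
        abel
      · refine weighted_ext fun m v => ?_
        rw [P.wfn_wmk a (apply_mem_weightPart hs hr), LinearMap.sub_apply, LinearMap.smul_apply,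
          Module.End.mul_apply, Module.End.mul_apply, P.wfn_wmk a hr, P.wlie_wmk a hs,
          P.wlie_wmk a hs, P.wfn_wmk a hr, P.lie_fn hD hf, map_sub, map_smul,
          P.wmk_congr a (show m + r + s = m + (s + r) by ring),
          P.wmk_congr a (show m + s + r = m + (s + r) by ring)]

end AKModule

/-! ### The enveloping algebra of `𝒦(N; ε) ⋉ 𝒜` -/

/-- The parity automorphism of `𝒦(N; ε)`, `D ↦ σ D σ` with `σ` the parity automorphism of `𝒜`. -/
def parityK (ε : Fin N → ℤ) : contactAlgebra ε →ₗ[ℂ] contactAlgebra ε where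
  toFun x := ⟨parity.toLinearMap * x.1 * parity.toLinearMap, by
    obtain ⟨x, hx⟩ := x
    obtain ⟨x₀, h₀, x₁, h₁, rfl⟩ := Submodule.mem_sup.1 hx
    have e : parity.toLinearMap * (x₀ + x₁) * parity.toLinearMap = x₀ - x₁ := by
      refine LinearMap.ext fun f => ?_
      simp [h₀.1.1, h₁.1.1, parity_parity, sgn, sub_eq_add_neg]
    simp only [e]
    exact sub_mem (contactPart_le ε 0 h₀) (contactPart_le ε 1 h₁)⟩
  map_add' x y := Subtype.ext (by simp [mul_add, add_mul])
  map_smul' c x := Subtype.ext (by simp)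

theorem parityK_toK {ε : Fin N → ℤ} {p : ZMod 2} {D : Module.End ℂ (SA N)}
    (hD : D ∈ contactPart ε p) : parityK ε (toK hD) = sgn p • toK hD := by
  refine Subtype.ext (LinearMap.ext fun f => ?_)
  simp [parityK, toK, hD.1.1, parity_parity]

/-- The tensor algebra of the vector space `𝒦(N; ε) ⊕ 𝒜`. -/
abbrev Tens (ε : Fin N → ℤ) : Type := TensorAlgebra ℂ (contactAlgebra ε × SA N)

/-- The generator of the tensor algebra given by an element of `𝒦(N; ε)`. -/
def genLie (ε : Fin N → ℤ) : contactAlgebra ε →ₗ[ℂ] Tens ε :=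
  TensorAlgebra.ι ℂ ∘ₗ LinearMap.inl ℂ _ _

/-- The generator of the tensor algebra given by an element of `𝒜`. -/
def genFn (ε : Fin N → ℤ) : SA N →ₗ[ℂ] Tens ε :=
  TensorAlgebra.ι ℂ ∘ₗ LinearMap.inr ℂ _ _

/-- The relations `x y = (-1)^{|x||y|} y x + [x, y]` for homogeneous `x, y ∈ 𝒦(N; ε) ⋉ 𝒜`; here
`[D, f] = D(f)` and `[f, g] = 0` for `D ∈ 𝒦(N; ε)` and `f, g ∈ 𝒜`. -/
inductive EnvRel (ε : Fin N → ℤ) : Tens ε → Tens ε → Prop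
  | lie_lie {p q : ZMod 2} {D E : Module.End ℂ (SA N)} (hD : D ∈ contactPart ε p)
      (hE : E ∈ contactPart ε q) :
      EnvRel ε (genLie ε (toK hD) * genLie ε (toK hE))
        (sgn (p * q) • (genLie ε (toK hE) * genLie ε (toK hD))
          + genLie ε (toK (superBracket_mem hD hE)))
  | lie_fn {p q : ZMod 2} {D : Module.End ℂ (SA N)} {f : SA N} (hD : D ∈ contactPart ε p)
      (hf : f ∈ homog q) :
      EnvRel ε (genLie ε (toK hD) * genFn ε f)
        (sgn (p * q) • (genFn ε f * genLie ε (toK hD)) + genFn ε (D f))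
  | fn_fn {p q : ZMod 2} {f g : SA N} (hf : f ∈ homog p) (hg : g ∈ homog q) :
      EnvRel ε (genFn ε f * genFn ε g) (sgn (p * q) • (genFn ε g * genFn ε f))

/-- The universal enveloping algebra of the Lie superalgebra `𝒦(N; ε) ⋉ 𝒜`. -/
def Env (ε : Fin N → ℤ) : Type := RingQuot (EnvRel ε)

instance (ε : Fin N → ℤ) : Ring (Env ε) := inferInstanceAs (Ring (RingQuot (EnvRel ε)))

instance (ε : Fin N → ℤ) : Algebra ℂ (Env ε) := inferInstanceAs (Algebra ℂ (RingQuot (EnvRel ε)))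

namespace Env

variable {ε : Fin N → ℤ}

/-- The projection of the tensor algebra onto the enveloping algebra. -/
def mk (ε : Fin N → ℤ) : Tens ε →ₐ[ℂ] Env ε :=
  (RingQuot.mkAlgHom ℂ (EnvRel ε) : Tens ε →ₐ[ℂ] RingQuot (EnvRel ε))

/-- The map from `𝒦(N; ε)` to the enveloping algebra. -/
def lie (ε : Fin N → ℤ) : contactAlgebra ε →ₗ[ℂ] Env ε := (mk ε).toLinearMap ∘ₗ genLie ε

/-- The map from `𝒜` to the enveloping algebra. -/
def fn (ε : Fin N → ℤ) : SA N →ₗ[ℂ] Env ε := (mk ε).toLinearMap ∘ₗ genFn ε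

theorem mk_rel {x y : Tens ε} (h : EnvRel ε x y) : mk ε x = mk ε y :=
  RingQuot.mkAlgHom_rel ℂ h

theorem lie_mul_lie {p q : ZMod 2} {D E : Module.End ℂ (SA N)} (hD : D ∈ contactPart ε p)
    (hE : E ∈ contactPart ε q) : lie ε (toK hD) * lie ε (toK hE)
      = sgn (p * q) • (lie ε (toK hE) * lie ε (toK hD)) + lie ε (toK (superBracket_mem hD hE)) := by
  simpa [lie] using mk_rel (.lie_lie hD hE)

theorem lie_mul_fn {p q : ZMod 2} {D : Module.End ℂ (SA N)} {f : SA N} (hD : D ∈ contactPart ε p)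
    (hf : f ∈ homog q) : lie ε (toK hD) * fn ε f
      = sgn (p * q) • (fn ε f * lie ε (toK hD)) + fn ε (D f) := by
  simpa [lie, fn] using mk_rel (.lie_fn hD hf)

theorem lie_mul_fn' {p : ZMod 2} {D : Module.End ℂ (SA N)} (hD : D ∈ contactPart ε p) (f : SA N) :
    lie ε (toK hD) * fn ε f = fn ε (parityPow p f) * lie ε (toK hD) + fn ε (D f) := by
  obtain ⟨f₀, h₀, f₁, h₁, rfl⟩ := exists_homog f
  simp only [map_add, mul_add, add_mul, lie_mul_fn hD h₀, lie_mul_fn hD h₁, parityPow_of_mem h₀,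
    parityPow_of_mem h₁, map_smul, smul_mul_assoc]
  abel

theorem induction {C : Env ε → Prop} (hc : ∀ c : ℂ, C (algebraMap ℂ _ c))
    (hl : ∀ {p : ZMod 2} {D : Module.End ℂ (SA N)} (hD : D ∈ contactPart ε p), C (lie ε (toK hD)))
    (hf : ∀ f, C (fn ε f)) (hadd : ∀ x y, C x → C y → C (x + y))
    (hmul : ∀ x y, C x → C y → C (x * y)) (u : Env ε) : C u := by
  obtain ⟨u, rfl⟩ : ∃ x, mk ε x = u := RingQuot.mkAlgHom_surjective ℂ (EnvRel ε) u
  induction u using TensorAlgebra.induction with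
  | algebraMap r => rw [AlgHom.commutes]; exact hc r
  | ι x =>
    obtain ⟨⟨x, hx⟩, f⟩ := x
    obtain ⟨x₀, h₀, x₁, h₁, rfl⟩ := Submodule.mem_sup.1 hx
    have e : mk ε (TensorAlgebra.ι ℂ (⟨x₀ + x₁, hx⟩, f))
        = lie ε (toK h₀) + lie ε (toK h₁) + fn ε f := by
      simp only [lie, fn, genLie, genFn, LinearMap.comp_apply, AlgHom.toLinearMap_apply, ← map_add]
      simp [toK]
    rw [e]
    exact hadd _ _ (hadd _ _ (hl h₀) (hl h₁)) (hf f)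
  | mul a b ha hb => rw [map_mul]; exact hmul _ _ ha hb
  | add a b ha hb => rw [map_add]; exact hadd _ _ ha hb

/-- The parity automorphism of the enveloping algebra. -/
def par (ε : Fin N → ℤ) : Env ε →ₐ[ℂ] Env ε :=
  (RingQuot.liftAlgHom ℂ ⟨TensorAlgebra.lift ℂ (LinearMap.coprod (lie ε ∘ₗ parityK ε)
    (fn ε ∘ₗ parity.toLinearMap)), by
      intro x y h
      cases h with
      | lie_lie hD hE =>
        simp only [genLie, LinearMap.comp_apply, map_mul, map_add, map_smul, TensorAlgebra.lift_ι_apply,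
          LinearMap.coprod_apply, LinearMap.inl_apply, map_zero, add_zero, parityK_toK,
          smul_mul_assoc, mul_smul_comm, lie_mul_lie hD hE, smul_add, sgn_add, mul_smul]
        module
      | @lie_fn p q D f hD hf =>
        have hf' : parity f = sgn q • f := hf
        have hDf : parity (D f) = sgn p • sgn q • D f := by rw [hD.1.1, hf', map_smul]
        simp only [genLie, genFn, LinearMap.comp_apply, map_mul, map_add, map_smul,
          TensorAlgebra.lift_ι_apply, LinearMap.coprod_apply, LinearMap.inl_apply,
          LinearMap.inr_apply, map_zero, add_zero, zero_add, parityK_toK, AlgHom.toLinearMap_apply,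
          hf', hDf, smul_mul_assoc, mul_smul_comm, lie_mul_fn hD hf, smul_add]
        module
      | @fn_fn p q f g hf hg =>
        have hf' : parity f = sgn p • f := hf
        have hg' : parity g = sgn q • g := hg
        have h : fn ε f * fn ε g = sgn (p * q) • (fn ε g * fn ε f) := by
          simpa [fn] using mk_rel (.fn_fn hf hg)
        simp only [genFn, LinearMap.comp_apply, map_mul, map_smul,
          TensorAlgebra.lift_ι_apply, LinearMap.coprod_apply,
          LinearMap.inr_apply, map_zero, zero_add, AlgHom.toLinearMap_apply,
          hf', hg', smul_mul_assoc, mul_smul_comm, h]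
        module⟩ : RingQuot (EnvRel ε) →ₐ[ℂ] Env ε)

theorem par_mk (x : Tens ε) : par ε (mk ε x) = TensorAlgebra.lift ℂ
    (LinearMap.coprod (lie ε ∘ₗ parityK ε) (fn ε ∘ₗ parity.toLinearMap)) x :=
  RingQuot.liftAlgHom_mkAlgHom_apply ℂ _ _ x

theorem par_lie (x : contactAlgebra ε) : par ε (lie ε x) = lie ε (parityK ε x) := by
  rw [lie, LinearMap.comp_apply, AlgHom.toLinearMap_apply, par_mk]
  simp [genLie, lie]

theorem par_fn (f : SA N) : par ε (fn ε f) = fn ε (parity f) := by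
  rw [fn, LinearMap.comp_apply, AlgHom.toLinearMap_apply, par_mk]
  simp [genFn, fn]

theorem par_par (u : Env ε) : par ε (par ε u) = u := by
  induction u using Env.induction with
  | hc c => simp only [AlgHom.commutes]
  | hl hD => simp [par_lie, parityK_toK, smul_smul, sgn_mul_self]
  | hf f => simp only [par_fn, parity_parity]
  | hadd x y hx hy => simp [hx, hy]
  | hmul x y hx hy => simp [hx, hy]

end Env

/-! ### The subalgebra `𝒦_0` and its action on modules over `ℂ z ⊕ 𝔰𝔬_N` -/

/-- The product `ξ_I` of the `ξ_i`, `i ∈ I`, in increasing order. -/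
def xiProd (I : Finset (Fin N)) : SA N := ((I.sort (· ≤ ·)).map xi).prod

/-- The subspace `∑_I (t - 1)^{max(1 - ⌊(|I| + 1) / 3⌋, 0)} ξ_I 𝒜` of `𝒜`. The subalgebra `𝒦_0` of
`𝒦(N; ε)` consists of the `D_f` with `f` in this subspace. -/
def isotropySpace (N : ℕ) : Submodule ℂ (SA N) :=
  ⨆ I : Finset (Fin N), LinearMap.range
    (LinearMap.mulLeft ℂ ((tpow 1 - 1) ^ (1 - (I.card + 1) / 3) * xiProd I))

/-- The evaluation homomorphism `𝒜 → ℂ`, `t ↦ 1`, `ξ_i ↦ 0`. -/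
def evalPt : SA N →ₐ[ℂ] ℂ :=
  (Algebra.TensorProduct.lift (AddMonoidAlgebra.lift ℂ ℂ ℤ 1) ExteriorAlgebra.algebraMapInv
    (fun _ _ => Commute.all _ _) : ℂ[T;T⁻¹] ⊗[ℂ] Grassmann N →ₐ[ℂ] ℂ)

/-- The reductive Lie algebra `ℂ z ⊕ 𝔰𝔬_N`. -/
abbrev Levi (N : ℕ) : Type := ℂ × LieAlgebra.Orthogonal.so (Fin N) ℂ

instance (N : ℕ) : LieRing (Levi N) :=
  letI : LieRing ℂ := LieRing.ofAssociativeRing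
  inferInstanceAs (LieRing (ℂ × LieAlgebra.Orthogonal.so (Fin N) ℂ))

instance (N : ℕ) : LieAlgebra ℂ (Levi N) :=
  letI : LieRing ℂ := LieRing.ofAssociativeRing
  inferInstanceAs (LieAlgebra ℂ (ℂ × LieAlgebra.Orthogonal.so (Fin N) ℂ))

/-- The element `E_{ji} - E_{ij}` of `𝔰𝔬_N`. -/
def soGen (i j : Fin N) : LieAlgebra.Orthogonal.so (Fin N) ℂ :=
  ⟨Matrix.single j i 1 - Matrix.single i j 1, by
    rw [LieAlgebra.Orthogonal.mem_so]
    simp⟩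

/-- The map `𝒦_0 → ℂ z ⊕ 𝔰𝔬_N` in terms of the function `f` for `D_f`: it sends `D_t - D_1` to
`z`, `D_{t ξ_i ξ_j}` to `E_{ji} - E_{ij}`, and kills `D_f` for `f` in
`(t - 1)² 𝒜 + ∑ (t - 1) ξ_i 𝒜 + ∑ (t - 1) ξ_i ξ_j 𝒜 + ∑_{|I| ≥ 3} ξ_I 𝒜`. -/
def symbol : SA N →ₗ[ℂ] Levi N :=
  LinearMap.prod (evalPt.toLinearMap ∘ₗ pdt)
    (∑ i, ∑ j, if i < j then
      LinearMap.toSpanSingleton ℂ _ (soGen i j) ∘ₗ evalPt.toLinearMap ∘ₗ pdxi j ∘ₗ pdxi i else 0)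

theorem evalPt_tpow (k : ℤ) : evalPt (tpow k : SA N) = 1 := by
  refine (Algebra.TensorProduct.lift_tmul _ _ _ _ _).trans ?_
  have h1 : (AddMonoidAlgebra.lift ℂ ℂ ℤ) 1 (T k) = 1 := by
    rw [LaurentPolynomial.T, AddMonoidAlgebra.lift_single]
    simp
  rw [h1, map_one, mul_one]

theorem evalPt_xi (i : Fin N) : evalPt (xi i) = 0 := by
  refine (Algebra.TensorProduct.lift_tmul _ _ _ _ _).trans ?_
  simp [ExteriorAlgebra.algebraMapInv]

theorem evalPt_parity (f : SA N) : evalPt (parity f) = evalPt f := by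
  induction f using SA_induction with
  | hc c => simp only [AlgHom.commutes]
  | ht k => rw [parity_tpow]
  | hx i => simp [parity_xi, evalPt_xi]
  | hadd f g hf hg => simp [hf, hg]
  | hmul f g hf hg => simp [hf, hg]

theorem symbol_parity (f : SA N) : symbol (parity f) = symbol f := by
  have h : ∀ i j, pdxi j (pdxi i (parity f)) = parity (pdxi j (pdxi i f)) := fun i j => by
    rw [parity_pdxi, parity_pdxi, map_neg, neg_neg]
  refine Prod.ext ?_ ?_
  · simp [symbol, ← parity_pdt, evalPt_parity]
  · simp only [symbol, LinearMap.prod_apply, Function.prod_apply, LinearMap.sum_apply]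
    refine Finset.sum_congr rfl fun i _ => Finset.sum_congr rfl fun j _ => ?_
    split_ifs
    · simp only [LinearMap.comp_apply, AlgHom.toLinearMap_apply, h, evalPt_parity]
    · rfl

theorem parity_mem_isotropySpace {f : SA N} (hf : f ∈ isotropySpace N) :
    parity f ∈ isotropySpace N := by
  refine Submodule.iSup_induction _ (motive := fun f => parity f ∈ isotropySpace N) hf ?_ ?_ ?_
  · rintro I _ ⟨g, rfl⟩
    have h : parity (xiProd I) = (-1 : ℂ) ^ I.card • xiProd I := by
      have : ∀ L : List (Fin N), parity (L.map xi).prod = (-1 : ℂ) ^ L.length • (L.map xi).prod := by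
        intro L
        induction L with
        | nil => simp
        | cons a L ih => simp [ih, parity_xi, pow_succ]
      rw [xiProd, this, Finset.length_sort]
    refine Submodule.mem_iSup_of_mem I ⟨(-1 : ℂ) ^ I.card • parity g, ?_⟩
    simp only [LinearMap.mulLeft_apply, map_mul, map_pow, map_sub, map_one, parity_tpow, h,
      mul_smul_comm, smul_mul_assoc]
  · simp
  · intro f g hf hg
    rw [map_add]
    exact add_mem hf hg

/-! ### Induced modules and tensor modules -/

section Induced

variable (ε : Fin N → ℤ) (V : Type*) [AddCommGroup V] [Module ℂ V] [LieRingModule (Levi N) V]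

/-- The relations `u x ⊗ v = u ⊗ x v` for `x ∈ 𝒦_0 ⋉ 𝒜`, where `𝒦_0` acts on `V` through
`ℂ z ⊕ 𝔰𝔬_N`, and `𝒜` acts through the evaluation at `t = 1`, `ξ = 0`. -/
def indRel : Submodule ℂ (Env ε ⊗[ℂ] V) := Submodule.span ℂ
  ({x | ∃ u f v, f ∈ isotropySpace N ∧
      x = (u * Env.lie ε (contactEquiv ε f)) ⊗ₜ[ℂ] v - u ⊗ₜ[ℂ] ⁅symbol f, v⁆} ∪
    {x | ∃ u h v, x = (u * Env.fn ε h) ⊗ₜ[ℂ] v - u ⊗ₜ[ℂ] (evalPt h • v)})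

/-- The space of the induced module `Ind V = U(𝒦(N; ε) ⋉ 𝒜) ⊗_{U(𝒦_0 ⋉ 𝒜)} V`. -/
def Ind : Type _ := (Env ε ⊗[ℂ] V) ⧸ indRel ε V

instance : AddCommGroup (Ind ε V) := inferInstanceAs (AddCommGroup ((Env ε ⊗[ℂ] V) ⧸ indRel ε V))

instance : Module ℂ (Ind ε V) := inferInstanceAs (Module ℂ ((Env ε ⊗[ℂ] V) ⧸ indRel ε V))

namespace Ind

/-- The projection `U(𝒦(N; ε) ⋉ 𝒜) ⊗ V → Ind V`. -/
def mk : Env ε ⊗[ℂ] V →ₗ[ℂ] Ind ε V := (indRel ε V).mkQ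

/-- The operator on `Ind V` induced by an operator preserving the relations. -/
def map (T : Module.End ℂ (Env ε ⊗[ℂ] V)) (hT : indRel ε V ≤ (indRel ε V).comap T) :
    Module.End ℂ (Ind ε V) := ((indRel ε V).mapQ (indRel ε V) T hT : _ ⧸ _ →ₗ[ℂ] _ ⧸ _)

variable {ε V}

theorem map_mk (T : Module.End ℂ (Env ε ⊗[ℂ] V)) (hT : indRel ε V ≤ (indRel ε V).comap T)
    (x : Env ε ⊗[ℂ] V) : map ε V T hT (mk ε V x) = mk ε V (T x) := rfl

theorem hom_ext {X : Type*} [AddCommGroup X] [Module ℂ X] {F G : Ind ε V →ₗ[ℂ] X}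
    (h : ∀ u v, F (mk ε V (u ⊗ₜ v)) = G (mk ε V (u ⊗ₜ v))) : F = G := by
  have h1 : F ∘ₗ mk ε V = G ∘ₗ mk ε V := TensorProduct.ext' h
  refine LinearMap.ext fun x => ?_
  obtain ⟨y, rfl⟩ : ∃ y, mk ε V y = x := Submodule.mkQ_surjective _ x
  exact LinearMap.congr_fun h1 y

theorem mul_mem (w : Env ε) :
    indRel ε V ≤ (indRel ε V).comap (LinearMap.rTensor V (LinearMap.mulLeft ℂ w)) := by
  refine Submodule.span_le.2 ?_
  rintro _ (⟨u, f, v, hf, rfl⟩ | ⟨u, h, v, rfl⟩)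
  · refine Submodule.subset_span (Or.inl ⟨w * u, f, v, hf, ?_⟩)
    simp [mul_assoc]
  · refine Submodule.subset_span (Or.inr ⟨w * u, h, v, ?_⟩)
    simp [mul_assoc]

variable (ε V)

/-- The action of the enveloping algebra on the induced module by left multiplication. -/
def act : Env ε →ₐ[ℂ] Module.End ℂ (Ind ε V) := AlgHom.ofLinearMap
  { toFun := fun w => map ε V (LinearMap.rTensor V (LinearMap.mulLeft ℂ w)) (mul_mem w)
    map_add' := fun w w' => hom_ext fun u v => by
      simp [map_mk, add_mul, TensorProduct.add_tmul]
    map_smul' := fun c w => hom_ext fun u v => by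
      simp [map_mk, ← TensorProduct.smul_tmul'] }
  (hom_ext fun u v => by simp [map_mk])
  (fun w w' => hom_ext fun u v => by simp [map_mk])

variable {ε V}

theorem act_mk (w u : Env ε) (v : V) : act ε V w (mk ε V (u ⊗ₜ v)) = mk ε V ((w * u) ⊗ₜ v) := rfl

theorem mk_fn (h : SA N) (v : V) :
    act ε V (Env.fn ε h) (mk ε V (1 ⊗ₜ v)) = evalPt h • mk ε V (1 ⊗ₜ v) := by
  rw [act_mk, ← map_smul, ← sub_eq_zero, ← map_sub]
  refine (Submodule.Quotient.mk_eq_zero _).2 (Submodule.subset_span (Or.inr ⟨1, h, v, ?_⟩))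
  simp

/-- `𝒜` acts associatively on the induced module. -/
theorem act_fn (x : Ind ε V) : (∀ f g, act ε V (Env.fn ε f) (act ε V (Env.fn ε g) x)
    = act ε V (Env.fn ε (f * g)) x) ∧ act ε V (Env.fn ε 1) x = x := by
  let Z : Submodule ℂ (Ind ε V) :=
    { carrier := {x | (∀ f g, act ε V (Env.fn ε f) (act ε V (Env.fn ε g) x)
        = act ε V (Env.fn ε (f * g)) x) ∧ act ε V (Env.fn ε 1) x = x}
      add_mem' := fun {x y} hx hy =>
        ⟨fun f g => by simp only [map_add, hx.1, hy.1], by simp only [map_add, hx.2, hy.2]⟩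
      zero_mem' := ⟨fun f g => by simp, by simp⟩
      smul_mem' := fun c x hx =>
        ⟨fun f g => by simp only [map_smul, hx.1], by simp only [map_smul, hx.2]⟩ }
  have hZ : ∀ w : Env ε, ∀ x ∈ Z, act ε V w x ∈ Z := by
    intro w
    induction w using Env.induction with
    | hc c =>
      intro x hx
      rw [AlgHom.commutes]
      exact Z.smul_mem c hx
    | @hl p D hD =>
      intro x hx
      have key : ∀ g (y : Ind ε V), act ε V (Env.fn ε g) (act ε V (Env.lie ε (toK hD)) y)
          = act ε V (Env.lie ε (toK hD)) (act ε V (Env.fn ε (parityPow p g)) y)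
            - act ε V (Env.fn ε (D (parityPow p g))) y := fun g y => by
        have h := Env.lie_mul_fn' hD (parityPow p g)
        rw [← parityPow_add, show p + p = 0 by rcases parity_cases p with rfl | rfl <;> rfl,
          show parityPow 0 g = g by simp [parityPow]] at h
        simp only [← Module.End.mul_apply, ← map_mul, h, ← LinearMap.sub_apply, ← map_sub,
          add_sub_cancel_right]
      refine ⟨fun f g => ?_, ?_⟩
      · rw [key g, map_sub, key f, key (f * g), hx.1, hx.1, hx.1, map_mul (parityPow p) f g, hD.1.2, map_add, map_add,
          LinearMap.add_apply, ← parityPow_add,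
          show p + p = 0 by rcases parity_cases p with rfl | rfl <;> rfl,
          show parityPow 0 f = f by simp [parityPow]]
        abel
      · rw [key, map_one, superDer_one hD.1, map_zero, map_zero, hx.2]
        simp
    | hf h =>
      intro x hx
      refine ⟨fun f g => ?_, ?_⟩
      · rw [hx.1, hx.1, hx.1, mul_assoc]
      · rw [hx.1, one_mul]
    | hadd u u' h h' =>
      intro x hx
      rw [map_add]
      exact Z.add_mem (h x hx) (h' x hx)
    | hmul u u' h h' =>
      intro x hx
      rw [map_mul]
      exact h _ (h' x hx)
  have h1 : ∀ v : V, mk ε V (1 ⊗ₜ v) ∈ Z := fun v =>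
    ⟨fun f g => by simp only [mk_fn, map_smul, map_mul, smul_smul, mul_comm],
      by rw [mk_fn, map_one, one_smul]⟩
  obtain ⟨y, rfl⟩ : ∃ y, mk ε V y = x := Submodule.mkQ_surjective _ x
  suffices h : mk ε V y ∈ Z from h
  induction y with
  | zero => rw [map_zero]; exact Z.zero_mem
  | tmul u v =>
    have := hZ u _ (h1 v)
    rwa [act_mk, mul_one] at this
  | add a b ha hb => rw [map_add]; exact Z.add_mem ha hb

theorem par_mem (p : ZMod 2) : indRel ε V ≤ (indRel ε V).comap
    (TensorProduct.map (Env.par ε).toLinearMap (sgn p • LinearMap.id)) := by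
  refine Submodule.span_le.2 ?_
  rintro _ (⟨u, f, v, hf, rfl⟩ | ⟨u, h, v, rfl⟩)
  · have e : parityK ε (contactEquiv ε f) = contactEquiv ε (parity f) := by
      obtain ⟨f₀, h₀, f₁, h₁, rfl⟩ := exists_homog f
      have k₀ : contactEquiv ε f₀ = toK (contactField_mem_part ε h₀) := rfl
      have k₁ : contactEquiv ε f₁ = toK (contactField_mem_part ε h₁) := rfl
      rw [map_add, map_add, map_add, k₀, k₁, parityK_toK, parityK_toK, ← k₀, ← k₁, map_add,
        show parity f₀ = sgn 0 • f₀ from h₀, show parity f₁ = sgn 1 • f₁ from h₁, map_smul, map_smul]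
    have := Submodule.smul_mem (indRel ε V) (sgn p) (Submodule.subset_span
      (Or.inl ⟨Env.par ε u, parity f, v, parity_mem_isotropySpace hf, rfl⟩))
    simpa [Env.par_lie, e, symbol_parity, smul_sub] using this
  · have := Submodule.smul_mem (indRel ε V) (sgn p) (Submodule.subset_span
      (Or.inr ⟨Env.par ε u, parity h, v, rfl⟩))
    simpa [Env.par_fn, evalPt_parity, smul_sub, smul_comm (evalPt h)] using this

variable (ε V)

/-- The parity operator of `Ind V`, where `V` is placed in parity `p`. -/
def par (p : ZMod 2) : Module.End ℂ (Ind ε V) :=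
  map ε V (TensorProduct.map (Env.par ε).toLinearMap (sgn p • LinearMap.id)) (par_mem p)

theorem par_act (p : ZMod 2) (w : Env ε) (x : Ind ε V) :
    par ε V p (act ε V w x) = act ε V (Env.par ε w) (par ε V p x) := by
  suffices h : par ε V p * act ε V w = act ε V (Env.par ε w) * par ε V p from
    LinearMap.congr_fun h x
  refine hom_ext fun u v => ?_
  simp only [Module.End.mul_apply, act_mk, par, map_mk, TensorProduct.map_tmul,
    AlgHom.toLinearMap_apply, map_mul]

end Ind

/-- The induced module `Ind V` as an `𝒜𝒦(N; ε)` module, where `V` is placed in parity `p`. -/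
def indModule (p : ZMod 2) : AKModule ε (Ind ε V) where
  par := Ind.par ε V p
  fn := AlgHom.ofLinearMap ((Ind.act ε V).toLinearMap ∘ₗ Env.fn ε)
    (LinearMap.ext fun x => (Ind.act_fn x).2)
    (fun f g => LinearMap.ext fun x => ((Ind.act_fn x).1 f g).symm)
  lie := (Ind.act ε V).toLinearMap ∘ₗ Env.lie ε
  par_par x := by
    suffices h : Ind.par ε V p * Ind.par ε V p = 1 from LinearMap.congr_fun h x
    refine Ind.hom_ext fun u v => ?_
    simp [Ind.par, Ind.map_mk, Env.par_par, smul_smul, sgn_mul_self]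
  par_fn {q f} hf x := by
    have hf' : parity f = sgn q • f := hf
    refine (Ind.par_act ε V p _ x).trans ?_
    rw [Env.par_fn, hf', map_smul, map_smul]
    rfl
  par_lie {q D} hD x := by
    refine (Ind.par_act ε V p _ x).trans ?_
    rw [Env.par_lie, parityK_toK, map_smul, map_smul]
    rfl
  lie_lie {q r D E} hD hE x := by
    have h := congrArg (Ind.act ε V) (Env.lie_mul_lie hD hE)
    simp only [map_mul, map_add, map_smul] at h
    have h' := LinearMap.congr_fun h x
    simp only [Module.End.mul_apply, LinearMap.add_apply, LinearMap.smul_apply] at h'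
    exact eq_sub_of_add_eq' h'.symm
  lie_fn {q r D f} hD hf x := by
    have h := congrArg (Ind.act ε V) (Env.lie_mul_fn hD hf)
    simp only [map_mul, map_add, map_smul] at h
    have h' := LinearMap.congr_fun h x
    simp only [Module.End.mul_apply, LinearMap.add_apply, LinearMap.smul_apply] at h'
    exact eq_sub_of_add_eq' h'.symm

/-- The tensor module `ℱ_a(V, c) = 𝔚^{(a)}(Ind V)`; here `V` is a `ℂ z ⊕ 𝔰𝔬_N` module placed in
parity `p`, and `c` is the scalar by which `z` acts on `V`. -/
def tensorModule (a : ℂ) (p : ZMod 2) : AKModule ε ((indModule ε V p).Weighted a) :=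
  (indModule ε V p).weighting a

end Induced

end ContactSuper

end

open TensorProduct LaurentPolynomial

noncomputable section

namespace ContactSuper

variable {N : ℕ}

/-! ### The contact bracket on functions -/

/-! By Frobenius reciprocity, a homomorphism out of `Ind V` is the same as a copy of `V` on which
`𝒜` acts by evaluation at the point `t = 1`, `ξ = 0` and `𝒦_0` acts through its symbol. A weight
module `P` usually contains no vector fixed by `t`, so such a copy is sought in the completion `∏
P_{a+sm}`, modelled as sequences `ℤ → M`. A homomorphism from `Ind V` to the completion gives,
component by component, a homomorphism from the weighting of `Ind V` to `P`. If it is nonzero,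
simplicity of `P` makes it surjective, and `P` is then a quotient of the tensor module.

The subspace searched is `fiber`, consisting of the vectors of the completion on which `𝒜` acts by
evaluation. It is nonzero: for a weight vector `w` the formal sum of all `t^k w` is fixed by `t`,
and multiplying by suitable `ξ_i` makes it killed by every `ξ_i` (`fiber_ne_bot`). It is
finite-dimensional: being fixed by `t`, a vector is determined by its components of index `0` and
`1`, which lie in finite-dimensional weight spaces (`finiteDimensional_fiber`). It is stable under
the fields `D_f` vanishing at the point, that is, for `f ∈ stab N` (`ham_mem_fiber`).

The core is the study of a finite-dimensional space `U` stable under these fields. Put `τ = t - 1`,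
and give `τ` order `2` and each `ξ_i` order `1`. As `{τ, τ^{k+1}} = 2k τ^{k+1}`, the operators of
high powers of `τ` are eigenvectors of a commutator map for distinct eigenvalues, hence almost all
vanish. A difference of two brackets extends this to `τ^k f` for all `f`, except in Grassmann degree
`4`; that degree is reached from degree `5` with the help of an index not occurring in the monomial,
which exists because `N ≠ 4` (`exists_ham_tau_pow_mul_eq_zero`). Next, an eigenvector of `D_τ` on
`U` whose eigenvalue has maximal real part is killed by all `f` of order at least `3`, since these
would raise the eigenvalue (`exists_ham_higher_eq_zero`).

Functions of order at least `3` form the kernel of the symbol on `stab N` (`mem_higher_iff`), and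
the symbol is a homomorphism because it records the linearization of `D_f` at the point
(`linPart_eq`, `symbol_contactBracket`). So the stabilizer acts on the vectors killed by that kernel
through `ℂ z ⊕ 𝔰𝔬_N`, and a minimal invariant subspace of homogeneous vectors provides `V`
(`exists_irreducible_symbol_rep`). -/

theorem mul_eq_sgn_smul_mul {p q : ZMod 2} {f g : SA N} (hf : f ∈ homog p) (hg : g ∈ homog q) :
    f * g = sgn (p * q) • (g * f) := by
  rw [supercomm hf, parityPow_of_mem hg, smul_mul_assoc]

/-- The contact bracket `{f, g} = D_f(g) - 2 D^ε(f) g`. -/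
def contactBracket (ε : Fin N → ℤ) (f g : SA N) : SA N :=
  contactField ε f g - (2 : ℂ) • (Deps ε f * g)

theorem contactField_tpow_mul_xi (ε : Fin N → ℤ) {p : ZMod 2} {f : SA N} (hf : f ∈ homog p)
    (i : Fin N) : contactField ε f (tpow (ε i) * xi i)
      = ((1 / 2 : ℂ) * (ε i : ℂ)) • (tpow (ε i - 1) * (Delta f * xi i))
        + tpow (ε i) * (Deps ε f * xi i) + sgn p • pdxi i f := by
  have hD := contactField_mem_superDer (ε := ε) hf
  rw [hD.2, superDer_tpow hD, parityPow_tpow, contactField_tpow_one, contactField_xi,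
    show parity f = sgn p • f from hf]
  simp only [map_smul, smul_mul_assoc, mul_add, mul_smul_comm, mul_assoc, tpow_mul_tpow_mul,
    add_neg_cancel, tpow_zero, one_mul, ← sub_eq_add_neg]
  module

/-- These are the cross terms left over when the generating function of a commutator of contact
fields is expanded by the Leibniz rule. In this combination all terms containing `Delta` cancel. -/
theorem contactBracket_aux (ε : Fin N → ℤ) {p q : ZMod 2} {f g : SA N} (hf : f ∈ homog p)
    (hg : g ∈ homog q) (i : Fin N) :
    (sgn (p * q) * sgn p) • (contactField ε g (tpow (ε i) * xi i) * contactField ε f (xi i))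
      - sgn q • (contactField ε f (tpow (ε i) * xi i) * contactField ε g (xi i))
    = (2 * sgn (p * q)) • (Deps ε g * xi i * pdxi i f)
      + (2 * (sgn (p * q) * sgn q)) • (tpow (-ε i) * pdxi i g * pdxi i f)
      - (2 : ℂ) • (Deps ε f * xi i * pdxi i g) := by
  have e11 : (1 : ZMod 2) + 1 = 0 := rfl
  have ha : pdxi i f ∈ homog (1 + p) := apply_mem_homog (pdxi_mem_superDer i) hf
  have hb : pdxi i g ∈ homog (1 + q) := apply_mem_homog (pdxi_mem_superDer i) hg
  have c1 := mul_eq_sgn_smul_mul ha (mul_mem_homog (Deps_mem (ε := ε) hg) (xi_mem_homog i))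
  have c2 := mul_eq_sgn_smul_mul ha (mul_mem_homog (Delta_mem hg) (xi_mem_homog i))
  have c3 := mul_eq_sgn_smul_mul hb (mul_mem_homog (Deps_mem (ε := ε) hf) (xi_mem_homog i))
  have c4 := mul_eq_sgn_smul_mul hb (mul_mem_homog (Delta_mem hf) (xi_mem_homog i))
  have c5 := mul_eq_sgn_smul_mul ha hb
  have t1 : ∀ (k : ℤ) (x y : SA N), x * (tpow k * y) = tpow k * (x * y) := fun k x y => by
    rw [← mul_assoc, ← tpow_mul_comm, mul_assoc]
  -- Both products in the statement are instances of this one, with `f` and `g` interchanged. Terms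
  -- with two factors `ξ_i` vanish; the remaining ones are matched through the reorderings `c1` to
  -- `c5`.
  have A : ∀ {p q : ZMod 2} {f g : SA N}, f ∈ homog p → g ∈ homog q →
      contactField ε f (tpow (ε i) * xi i) * contactField ε g (xi i)
      = (sgn q * ((1 / 2 : ℂ) * (ε i : ℂ))) • (tpow (-1) * (Delta f * xi i * pdxi i g))
        + sgn q • (Deps ε f * xi i * pdxi i g)
        - (sgn p * ((1 / 2 : ℂ) * (ε i : ℂ))) • (tpow (-1) * (pdxi i f * (Delta g * xi i)))
        + sgn p • (pdxi i f * (Deps ε g * xi i))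
        + (sgn p * sgn q) • (tpow (-ε i) * (pdxi i f * pdxi i g)) := by
    intro p q f g hf hg
    rw [contactField_tpow_mul_xi ε hf, contactField_xi, show parity g = sgn q • g from hg]
    simp only [map_smul, mul_add, add_mul, smul_mul_assoc, mul_smul_comm, mul_assoc,
      t1 _ (Delta f), t1 _ (Deps ε f), t1 _ (pdxi i f), xi_mul_mul_xi, mul_zero, smul_zero, zero_add, add_zero, tpow_mul_tpow_mul,
      xi_tpow_mul, smul_smul, smul_add, neg_smul, mul_neg, sub_eq_add_neg]
    rw [show ε i + -1 + -ε i = -1 by ring, show ε i + -ε i = 0 by ring, tpow_zero, one_mul]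
    module
  rw [A hf hg, A hg hf, c1, c2, c3, c4, mul_assoc (tpow (-ε i)), c5]
  rcases parity_cases p with rfl | rfl <;> rcases parity_cases q with rfl | rfl <;>
    simp only [e11, add_zero, zero_add, mul_zero, mul_one, sgn_zero, sgn_one,
      mul_neg, one_smul, neg_smul] <;> module

/-- A contact field is determined by its generating function `twiceHam`, so it suffices to compute
that function for the commutator. Commutators of operators thereby become a bracket on functions,
which is far easier to evaluate on monomials. -/
theorem superBracket_contactField (ε : Fin N → ℤ) {p q : ZMod 2} {f g : SA N} (hf : f ∈ homog p)
    (hg : g ∈ homog q) : superBracket p q (contactField ε f) (contactField ε g)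
      = contactField ε (contactBracket ε f g) := by
  have hfp := contactField_mem_part ε hf
  have hgp := contactField_mem_part ε hg
  obtain ⟨-, h⟩ := eq_contactField (superBracket_mem hfp hgp)
  refine h.trans (congrArg _ ?_)
  -- `D_f` is applied to the identity `twiceHam (D_g) = 2 g` and expanded by the Leibniz rule. The
  -- second-order terms are exactly those occurring in `twiceHam` of the commutator.
  have h1 : ∀ {p q : ZMod 2} {f g : SA N}, f ∈ homog p → g ∈ homog q →
      (2 : ℂ) • contactField ε f g = contactField ε f (contactField ε g (tpow 1))
        + sgn q • ∑ i, (contactField ε f (tpow (ε i) * xi i) * contactField ε g (xi i)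
          + sgn p • (tpow (ε i) * xi i * contactField ε f (contactField ε g (xi i)))) := by
    intro p q f g hf hg
    rw [← map_smul, ← twiceHam_contactField ε hg, twiceHam, map_add, map_smul, map_sum]
    congr 2
    refine Finset.sum_congr rfl fun i _ => ?_
    rw [(contactField_mem_superDer hf).2 (tpow (ε i) * xi i) (contactField ε g (xi i)),
      map_mul (parityPow p), parityPow_tpow, parityPow_xi]
    simp
  have h2 := h1 hf hg
  have h3 := h1 hg hf
  have h4 : ∑ i, ((sgn (p * q) * sgn p) • (contactField ε g (tpow (ε i) * xi i) *
      contactField ε f (xi i)) - sgn q • (contactField ε f (tpow (ε i) * xi i) *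
      contactField ε g (xi i))) = _ := Finset.sum_congr rfl fun i _ => contactBracket_aux ε hf hg i
  have h5 : twiceHam ε (p + q) (superBracket p q (contactField ε f) (contactField ε g))
      = (2 : ℂ) • contactField ε f g - (2 * sgn (p * q)) • contactField ε g f
        + ∑ i, ((sgn (p * q) * sgn p) • (contactField ε g (tpow (ε i) * xi i) *
      contactField ε f (xi i)) - sgn q • (contactField ε f (tpow (ε i) * xi i) *
      contactField ε g (xi i))) := by
    rw [mul_comm (2 : ℂ), mul_smul, h2, h3, twiceHam]
    simp only [superBracket, LinearMap.sub_apply, LinearMap.smul_apply, Module.End.mul_apply,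
      Finset.sum_add_distrib, Finset.sum_sub_distrib, mul_sub, smul_add, smul_sub,
      ← Finset.smul_sum, smul_smul, mul_smul_comm, sgn_add]
    module
  -- Here `Delta g` and `D^ε f` are interchanged so that this term has the shape `D^ε(f) g` of the
  -- correction in `contactBracket`.
  have h6 : contactField ε g f = sgn (p * q) • (Deps ε f * Delta g)
      + ∑ i, Deps ε g * xi i * pdxi i f + sgn q • ∑ i, tpow (-ε i) * pdxi i g * pdxi i f := by
    rw [contactField_apply, show parity g = sgn q • g from hg,
      mul_eq_sgn_smul_mul (Delta_mem hg) (Deps_mem (ε := ε) hf), mul_comm q p]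
    simp only [map_smul, mul_smul_comm, smul_mul_assoc, Finset.smul_sum]
  rw [h5, h4, h6, contactBracket, Delta_apply]
  simp only [Finset.sum_add_distrib, Finset.sum_sub_distrib, ← Finset.smul_sum, mul_sub,
    mul_smul_comm, smul_add, smul_sub, smul_smul, Finset.mul_sum, mul_assoc]
  rcases parity_cases (p * q) with e | e <;> simp only [e, sgn_zero, sgn_one] <;> module

theorem contactBracket_add_left (ε : Fin N → ℤ) (f f' g : SA N) :
    contactBracket ε (f + f') g = contactBracket ε f g + contactBracket ε f' g := by
  simp only [contactBracket, map_add, LinearMap.add_apply, add_mul, smul_add]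
  abel

theorem contactBracket_add_right (ε : Fin N → ℤ) (f g g' : SA N) :
    contactBracket ε f (g + g') = contactBracket ε f g + contactBracket ε f g' := by
  simp only [contactBracket, map_add, mul_add, smul_add]
  abel


/-! ### Monomials and operators on them -/

/-- The function `τ = t - 1`. -/
def tau : SA N := tpow 1 - 1

/-- The product `ξ_{i_1} ⋯ ξ_{i_k}` for a list of indices. -/
def xiList (L : List (Fin N)) : SA N := (L.map xi).prod

theorem xiList_nil : (xiList [] : SA N) = 1 := rfl

theorem xiList_cons (a : Fin N) (L : List (Fin N)) : xiList (a :: L) = xi a * xiList L := by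
  simp [xiList]

theorem xiList_append (L L' : List (Fin N)) : xiList (L ++ L') = xiList L * xiList L' := by
  simp [xiList]

/-- Lists may be unsorted and have repetitions: products then correspond to concatenation, and no
sorting signs are needed for a spanning set. -/
theorem span_monomials : Submodule.span ℂ
    (Set.range fun x : ℤ × List (Fin N) => tpow x.1 * xiList x.2) = ⊤ := by
  have h1 : (1 : SA N) = tpow 0 * xiList [] := by rw [tpow_zero, xiList_nil, one_mul]
  refine (Submodule.eq_top_iff').2 fun f => ?_
  induction f using SA_induction with
  | hc c =>
    rw [Algebra.algebraMap_eq_smul_one, h1]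
    exact Submodule.smul_mem _ _ (Submodule.subset_span ⟨(0, []), rfl⟩)
  | ht k => exact Submodule.subset_span ⟨(k, []), by simp [xiList_nil]⟩
  | hx i => exact Submodule.subset_span ⟨(0, [i]), by simp [xiList, tpow_zero]⟩
  | hadd f g hf hg => exact add_mem hf hg
  | hmul f g hf hg =>
    have h := Submodule.mul_mem_mul hf hg
    rw [Submodule.span_mul_span] at h
    refine Submodule.span_mono ?_ h
    rintro _ ⟨_, ⟨x, rfl⟩, _, ⟨y, rfl⟩, rfl⟩
    refine ⟨(x.1 + y.1, x.2 ++ y.2), ?_⟩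
    simp only [tpow_add, xiList_append, mul_assoc]
    rw [← mul_assoc (xiList x.2), ← tpow_mul_comm, mul_assoc]

theorem monomial_induction {C : SA N → Prop} (h0 : C 0) (hadd : ∀ f g, C f → C g → C (f + g))
    (hsmul : ∀ (c : ℂ) f, C f → C (c • f)) (hm : ∀ j L, C (tpow j * xiList L)) (f : SA N) : C f := by
  have hf : f ∈ Submodule.span ℂ (Set.range fun x : ℤ × List (Fin N) => tpow x.1 * xiList x.2) :=
    span_monomials ▸ Submodule.mem_top
  induction hf using Submodule.span_induction with
  | mem x hx => obtain ⟨y, rfl⟩ := hx; exact hm _ _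
  | zero => exact h0
  | add x y _ _ hx hy => exact hadd _ _ hx hy
  | smul c x _ hx => exact hsmul c _ hx

theorem xi_mul_xiList_of_mem {a : Fin N} {L : List (Fin N)} (h : a ∈ L) : xi a * xiList L = 0 := by
  induction L with
  | nil => simp at h
  | cons b L ih =>
    rw [xiList_cons]
    rcases List.mem_cons.1 h with rfl | h
    · rw [← mul_assoc, xi_mul_self, zero_mul]
    · rw [← mul_assoc, xi_mul_xi, neg_mul, mul_assoc, ih h, mul_zero, neg_zero]

/-- This lets one pass to duplicate-free lists, whose length counts the indices that occur. -/
theorem xiList_of_not_nodup {L : List (Fin N)} (h : ¬ L.Nodup) : xiList L = 0 := by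
  induction L with
  | nil => simp at h
  | cons b L ih =>
    rw [xiList_cons]
    by_cases hb : b ∈ L
    · exact xi_mul_xiList_of_mem hb
    · rw [ih (fun hL => h (List.nodup_cons.2 ⟨hb, hL⟩)), mul_zero]

theorem parity_xiList (L : List (Fin N)) :
    parity (xiList L) = (-1 : ℂ) ^ L.length • xiList L := by
  induction L with
  | nil => simp [xiList_nil]
  | cons a L ih => simp [xiList_cons, ih, parity_xi, pow_succ]

theorem exists_homog_tpow_mul_xiList (j : ℤ) (L : List (Fin N)) :
    ∃ p, tpow j * xiList L ∈ homog p := by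
  induction L with
  | nil => exact ⟨0, by rw [xiList_nil, mul_one]; exact tpow_mem_homog j⟩
  | cons a L ih =>
    obtain ⟨p, hp⟩ := ih
    refine ⟨1 + p, ?_⟩
    rw [xiList_cons, ← mul_assoc, tpow_mul_comm, mul_assoc]
    exact mul_mem_homog (xi_mem_homog a) hp

theorem pdxi_anticomm (i j : Fin N) (f : SA N) : pdxi i (pdxi j f) = - pdxi j (pdxi i f) := by
  induction f using pure_induction with
  | h0 => simp
  | hp p x =>
    rw [pdxi_pure, pdxi_pure, pdxi_pure, pdxi_pure, CliffordAlgebra.contractLeft_comm,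
      ← neg_one_smul ℂ, pure_smul, neg_one_smul]
  | hadd f g hf hg => simp only [map_add, hf, hg, neg_add]

theorem pdxi_pdxi (i : Fin N) (f : SA N) : pdxi i (pdxi i f) = 0 := by
  have h := pdxi_anticomm i i f
  have h2 : (2 : ℂ) • pdxi i (pdxi i f) = 0 := by
    rw [two_smul]; nth_rw 1 [h]; exact neg_add_cancel _
  simpa using h2

theorem pdxi_xiList_of_notMem {a : Fin N} {L : List (Fin N)} (h : a ∉ L) :
    pdxi a (xiList L) = 0 := by
  induction L with
  | nil => rw [xiList_nil, ← tpow_zero, pdxi_tpow]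
  | cons b L ih =>
    rw [List.mem_cons, not_or] at h
    rw [xiList_cons, pdxi_mul, pdxi_xi, if_neg h.1, ih h.2, zero_mul, mul_zero, add_zero]

/-- The Euler operator `∑ ξ_i ∂_i`. -/
def euler (f : SA N) : SA N := ∑ i, xi i * pdxi i f

theorem Delta_eq (f : SA N) : Delta f = (2 : ℂ) • f - euler f := Delta_apply f

theorem euler_mul (f g : SA N) : euler (f * g) = euler f * g + f * euler g := by
  simp only [euler, Finset.sum_mul, Finset.mul_sum, ← Finset.sum_add_distrib]
  refine Finset.sum_congr rfl fun i _ => ?_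
  have := (Delta_mem_superDer_aux i).2 f g
  simpa [parityPow] using this

theorem euler_tpow (k : ℤ) : euler (tpow k : SA N) = 0 := by simp [euler, pdxi_tpow]

theorem euler_xi (i : Fin N) : euler (xi i) = xi i := by simp [euler, pdxi_xi]

theorem euler_xiList (L : List (Fin N)) : euler (xiList L) = (L.length : ℂ) • xiList L := by
  induction L with
  | nil => rw [xiList_nil, ← tpow_zero, euler_tpow]; simp
  | cons a L ih =>
    rw [xiList_cons, euler_mul, ih, euler_xi, List.length_cons, mul_smul_comm]
    push_cast
    module

theorem Deps_mul (ε : Fin N → ℤ) (f g : SA N) : Deps ε (f * g) = Deps ε f * g + f * Deps ε g := by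
  have := (Deps_mem_superDer ε).2 f g
  simpa [parityPow] using this

theorem Deps_one (ε : Fin N → ℤ) : Deps ε 1 = 0 := superDer_one (Deps_mem_superDer ε)

theorem Deps_tpow (ε : Fin N → ℤ) (k : ℤ) : Deps ε (tpow k) = (k : ℂ) • tpow (k - 1) := by
  simp [Deps_apply, pdt_tpow, pdxi_tpow]

theorem Deps_xi (ε : Fin N → ℤ) (i : Fin N) :
    Deps ε (xi i) = (-(1 / 2 : ℂ) * (ε i : ℂ)) • (tpow (-1) * xi i) := by
  simp [Deps_apply, pdt_xi, pdxi_xi]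

/-- Each generator is an eigenvector of the derivation `t D^ε`, hence so is every monomial. The
eigenvalue, which depends on `ε`, never matters later. -/
theorem Deps_tpow_mul_xiList (ε : Fin N → ℤ) (j : ℤ) (L : List (Fin N)) :
    ∃ c : ℂ, Deps ε (tpow j * xiList L) = c • (tpow (j - 1) * xiList L) := by
  have h : ∃ c : ℂ, Deps ε (xiList L) = c • (tpow (-1) * xiList L) := by
    induction L with
    | nil => exact ⟨0, by rw [xiList_nil, Deps_one, zero_smul]⟩
    | cons a L ih =>
      obtain ⟨c, hc⟩ := ih
      refine ⟨-(1 / 2 : ℂ) * (ε a : ℂ) + c, ?_⟩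
      rw [xiList_cons, Deps_mul, hc, Deps_xi, mul_smul_comm, xi_tpow_mul, add_smul,
        smul_mul_assoc, mul_assoc]
  obtain ⟨c, hc⟩ := h
  refine ⟨j + c, ?_⟩
  rw [Deps_mul, hc, Deps_tpow, mul_smul_comm, tpow_mul_tpow_mul, smul_mul_assoc, add_smul,
    sub_eq_add_neg]

/-! ### Powers of the local coordinate `τ` and contact brackets involving them -/

theorem tau_mul_comm (f : SA N) : tau * f = f * tau := by
  rw [tau, sub_mul, mul_sub, tpow_mul_comm, one_mul, mul_one]


theorem tau_pow_mul_comm (k : ℕ) (f : SA N) : tau ^ k * f = f * tau ^ k :=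
  Commute.pow_left (tau_mul_comm f : Commute tau f) k

theorem parity_tau : parity (tau : SA N) = tau := by simp [tau, parity_tpow]

theorem tau_pow_mem_homog (k : ℕ) : (tau ^ k : SA N) ∈ homog 0 := by
  show parity _ = _
  rw [map_pow, parity_tau, sgn_zero, one_smul]

theorem pdxi_tau_pow (i : Fin N) (k : ℕ) : pdxi i (tau ^ k) = 0 := by
  have h1 : pdxi i (tau : SA N) = 0 := by
    rw [tau, map_sub, pdxi_tpow, ← tpow_zero, pdxi_tpow, sub_zero]
  induction k with
  | zero => rw [pow_zero, ← tpow_zero, pdxi_tpow]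
  | succ k ih => rw [pow_succ, pdxi_mul, ih, h1, zero_mul, mul_zero, add_zero]

theorem pdxi_tau_pow_mul (i : Fin N) (k : ℕ) (f : SA N) :
    pdxi i (tau ^ k * f) = tau ^ k * pdxi i f := by
  rw [pdxi_mul, pdxi_tau_pow, zero_mul, zero_add, map_pow, parity_tau]

theorem euler_tau_pow_mul (k : ℕ) (f : SA N) : euler (tau ^ k * f) = tau ^ k * euler f := by
  rw [euler_mul, euler]
  simp [pdxi_tau_pow]

theorem Deps_tau (ε : Fin N → ℤ) : Deps ε (tau : SA N) = 1 := by
  rw [tau, map_sub, Deps_one, Deps_tpow]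
  simp [tpow_zero]

theorem Deps_tau_pow (ε : Fin N → ℤ) (k : ℕ) :
    Deps ε (tau ^ (k + 1) : SA N) = ((k : ℂ) + 1) • tau ^ k := by
  induction k with
  | zero => simp [Deps_tau]
  | succ k ih =>
    rw [pow_succ, Deps_mul, ih, Deps_tau, mul_one, smul_mul_assoc, ← pow_succ]
    push_cast
    module

/-- The contact bracket with a power of `τ`. -/
theorem contactBracket_tau_pow (ε : Fin N → ℤ) (k : ℕ) (g : SA N) :
    contactBracket ε (tau ^ (k + 1)) g
      = (2 : ℂ) • (tau ^ (k + 1) * Deps ε g) - ((k : ℂ) + 1) • (tau ^ k * Delta g) := by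
  have h : euler (tau ^ (k + 1) : SA N) = 0 := by simp [euler, pdxi_tau_pow]
  have hp : parity (tau ^ (k + 1) : SA N) = tau ^ (k + 1) := by rw [map_pow, parity_tau]
  rw [contactBracket, contactField_apply, Delta_eq, h, sub_zero, Deps_tau_pow, hp, Delta_eq g]
  simp only [pdxi_tau_pow, mul_zero, zero_mul, Finset.sum_const_zero, add_zero, euler, mul_sub,
    Finset.mul_sum, smul_mul_assoc, mul_smul_comm, ← Finset.smul_sum, mul_assoc]
  module

/-- The eigenvalues `2k` are pairwise distinct, so in a finite-dimensional representation only
finitely many powers of `τ` can act nontrivially. -/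
theorem contactBracket_tau_tau_pow (ε : Fin N → ℤ) (k : ℕ) :
    contactBracket ε (tau ^ 1) (tau ^ (k + 1) : SA N) = (2 * (k : ℂ)) • tau ^ (k + 1) := by
  have h := contactBracket_tau_pow ε 0 (tau ^ (k + 1) : SA N)
  rw [zero_add] at h
  have h0 : euler (tau ^ (k + 1) : SA N) = 0 := by simp [euler, pdxi_tau_pow]
  rw [h, Deps_tau_pow, Delta_eq, h0, mul_smul_comm, ← pow_add, add_comm 1 k]
  simp only [pow_zero, one_mul, Nat.cast_zero]
  module

/-- In this difference the terms with `D^ε g` cancel, leaving an operator diagonal in the Grassmann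
degree: on degree `d` the factor `2 + Δ` equals `4 - d`. This is why degree `4` is exceptional. -/
theorem contactBracket_sub (ε : Fin N → ℤ) (k : ℕ) (g : SA N) :
    contactBracket ε (tau ^ (k + 1)) (tau * g) - contactBracket ε (tau ^ (k + 2)) g
      = tau ^ (k + 1) * ((2 : ℂ) • g + Delta g) := by
  have e : Delta (tau * g) = tau * Delta g := by
    have := euler_tau_pow_mul 1 g
    rw [pow_one] at this
    rw [Delta_eq, Delta_eq, this, mul_sub, mul_smul_comm]
  have h := contactBracket_tau_pow ε (k + 1) g
  rw [contactBracket_tau_pow, h, e, Deps_mul, Deps_tau, one_mul, mul_add, ← mul_assoc, ← mul_assoc,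
    ← pow_succ, ← pow_succ, mul_add, mul_smul_comm]
  push_cast
  module

/-- The bracket with `τ` measures the order of vanishing `2k + |L|`, shifted by `-2`, up to a term
with one more factor `τ`. -/
theorem contactBracket_tau_monomial (ε : Fin N → ℤ) (k : ℕ) (j : ℤ) (L : List (Fin N)) :
    ∃ c : ℂ, contactBracket ε (tau ^ 1) (tau ^ k * (tpow j * xiList L))
      = (2 * (k : ℂ) + (L.length : ℂ) - 2) • (tau ^ k * (tpow j * xiList L))
        + c • (tau ^ (k + 1) * (tpow (j - 1) * xiList L)) := by
  obtain ⟨c, hc⟩ := Deps_tpow_mul_xiList ε j L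
  refine ⟨2 * c, ?_⟩
  have h := contactBracket_tau_pow ε 0 (tau ^ k * (tpow j * xiList L))
  have hk : tau * Deps ε (tau ^ k : SA N) = (k : ℂ) • tau ^ k := by
    cases k with
    | zero => simp [Deps_one]
    | succ k => rw [Deps_tau_pow, mul_smul_comm, ← pow_succ']; push_cast; rfl
  rw [zero_add] at h
  rw [h, Delta_eq, euler_tau_pow_mul, euler_mul, euler_tpow, euler_xiList, Deps_mul, hc, mul_add,
    pow_one, ← mul_assoc tau, hk]
  simp only [pow_zero, one_mul, zero_mul, zero_add, mul_smul_comm, smul_mul_assoc, ← mul_assoc,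
    ← pow_succ', Nat.cast_zero]
  module

/-- Every term of the bracket keeps a factor `ξ_i` from each argument and vanishes, except the one
in which `∂_i` is applied to both. This lowers the Grassmann degree by one and serves to reach
degree `4` from degree `5`. -/
theorem contactBracket_xi_mul (ε : Fin N → ℤ) (i : Fin N) {w : SA N} (hw : pdxi i w = 0) :
    contactBracket ε (xi i * w) (tau * xi i) = -(tpow (-ε i) * (tau * parity w)) := by
  have hx : ∀ x y : SA N, xi i * x * (xi i * y) = 0 := fun x y => by
    rw [mul_assoc, ← mul_assoc x, ← parity_parity x, ← xi_mul_comm, ← mul_assoc, ← mul_assoc,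
      xi_mul_self, zero_mul, zero_mul]
  have h1 : Delta (xi i * w) = xi i * (w - euler w) := by
    rw [Delta_eq, euler_mul, euler_xi, mul_sub]; module
  have h2 : Deps ε (xi i * w) = xi i * (Deps ε w + (-(1 / 2 : ℂ) * (ε i : ℂ)) • (tpow (-1) * w)) := by
    rw [Deps_mul, Deps_xi, mul_add, mul_smul_comm, xi_tpow_mul, smul_mul_assoc, mul_assoc, add_comm]
  have h3 : Deps ε (tau * xi i) = xi i * (1 + (-(1 / 2 : ℂ) * (ε i : ℂ)) • (tpow (-1) * tau)) := by
    rw [Deps_mul, Deps_xi, Deps_tau, mul_add, mul_smul_comm, mul_smul_comm, xi_tpow_mul, one_mul,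
      mul_one, tau_mul_comm, mul_assoc, ← tau_mul_comm]
  have h4 : ∀ j, pdxi j (tau * xi i) = if j = i then tau else 0 := fun j => by
    have := pdxi_tau_pow_mul j 1 (xi i)
    rw [pow_one, pdxi_xi] at this
    rw [this]
    split_ifs <;> simp
  have h5 : pdxi i (parity (xi i * w)) = - parity w := by
    have := parity_pdxi i w
    rw [hw, map_zero] at this
    rw [map_mul, parity_xi, neg_mul, map_neg, pdxi_mul, pdxi_xi, if_pos rfl,
      neg_eq_zero.1 this.symm, mul_zero, add_zero, one_mul]
  rw [contactBracket, contactField_apply, h1, h2, h3, hx]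
  simp only [h4, mul_ite, mul_zero, Finset.sum_ite_eq', Finset.mem_univ, if_true, h5]
  have h6 := hx (Deps ε w + (-(1 / 2 : ℂ) * (ε i : ℂ)) • (tpow (-1) * w)) tau
  rw [← tau_mul_comm] at h6
  rw [mul_assoc _ (xi i) tau, ← tau_mul_comm (xi i), h6]
  simp only [smul_zero, sub_zero, zero_add, mul_neg, neg_mul, mul_assoc, tau_mul_comm (parity w)]


/-! ### The stabilizer of the point `t = 1`, `ξ = 0` and its linear part -/

theorem evalPt_tau : evalPt (tau : SA N) = 0 := by
  rw [tau, map_sub, evalPt_tpow, map_one, sub_self]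

theorem evalPt_of_odd {f : SA N} (hf : f ∈ homog 1) : evalPt f = 0 := by
  have h := evalPt_parity f
  rw [show parity f = sgn 1 • f from hf, sgn_one, map_smul, neg_one_smul] at h
  exact self_eq_neg.1 h.symm

/-- The functions `f` for which `D_f` vanishes at the point `t = 1`, `ξ = 0`. -/
def stab (N : ℕ) : Submodule ℂ (SA N) where
  carrier := {f | evalPt f = 0 ∧ ∀ i, evalPt (pdxi i f) = 0}
  add_mem' := by
    rintro f g ⟨hf, hf'⟩ ⟨hg, hg'⟩
    exact ⟨by simp [hf, hg], fun i => by simp [hf', hg']⟩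
  zero_mem' := by simp
  smul_mem' := by
    rintro c f ⟨hf, hf'⟩
    exact ⟨by simp [hf], fun i => by simp [hf']⟩

theorem tau_mul_mem_stab (f : SA N) : tau * f ∈ stab N :=
  ⟨by rw [map_mul, evalPt_tau, zero_mul], fun i => by
    have := pdxi_tau_pow_mul i 1 f
    rw [pow_one] at this
    rw [this, map_mul, evalPt_tau, zero_mul]⟩

theorem xi_mul_xi_mul_mem_stab (i j : Fin N) (f : SA N) : xi i * (xi j * f) ∈ stab N := by
  refine ⟨by rw [map_mul, evalPt_xi, zero_mul], fun k => ?_⟩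
  simp [pdxi_mul, evalPt_xi, parity_xi]

theorem parity_mem_stab {f : SA N} (hf : f ∈ stab N) : parity f ∈ stab N := by
  refine ⟨by rw [evalPt_parity, hf.1], fun i => ?_⟩
  rw [← neg_eq_zero, ← map_neg, ← parity_pdxi, evalPt_parity, hf.2]

/-- The even and odd parts of a function in `stab N` are again in `stab N`, so additive statements
reduce to homogeneous functions, for which super signs make sense. -/
theorem stab_induction {C : SA N → Prop} (hadd : ∀ f g, C f → C g → C (f + g))
    (hC : ∀ p, ∀ f ∈ homog p, f ∈ stab N → C f) {f : SA N} (hf : f ∈ stab N) : C f := by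
  have e : f = (1 / 2 : ℂ) • (f + parity f) + (1 / 2 : ℂ) • (f - parity f) := by module
  rw [e]
  refine hadd _ _ (hC 0 _ ?_ ?_) (hC 1 _ ?_ ?_)
  · show parity _ = _
    simp only [map_smul, map_add, parity_parity, sgn_zero, one_smul, add_comm]
  · exact Submodule.smul_mem _ _ (add_mem hf (parity_mem_stab hf))
  · show parity _ = _
    simp only [map_smul, map_sub, parity_parity, sgn_one]
    module
  · exact Submodule.smul_mem _ _ (sub_mem hf (parity_mem_stab hf))

theorem isotropySpace_le_stab : isotropySpace N ≤ stab N := by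
  refine iSup_le fun I => ?_
  rintro _ ⟨g, rfl⟩
  rw [LinearMap.mulLeft_apply, mul_assoc, xiProd, ← xiList, ← tau, ← Finset.length_sort (· ≤ ·)]
  -- With natural-number division and truncated subtraction, the exponent `1 - (|I| + 1) / 3` is `1`
  -- for `|I| ≤ 1` and `0` for `|I| ≥ 2`.
  rcases I.sort (· ≤ ·) with _ | ⟨a, _ | ⟨b, L⟩⟩
  · simpa using tau_mul_mem_stab _
  · simpa using tau_mul_mem_stab _
  · rw [List.length_cons, List.length_cons, show 1 - (L.length + 1 + 1 + 1) / 3 = 0 by omega,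
      pow_zero, one_mul, xiList_cons, xiList_cons, mul_assoc, mul_assoc]
    exact xi_mul_xi_mul_mem_stab a b _

theorem evalPt_euler (f : SA N) : evalPt (euler f) = 0 := by
  simp [euler, evalPt_xi]

theorem evalPt_contactField (ε : Fin N → ℤ) {f : SA N} (hf : f ∈ stab N) (h : SA N) :
    evalPt (contactField ε f h) = 0 := by
  simp [contactField_apply, Delta_eq, evalPt_euler, hf.1, evalPt_xi, (parity_mem_stab hf).2]

/-- The values of `D_f` on `t` and on the `ξ_i` recover, at the point, `f` and its first odd
derivatives. Together with `evalPt_contactField` this describes `stab N` as the set of `f` whose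
field vanishes there, a condition visibly closed under commutators. -/
theorem mem_stab_of_evalPt (ε : Fin N → ℤ) {f : SA N}
    (h : ∀ g, evalPt (contactField ε f g) = 0) : f ∈ stab N := by
  have h1 := h (tpow 1)
  rw [contactField_tpow_one, Delta_eq, map_sub, evalPt_euler, sub_zero, map_smul, smul_eq_zero] at h1
  refine ⟨h1.resolve_left two_ne_zero, fun i => ?_⟩
  have h2 := h (xi i)
  rw [contactField_xi] at h2
  simp only [map_add, map_mul, map_smul, evalPt_xi, mul_zero, smul_zero, zero_add, evalPt_tpow,
    one_mul] at h2
  rw [← evalPt_parity, parity_pdxi, map_neg, h2, neg_zero]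

/-- The action of `D_f` on the odd part of the cotangent space at the point. -/
def linPart (ε : Fin N → ℤ) (f : SA N) : Matrix (Fin N) (Fin N) ℂ :=
  Matrix.of fun j i => evalPt (pdxi j (contactField ε f (xi i)))

/-- A field vanishing at the point has a well-defined linearization there: by the Leibniz rule only
first derivatives of `h` survive evaluation. The `t`-direction does not contribute, because `D_f t =
Δ f` has no linear odd term for `f ∈ stab N`. -/
theorem evalPt_pdxi_contactField (ε : Fin N → ℤ) {p : ZMod 2} {f : SA N} (hp : f ∈ homog p)
    (hf : f ∈ stab N) (j : Fin N) (h : SA N) : evalPt (pdxi j (contactField ε f h))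
      = ∑ i, linPart ε f j i * evalPt (pdxi i h) := by
  have hD := contactField_mem_superDer (ε := ε) hp
  have h0 := evalPt_contactField ε hf
  have hP : ∀ g : SA N, evalPt (parityPow p g) = evalPt g := fun g => by
    rcases parity_cases p with rfl | rfl <;> simp [parityPow, evalPt_parity]
  induction h using SA_induction with
  | hc c =>
    rw [Algebra.algebraMap_eq_smul_one, map_smul, superDer_one hD]
    simp [← tpow_zero, pdxi_tpow]
  | ht k =>
    rw [superDer_tpow hD, contactField_tpow_one, Delta_eq]
    have : evalPt (pdxi j (euler f)) = 0 := by
      simp [euler, pdxi_mul, pdxi_xi, parity_xi, evalPt_xi, apply_ite (evalPt (N := N)), hf.2]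
    simp [pdxi_mul, pdxi_tpow, parity_tpow, hf.2, this]
  | hx i => simp [pdxi_xi, linPart]
  | hadd f g hf hg => simp only [map_add, hf, hg, mul_add, Finset.sum_add_distrib]
  | hmul g g' hg hg' =>
    rw [hD.2]
    simp only [map_add, pdxi_mul, map_mul, hg, hg', h0, hP, evalPt_parity, mul_zero, zero_mul,
      add_zero, zero_add, mul_add, Finset.sum_add_distrib, Finset.sum_mul, Finset.mul_sum, mul_assoc,
      mul_left_comm]

/-! ### The symbol as the linearization at the point -/

theorem evalPt_pdxi_pdxi_swap (i j : Fin N) (f : SA N) :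
    evalPt (pdxi i (pdxi j f)) = - evalPt (pdxi j (pdxi i f)) := by
  rw [pdxi_anticomm, map_neg]

theorem symbol_fst (f : SA N) : (symbol f).1 = evalPt (pdt f) := rfl

/-- The orthogonal part of the symbol is the odd Hessian at the point; it is antisymmetric because
odd derivatives anticommute. -/
theorem symbol_snd_apply (f : SA N) (a b : Fin N) :
    ((symbol f).2 : Matrix (Fin N) (Fin N) ℂ) b a = evalPt (pdxi b (pdxi a f)) := by
  have h : ((symbol f).2 : Matrix (Fin N) (Fin N) ℂ) = ∑ i, ∑ j, if i < j then
      evalPt (pdxi j (pdxi i f)) • (Matrix.single j i (1 : ℂ) - Matrix.single i j 1) else 0 := by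
    simp only [symbol, LinearMap.prod_apply, Function.prod_apply, LinearMap.sum_apply,
      AddSubmonoidClass.coe_finsetSum]
    refine Finset.sum_congr rfl fun i _ => Finset.sum_congr rfl fun j _ => ?_
    split_ifs <;> rfl
  rw [h]
  simp only [Matrix.sum_apply]
  -- A pair `i < j` reaches the entry `(b, a)` either through `E_{ji}` or through `-E_{ij}`. In the
  -- second case the sign is absorbed by interchanging the two derivatives.
  have h2 : ∀ i j, (if i < j then evalPt (pdxi j (pdxi i f)) •
      (Matrix.single j i (1 : ℂ) - Matrix.single i j 1) else (0 : Matrix (Fin N) (Fin N) ℂ)) b a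
      = (if j = b then if i = a then if a < b then evalPt (pdxi b (pdxi a f)) else 0 else 0 else 0)
        + (if j = a then if i = b then if b < a then evalPt (pdxi b (pdxi a f)) else 0 else 0 else 0) := by
    intro i j
    by_cases hij : i < j
    · simp only [hij, if_true, Matrix.smul_apply, Matrix.sub_apply, Matrix.single_apply, smul_eq_mul]
      by_cases h1 : j = b <;> by_cases h2 : i = a <;> by_cases h3 : j = a <;> by_cases h4 : i = b <;>
        simp_all
      exact (evalPt_pdxi_pdxi_swap _ _ _).symm
    · rw [if_neg hij]
      by_cases h1 : j = b <;> by_cases h2 : i = a <;> by_cases h3 : j = a <;> by_cases h4 : i = b <;>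
        simp_all
  simp only [h2, Finset.sum_add_distrib, Finset.sum_ite_eq', Finset.mem_univ, if_true]
  rcases lt_trichotomy a b with h | rfl | h
  · simp [h, h.not_gt]
  · simp [pdxi_pdxi]
  · simp [h, h.not_gt]

/-- On the odd cotangent directions `z` acts as the identity and `𝔰𝔬_N` by its defining
representation. The dependence on `ε` disappears, since `t^{ε_i}` evaluates to `1` and `Δ f` to `0`.
-/
theorem linPart_eq (ε : Fin N → ℤ) {f : SA N} (hf : f ∈ stab N) :
    linPart ε f = (symbol f).1 • 1 + ((symbol f).2 : Matrix (Fin N) (Fin N) ℂ) := by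
  ext j i
  have h1 : ∀ g, evalPt (pdxi j (g * xi i)) = evalPt g * if j = i then 1 else 0 := fun g => by
    rw [pdxi_mul, pdxi_xi, map_add, map_mul, map_mul, evalPt_xi, mul_zero, zero_add, evalPt_parity]
    split_ifs <;> simp
  have h2 : evalPt (pdxi j (pdxi i (parity f))) = evalPt (pdxi j (pdxi i f)) := by
    rw [← evalPt_parity (pdxi j (pdxi i f)), parity_pdxi, parity_pdxi, map_neg (pdxi j), neg_neg]
  have h3 : evalPt (Deps ε f) = evalPt (pdt f) := by simp [Deps_apply, evalPt_xi]
  have h4 : evalPt (pdxi j (tpow (-ε i) * pdxi i (parity f))) = evalPt (pdxi j (pdxi i f)) := by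
    rw [pdxi_mul, pdxi_tpow, zero_mul, zero_add, map_mul, parity_tpow, evalPt_tpow, one_mul, h2]
  rw [linPart, Matrix.of_apply, contactField_xi]
  simp only [map_add, map_smul, h1, h3, h4, map_mul, Delta_eq, map_sub, evalPt_euler, hf.1,
    Matrix.add_apply, symbol_snd_apply, Matrix.smul_apply, Matrix.one_apply, symbol_fst]
  simp

/-- Antisymmetric matrices have zero diagonal, so any diagonal entry gives the scalar part. Hence
linearization loses no information about the symbol, provided there is an odd variable. -/
theorem levi_ext (hN : 1 ≤ N) {x y : Levi N}
    (h : x.1 • (1 : Matrix (Fin N) (Fin N) ℂ) + (x.2 : Matrix (Fin N) (Fin N) ℂ)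
      = y.1 • 1 + (y.2 : Matrix (Fin N) (Fin N) ℂ)) : x = y := by
  have hd : ∀ A : LieAlgebra.Orthogonal.so (Fin N) ℂ, ∀ i, (A : Matrix (Fin N) (Fin N) ℂ) i i = 0 := by
    intro A i
    have := (LieAlgebra.Orthogonal.mem_so (Fin N) ℂ _).1 A.2
    have h2 := congrFun (congrFun this i) i
    rw [Matrix.transpose_apply, Matrix.neg_apply] at h2
    exact self_eq_neg.1 h2
  have h1 : x.1 = y.1 := by
    have := congrFun (congrFun h ⟨0, hN⟩) ⟨0, hN⟩
    simpa [hd] using this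
  refine Prod.ext h1 (Subtype.ext ?_)
  rw [h1] at h
  exact add_left_cancel h

theorem symbol_eq_zero_of_odd {f : SA N} (hf : f ∈ homog 1) : symbol f = 0 := by
  have h := symbol_parity f
  rw [show parity f = sgn 1 • f from hf, sgn_one, map_smul, neg_one_smul] at h
  have h2 : (2 : ℂ) • symbol f = 0 := by rw [two_smul]; nth_rw 1 [← h]; exact neg_add_cancel _
  exact (smul_eq_zero.1 h2).resolve_left two_ne_zero

theorem contactField_contactBracket (ε : Fin N → ℤ) {p q : ZMod 2} {f g : SA N} (hf : f ∈ homog p)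
    (hg : g ∈ homog q) (h : SA N) : contactField ε (contactBracket ε f g) h
      = contactField ε f (contactField ε g h) - sgn (p * q) • contactField ε g (contactField ε f h) := by
  rw [← superBracket_contactField ε hf hg]; rfl

theorem contactBracket_mem_stab (ε : Fin N → ℤ) {f g : SA N} (hf : f ∈ stab N) (hg : g ∈ stab N) :
    contactBracket ε f g ∈ stab N := by
  revert g
  refine stab_induction (C := fun f => ∀ {g}, g ∈ stab N → contactBracket ε f g ∈ stab N)
    (fun f f' h h' g hg => by rw [contactBracket_add_left]; exact add_mem (h hg) (h' hg))
    (fun p f hp hf g hg => ?_) hf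
  refine stab_induction (C := fun g => contactBracket ε f g ∈ stab N)
    (fun f f' h h' => by rw [contactBracket_add_right]; exact add_mem h h')
    (fun q g hq hg => ?_) hg
  refine mem_stab_of_evalPt ε fun h => ?_
  rw [contactField_contactBracket ε hp hq, map_sub, map_smul, evalPt_contactField ε hf,
    evalPt_contactField ε hg, smul_zero, sub_zero]

theorem levi_lie (x y : Levi N) : ((⁅x, y⁆ : Levi N).1 = 0) ∧
    ((⁅x, y⁆ : Levi N).2 : Matrix (Fin N) (Fin N) ℂ) = x.2 * y.2 - y.2 * x.2 := by
  refine ⟨?_, rfl⟩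
  show x.1 * y.1 - y.1 * x.1 = 0
  ring

/-- The symbol is a homomorphism of Lie superalgebras on the stabilizer. -/
theorem symbol_contactBracket (hN : 1 ≤ N) (ε : Fin N → ℤ) {p q : ZMod 2} {f g : SA N}
    (hp : f ∈ homog p) (hq : g ∈ homog q) (hf : f ∈ stab N) (hg : g ∈ stab N) :
    symbol (contactBracket ε f g) = ⁅symbol f, symbol g⁆ := by
  have h1 : linPart ε (contactBracket ε f g)
      = linPart ε f * linPart ε g - sgn (p * q) • (linPart ε g * linPart ε f) := by
    ext j i
    rw [linPart, Matrix.of_apply, contactField_contactBracket ε hp hq, map_sub, map_smul, map_sub,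
      map_smul, evalPt_pdxi_contactField ε hp hf, evalPt_pdxi_contactField ε hq hg,
      Matrix.sub_apply, Matrix.smul_apply, Matrix.mul_apply, Matrix.mul_apply]
    rfl
  refine levi_ext hN ?_
  rw [← linPart_eq ε (contactBracket_mem_stab ε hf hg), h1, (levi_lie _ _).1, (levi_lie _ _).2,
    linPart_eq ε hf, linPart_eq ε hg]
  have key : ∀ c d : ℂ, ∀ A B : Matrix (Fin N) (Fin N) ℂ,
      (c • 1 + A) * (d • 1 + B) - (d • 1 + B) * (c • 1 + A) = (0 : ℂ) • 1 + (A * B - B * A) := by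
    intro c d A B
    simp only [add_mul, mul_add, smul_mul_assoc, mul_smul_comm, one_mul, mul_one]
    module
  -- For two odd functions the superbracket of linear parts would be an anticommutator; both symbols
  -- are then zero, so no discrepancy arises.
  rcases parity_cases p with rfl | rfl
  · rw [zero_mul, sgn_zero, one_smul, key]
  · rcases parity_cases q with rfl | rfl
    · rw [mul_zero, sgn_zero, one_smul, key]
    · simp [symbol_eq_zero_of_odd hp, symbol_eq_zero_of_odd hq]

/-! ### Functions of higher order at the point -/

/-- The span of the `(t - 1)^k t^j ξ_L` with `2 k + |L| ≥ 3`. -/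
def higher (N : ℕ) : Submodule ℂ (SA N) := Submodule.span ℂ
  {f | ∃ (k : ℕ) (j : ℤ) (L : List (Fin N)), 3 ≤ 2 * k + L.length ∧
    f = tau ^ k * (tpow j * xiList L)}

/-- Telescoping `t^{i+1} - t^i = τ t^i`, in both directions from `0` since `j` may be negative. -/
theorem tpow_sub_one_mul_mem (x : SA N) (j : ℤ) : (tpow j - 1) * x
    ∈ Submodule.span ℂ (Set.range fun i : ℤ => tau ^ 1 * (tpow i * x)) := by
  have hm : ∀ i : ℤ, tau ^ 1 * (tpow i * x)
      ∈ Submodule.span ℂ (Set.range fun i : ℤ => tau ^ 1 * (tpow i * x)) := fun i =>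
    Submodule.subset_span ⟨i, rfl⟩
  have hs : ∀ i : ℤ, tau ^ 1 * (tpow i * x) = (tpow (i + 1) - 1) * x - (tpow i - 1) * x := fun i => by
    rw [pow_one, tau, sub_mul, tpow_mul_tpow_mul, sub_mul, sub_mul, one_mul, one_mul, add_comm 1 i]
    abel
  induction j using Int.induction_on with
  | zero => simp [tpow_zero]
  | succ n ih =>
    have := add_mem (hm n) ih
    rwa [hs, sub_add_cancel] at this
  | pred n ih =>
    have := sub_mem ih (hm (-n - 1))
    rwa [hs, sub_add_cancel, sub_sub_cancel] at this

/-- Consecutive Taylor remainders differ by `τ (t^i - 1)`, which has a second factor `τ` by the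
first-order statement; the sum telescopes again. -/
theorem tpow_sub_taylor_mul_mem (x : SA N) (j : ℤ) : (tpow j - 1 - (j : ℂ) • tau) * x
    ∈ Submodule.span ℂ (Set.range fun i : ℤ => tau ^ 2 * (tpow i * x)) := by
  have hm : ∀ i : ℤ, tau * ((tpow i - 1) * x)
      ∈ Submodule.span ℂ (Set.range fun i : ℤ => tau ^ 2 * (tpow i * x)) := fun i => by
    have h := Submodule.mem_map_of_mem (f := LinearMap.mulLeft ℂ (tau : SA N))
      (tpow_sub_one_mul_mem x i)
    rw [Submodule.map_span, ← Set.range_comp] at h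
    simpa [Function.comp_def, ← mul_assoc, ← pow_two] using h
  have hs : ∀ i : ℤ, tau * ((tpow i - 1) * x)
      = (tpow (i + 1) - 1 - ((i + 1 : ℤ) : ℂ) • tau) * x - (tpow i - 1 - (i : ℂ) • tau) * x := fun i => by
    rw [tau, ← sub_mul, ← mul_assoc, sub_mul, mul_sub, ← tpow_add, add_comm 1 i]
    congr 1
    push_cast
    rw [mul_one, one_mul]
    module
  induction j using Int.induction_on with
  | zero => simp [tpow_zero]
  | succ n ih =>
    have := add_mem (hm n) ih
    rwa [hs, sub_add_cancel] at this
  | pred n ih =>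
    have := sub_mem ih (hm (-n - 1))
    rwa [hs, sub_add_cancel, sub_sub_cancel] at this

/-- The part of order at most `2` of a function. -/
def jet (f : SA N) : SA N := evalPt f • 1 + evalPt (pdt f) • tau + ∑ i, evalPt (pdxi i f) • xi i
  + (1 / 2 : ℂ) • ∑ i, ∑ j, evalPt (pdxi j (pdxi i f)) • (xi i * xi j)

theorem jet_add (f g : SA N) : jet (f + g) = jet f + jet g := by
  simp only [jet, map_add, add_smul, Finset.sum_add_distrib, smul_add]
  abel

theorem jet_smul (c : ℂ) (f : SA N) : jet (c • f) = c • jet f := by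
  simp only [jet, map_smul, smul_eq_mul, mul_smul, smul_add, Finset.smul_sum, smul_comm (1 / 2 : ℂ) c]

theorem evalPt_pdxi_pdxi_xi_mul_xi (a b i j : Fin N) : evalPt (pdxi b (pdxi a (xi i * xi j)))
    = (if b = j then if a = i then 1 else 0 else 0)
      - (if b = i then if a = j then 1 else 0 else 0) := by
  have h : pdxi a (xi i * xi j)
      = (if a = i then (1 : ℂ) else 0) • xi j - (if a = j then (1 : ℂ) else 0) • xi i := by
    rw [pdxi_mul, pdxi_xi, pdxi_xi, parity_xi]
    split_ifs <;> simp [sub_eq_add_neg]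
  rw [h, map_sub, map_smul, map_smul, pdxi_xi, pdxi_xi]
  split_ifs <;> simp

/-- A Taylor expansion in which `τ` counts twice and `ξ_i` once. In Grassmann degree `0` the
expansion in `τ` must be taken to second order, in degrees `1` and `2` to first order, and from
degree `3` on nothing has to be removed. -/
theorem sub_jet_mem_higher (f : SA N) : f - jet f ∈ higher N := by
  have sp : ∀ (k : ℕ) (L : List (Fin N)), 3 ≤ 2 * k + L.length →
      Submodule.span ℂ (Set.range fun i : ℤ => tau ^ k * (tpow i * xiList L)) ≤ higher N := by
    intro k L h
    refine Submodule.span_mono ?_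
    rintro _ ⟨j, rfl⟩
    exact ⟨k, j, L, h, rfl⟩
  refine monomial_induction (C := fun f => f - jet f ∈ higher N) ?_ ?_ ?_ ?_ f
  · simp [jet]
  · intro f g hf hg
    rw [jet_add, add_sub_add_comm]; exact add_mem hf hg
  · intro c f hf
    rw [jet_smul, ← smul_sub]; exact Submodule.smul_mem _ c hf
  · intro j L
    rcases L with _ | ⟨a, _ | ⟨b, _ | ⟨c, L⟩⟩⟩
    · refine sp 2 [] (by simp) ?_
      have e : jet (tpow j * xiList [] : SA N) = 1 + (j : ℂ) • tau := by
        simp [jet, xiList_nil, pdxi_tpow, pdt_tpow, evalPt_tpow]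
      have := tpow_sub_taylor_mul_mem (xiList [] : SA N) j
      rw [e]
      rw [xiList_nil, mul_one] at this ⊢
      rwa [sub_sub] at this
    · refine sp 1 [a] (by simp) ?_
      have e : jet (tpow j * xiList [a]) = xi a := by
        simp [jet, xiList, pdxi_mul, pdxi_tpow, pdt_mul, pdt_tpow, pdt_xi, evalPt_tpow, evalPt_xi,
          pdxi_xi, parity_tpow, apply_ite]
      have := tpow_sub_one_mul_mem (xiList [a]) j
      rw [e]
      have e' : xiList [a] = xi a := by rw [xiList_cons, xiList_nil, mul_one]
      rw [sub_mul, one_mul] at this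
      rwa [e'] at this ⊢
    · refine sp 1 [a, b] (by simp) ?_
      have e' : xiList [a, b] = xi a * xi b := by
        rw [xiList_cons, xiList_cons, xiList_nil, mul_one]
      have e : jet (tpow j * xiList [a, b]) = xi a * xi b := by
        have : ∀ i k, evalPt (pdxi k (pdxi i (tpow j * xiList [a, b])))
            = (if k = b then if i = a then 1 else 0 else 0)
              - (if k = a then if i = b then 1 else 0 else 0) := by
          intro i k
          rw [e', pdxi_mul, pdxi_tpow, zero_mul, zero_add, parity_tpow, pdxi_mul, pdxi_tpow,
            zero_mul, zero_add, map_mul, parity_tpow, evalPt_tpow, one_mul, evalPt_pdxi_pdxi_xi_mul_xi]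
        simp only [jet, this]
        simp [xiList, pdxi_mul, pdxi_tpow, pdt_mul, pdt_tpow, pdt_xi, evalPt_xi, parity_xi, sub_smul,
          ite_smul, Finset.sum_sub_distrib]
        rw [xi_mul_xi b a]
        module
      have := tpow_sub_one_mul_mem (xiList [a, b]) j
      rw [e]
      rw [sub_mul, one_mul] at this
      rwa [e'] at this ⊢
    · refine sp 0 (a :: b :: c :: L) (by simp) ?_
      have e : jet (tpow j * xiList (a :: b :: c :: L)) = 0 := by
        simp [jet, xiList_cons, pdxi_mul, pdxi_tpow, pdt_mul, pdt_tpow, pdt_xi, evalPt_xi, parity_xi,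
          parity_tpow]
      rw [e, sub_zero]
      exact Submodule.subset_span ⟨j, by simp⟩

/-! ### Kernel and section of the symbol -/

theorem mem_higher_of_symbol_eq_zero {f : SA N} (hf : f ∈ stab N) (h : symbol f = 0) :
    f ∈ higher N := by
  have h1 : evalPt (pdt f) = 0 := by rw [← symbol_fst, h]; rfl
  have h2 : ∀ i j, evalPt (pdxi j (pdxi i f)) = 0 := fun i j => by
    rw [← symbol_snd_apply, h]; rfl
  have := sub_jet_mem_higher f
  rw [jet, hf.1, h1] at this
  simpa [hf.2, h2] using this

/-- A linear section of the symbol. -/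
def symbolSection (x : Levi N) : SA N :=
  x.1 • tau + (1 / 2 : ℂ) • ∑ i, ∑ j, (x.2 : Matrix (Fin N) (Fin N) ℂ) j i • (xi i * xi j)

theorem symbolSection_add (x y : Levi N) :
    symbolSection (x + y) = symbolSection x + symbolSection y := by
  have h : ∀ i j, ((x + y).2 : Matrix (Fin N) (Fin N) ℂ) j i
      = (x.2 : Matrix (Fin N) (Fin N) ℂ) j i + (y.2 : Matrix (Fin N) (Fin N) ℂ) j i :=
    fun _ _ => rfl
  simp only [symbolSection, h, Prod.fst_add, add_smul, Finset.sum_add_distrib, smul_add]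
  abel

theorem symbolSection_smul (c : ℂ) (x : Levi N) :
    symbolSection (c • x) = c • symbolSection x := by
  have h : ∀ i j, ((c • x).2 : Matrix (Fin N) (Fin N) ℂ) j i
      = c * (x.2 : Matrix (Fin N) (Fin N) ℂ) j i := fun _ _ => rfl
  simp only [symbolSection, h, Prod.smul_fst, smul_eq_mul, mul_smul, smul_add,
    Finset.smul_sum, smul_comm (1 / 2 : ℂ) c]

theorem symbolSection_mem_homog (x : Levi N) : symbolSection x ∈ homog 0 := by
  have h1 : (tau : SA N) ∈ homog 0 := by simpa using tau_pow_mem_homog (N := N) 1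
  have h2 : ∀ i j : Fin N, xi i * xi j ∈ homog 0 := fun i j => by
    have := mul_mem_homog (xi_mem_homog i) (xi_mem_homog j)
    rwa [show (1 : ZMod 2) + 1 = 0 from rfl] at this
  have h3 : ∑ i, ∑ j, (x.2 : Matrix (Fin N) (Fin N) ℂ) j i • (xi i * xi j) ∈ homog 0 :=
    sum_mem fun i _ => sum_mem fun j _ => Submodule.smul_mem _ _ (h2 i j)
  exact add_mem (Submodule.smul_mem _ _ h1) (Submodule.smul_mem _ _ h3)

theorem symbolSection_mem_stab (x : Levi N) : symbolSection x ∈ stab N := by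
  have h1 : (tau : SA N) ∈ stab N := by simpa using tau_mul_mem_stab (1 : SA N)
  have h2 : ∀ i j : Fin N, xi i * xi j ∈ stab N := fun i j => by
    simpa using xi_mul_xi_mul_mem_stab i j 1
  have h3 : ∑ i, ∑ j, (x.2 : Matrix (Fin N) (Fin N) ℂ) j i • (xi i * xi j) ∈ stab N :=
    sum_mem fun i _ => sum_mem fun j _ => Submodule.smul_mem _ _ (h2 i j)
  exact add_mem (Submodule.smul_mem _ _ h1) (Submodule.smul_mem _ _ h3)

theorem symbol_symbolSection (x : Levi N) : symbol (symbolSection x) = x := by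
  have ht : ∀ i, pdxi i (tau : SA N) = 0 := fun i => by
    have := pdxi_tau_pow (N := N) i 1
    rwa [pow_one] at this
  refine Prod.ext ?_ (Subtype.ext (Matrix.ext fun b a => ?_))
  · rw [symbol_fst]
    have h1 : pdt (tau : SA N) = 1 := by
      rw [tau, map_sub, pdt_tpow, ← tpow_zero, pdt_tpow]; simp
    simp [symbolSection, h1, pdt_mul, pdt_xi]
  -- The double sum meets each pair twice; by antisymmetry the two contributions agree, which the
  -- factor `1/2` in `symbolSection` compensates.
  · have hA : (x.2 : Matrix (Fin N) (Fin N) ℂ) a b = - (x.2 : Matrix (Fin N) (Fin N) ℂ) b a :=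
      congrFun (congrFun ((LieAlgebra.Orthogonal.mem_so (Fin N) ℂ _).1 x.2.2) b) a
    rw [symbol_snd_apply]
    simp [symbolSection, ht, evalPt_pdxi_pdxi_xi_mul_xi, mul_sub, Finset.sum_sub_distrib, hA]
    ring


theorem higher_induction {C : SA N → Prop} (h0 : C 0) (hadd : ∀ f g, C f → C g → C (f + g))
    (hsmul : ∀ (c : ℂ) f, C f → C (c • f)) (hm : ∀ (k : ℕ) (j : ℤ) (L : List (Fin N)),
      3 ≤ 2 * k + L.length → C (tau ^ k * (tpow j * xiList L))) {f : SA N} (hf : f ∈ higher N) :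
    C f := by
  induction hf using Submodule.span_induction with
  | mem x hx => obtain ⟨k, j, L, h, rfl⟩ := hx; exact hm k j L h
  | zero => exact h0
  | add x y _ _ hx hy => exact hadd _ _ hx hy
  | smul c x _ hx => exact hsmul c _ hx

theorem exists_homog_monomial (k : ℕ) (j : ℤ) (L : List (Fin N)) :
    ∃ p, tau ^ k * (tpow j * xiList L) ∈ homog p := by
  obtain ⟨p, hp⟩ := exists_homog_tpow_mul_xiList j L
  refine ⟨p, ?_⟩
  have := mul_mem_homog (tau_pow_mem_homog k) hp
  rwa [zero_add] at this

theorem pdt_tau_mul (f : SA N) : pdt (tau * f) = f + tau * pdt f := by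
  have h1 : pdt (tau : SA N) = 1 := by
    rw [tau, map_sub, pdt_tpow, ← tpow_zero, pdt_tpow]; simp
  rw [pdt_mul, h1, one_mul]

/-- The symbol and the conditions defining `stab N` see only terms of order at most `2`, so a
monomial of order at least `3` retains a factor `τ` or `ξ_i` that evaluates to zero. -/
theorem higher_le {f : SA N} (hf : f ∈ higher N) : f ∈ stab N ∧ symbol f = 0 := by
  have mono : ∀ (k : ℕ) (j : ℤ) (L : List (Fin N)), 3 ≤ 2 * k + L.length →
      evalPt (pdt (tau ^ k * (tpow j * xiList L))) = 0 ∧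
      ∀ a b, evalPt (pdxi b (pdxi a (tau ^ k * (tpow j * xiList L)))) = 0 := by
    intro k j L h
    simp only [pdxi_tau_pow_mul]
    rcases k with _ | _ | k
    · rcases L with _ | ⟨a, _ | ⟨b, _ | ⟨c, L⟩⟩⟩
      · simp at h
      · simp at h
      · simp at h
      · constructor
        · simp [xiList_cons, pdt_mul, pdt_xi, evalPt_xi]
        · intro i k
          simp [xiList_cons, pdxi_mul, pdxi_tpow, evalPt_xi, parity_xi, parity_tpow]
    · rcases L with _ | ⟨a, L⟩
      · simp at h
      · simp [xiList_cons, pdt_tau_mul, evalPt_xi, evalPt_tau]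
    · simp [pow_succ', mul_assoc, pdt_tau_mul, evalPt_tau]
  refine higher_induction (C := fun f => f ∈ stab N ∧ symbol f = 0) ⟨zero_mem _, map_zero _⟩
    (fun f g hf hg => ⟨add_mem hf.1 hg.1, by rw [map_add, hf.2, hg.2, add_zero]⟩)
    (fun c f hf => ⟨Submodule.smul_mem _ c hf.1, by rw [map_smul, hf.2, smul_zero]⟩)
    (fun k j L h => ⟨?_, Prod.ext ?_ (Subtype.ext (Matrix.ext fun b a => ?_))⟩) hf
  · rcases k with _ | k
    · rcases L with _ | ⟨a, _ | ⟨b, L⟩⟩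
      · simp at h
      · simp at h
      · rw [pow_zero, one_mul, xiList_cons, xiList_cons, ← xi_tpow_mul, ← xi_tpow_mul]
        exact xi_mul_xi_mul_mem_stab a b _
    · rw [pow_succ', mul_assoc]
      exact tau_mul_mem_stab _
  · rw [symbol_fst, (mono k j L h).1]; rfl
  · rw [symbol_snd_apply, (mono k j L h).2]; rfl

/-- As the kernel of a homomorphism, `higher N` is an ideal of `stab N`; no brackets of its
monomials need to be computed. -/
theorem mem_higher_iff {f : SA N} : f ∈ higher N ↔ f ∈ stab N ∧ symbol f = 0 :=
  ⟨higher_le, fun h => mem_higher_of_symbol_eq_zero h.1 h.2⟩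

/-! ### Finite-dimensional representations of the stabilizer -/

namespace AKModule

variable {ε : Fin N → ℤ} {X : Type*} [AddCommGroup X] [Module ℂ X]

/-- The action of `D_f`. -/
def ham (Q : AKModule ε X) : SA N →ₗ[ℂ] Module.End ℂ X :=
  Q.lie ∘ₗ (contactEquiv ε).toLinearMap

theorem ham_of_homog (Q : AKModule ε X) {p : ZMod 2} {f : SA N} (hf : f ∈ homog p) :
    Q.ham f = Q.lie (toK (contactField_mem_part ε hf)) := rfl

theorem ham_contactBracket (Q : AKModule ε X) {p q : ZMod 2} {f g : SA N} (hf : f ∈ homog p)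
    (hg : g ∈ homog q) (v : X) : Q.ham (contactBracket ε f g) v
      = Q.ham f (Q.ham g v) - sgn (p * q) • Q.ham g (Q.ham f v) := by
  have e : contactEquiv ε (contactBracket ε f g)
      = toK (superBracket_mem (contactField_mem_part ε hf) (contactField_mem_part ε hg)) :=
    Subtype.ext (superBracket_contactField ε hf hg).symm
  rw [Q.ham_of_homog hf, Q.ham_of_homog hg, ← Q.lie_lie, ← e]
  rfl

theorem ham_contactBracket_even (Q : AKModule ε X) {f : SA N} (hf : f ∈ homog 0) (g : SA N)
    (v : X) : Q.ham (contactBracket ε f g) v = Q.ham f (Q.ham g v) - Q.ham g (Q.ham f v) := by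
  obtain ⟨g₀, h₀, g₁, h₁, rfl⟩ := exists_homog g
  rw [contactBracket_add_right, map_add, LinearMap.add_apply, Q.ham_contactBracket hf h₀,
    Q.ham_contactBracket hf h₁]
  simp only [zero_mul, sgn_zero, one_smul, map_add, LinearMap.add_apply]
  abel

theorem par_ham (Q : AKModule ε X) (f : SA N) (v : X) :
    Q.par (Q.ham f v) = Q.ham (parity f) (Q.par v) := by
  obtain ⟨f₀, h₀, f₁, h₁, rfl⟩ := exists_homog f
  have e : ∀ {p : ZMod 2} {f : SA N}, f ∈ homog p →
      Q.par (Q.ham f v) = Q.ham (parity f) (Q.par v) := fun {p f} hf => by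
    rw [show parity f = sgn p • f from hf, map_smul, LinearMap.smul_apply, Q.ham_of_homog hf,
      Q.par_lie]
  simp only [map_add, LinearMap.add_apply, e h₀, e h₁]

/-- Commutation with `D_τ` on the finite-dimensional space `End U` has finitely many eigenvalues,
while the operator of `τ^{k+1}`, if nonzero, is an eigenvector with eigenvalue `2k`. -/
theorem exists_ham_tau_pow_eq_zero (Q : AKModule ε X) (U : Submodule ℂ X) [FiniteDimensional ℂ U]
    (hU : ∀ f ∈ stab N, ∀ v ∈ U, Q.ham f v ∈ U) :
    ∃ n, ∀ k, n ≤ k → ∀ v ∈ U, Q.ham (tau ^ (k + 1)) v = 0 := by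
  have hs : ∀ k, (tau ^ (k + 1) : SA N) ∈ stab N := fun k => by
    rw [pow_succ']; exact tau_mul_mem_stab _
  -- The exponent starts at `1` because the constant function `τ^0` is not in `stab N`.
  let T : ℕ → Module.End ℂ U := fun k => (Q.ham (tau ^ (k + 1))).restrict (hU _ (hs k))
  let A : Module.End ℂ (Module.End ℂ U) := LinearMap.mulLeft ℂ (T 0) - LinearMap.mulRight ℂ (T 0)
  have hA : ∀ k, A (T k) = (2 * (k : ℂ)) • T k := fun k => by
    refine LinearMap.ext fun v => Subtype.ext ?_
    have h := Q.ham_contactBracket_even (tau_pow_mem_homog 1) (tau ^ (k + 1)) v.1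
    rw [contactBracket_tau_tau_pow, map_smul] at h
    exact h.symm
  have hfin : {k | T k ≠ 0}.Finite := by
    refine Set.Finite.of_finite_image (f := fun k : ℕ => 2 * (k : ℂ))
      (A.finite_hasEigenvalue.subset ?_) fun k _ l _ h => ?_
    · rintro _ ⟨k, hk, rfl⟩
      exact Module.End.hasEigenvalue_of_hasEigenvector (Module.End.hasEigenvector_iff.2
        ⟨Module.End.mem_eigenspace_iff.2 (hA k), hk⟩)
    · simpa using h
  obtain ⟨n, hn⟩ := hfin.bddAbove
  refine ⟨n + 1, fun k hk v hv => ?_⟩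
  by_contra hne
  have : T k ≠ 0 := fun h => hne (congrArg Subtype.val (LinearMap.congr_fun h ⟨v, hv⟩))
  exact absurd (hn this) (by omega)

/-- Brackets with high powers of `τ` act by zero, hence so does `τ^{k+1}(2g + Δ g)` by
`contactBracket_sub`. On Grassmann degree `d` this is a multiple of `τ^{k+1} g` by `4 - d`. The
missing degree `4` is obtained as a bracket of a degree `5` monomial with `τ ξ_i`, which requires an
index `i` outside a four-element set. -/
theorem exists_ham_tau_pow_mul_eq_zero (hN4 : N ≠ 4) (Q : AKModule ε X) (U : Submodule ℂ X)
    [FiniteDimensional ℂ U] (hU : ∀ f ∈ stab N, ∀ v ∈ U, Q.ham f v ∈ U) :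
    ∃ n, ∀ k, n ≤ k → ∀ f, ∀ v ∈ U, Q.ham (tau ^ k * f) v = 0 := by
  obtain ⟨n, hn⟩ := Q.exists_ham_tau_pow_eq_zero U hU
  have h1 : ∀ k, n ≤ k → ∀ g ∈ stab N, ∀ v ∈ U,
      Q.ham (tau ^ (k + 1) * ((2 : ℂ) • g + Delta g)) v = 0 := by
    intro k hk g hg v hv
    rw [← contactBracket_sub ε, map_sub, LinearMap.sub_apply,
      Q.ham_contactBracket_even (tau_pow_mem_homog (k + 1)),
      Q.ham_contactBracket_even (tau_pow_mem_homog (k + 2)), hn k hk v hv,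
      hn k hk _ (hU _ (tau_mul_mem_stab g) v hv), hn (k + 1) (by omega) v hv,
      hn (k + 1) (by omega) _ (hU _ hg v hv)]
    simp
  have h2 : ∀ k, n ≤ k → ∀ (j : ℤ) (L : List (Fin N)), L.length ≠ 4 → ∀ v ∈ U,
      Q.ham (tau ^ (k + 2) * (tpow j * xiList L)) v = 0 := by
    intro k hk j L hL v hv
    -- `h1` applies only to functions in `stab N`. An extra factor `τ` puts the monomial there and
    -- accounts for the exponent `k + 2`.
    have h := h1 k hk _ (tau_mul_mem_stab (tpow j * xiList L)) v hv
    have e : tau ^ (k + 1) * ((2 : ℂ) • (tau * (tpow j * xiList L)) + Delta (tau * (tpow j * xiList L)))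
        = (4 - (L.length : ℂ)) • (tau ^ (k + 2) * (tpow j * xiList L)) := by
      have h3 := euler_tau_pow_mul 1 (tpow j * xiList L)
      rw [pow_one] at h3
      rw [Delta_eq, h3, euler_mul, euler_tpow, euler_xiList, pow_succ _ (k + 1)]
      simp only [mul_add, mul_sub, mul_smul_comm, mul_assoc, zero_mul, zero_add]
      module
    rw [e, map_smul, LinearMap.smul_apply] at h
    exact (smul_eq_zero.1 h).resolve_left (sub_ne_zero.2 (by exact_mod_cast hL.symm))
  have h4 : ∀ k, n ≤ k → ∀ (j : ℤ) (L : List (Fin N)), ∀ v ∈ U,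
      Q.ham (tau ^ (k + 3) * (tpow j * xiList L)) v = 0 := by
    intro k hk j L v hv
    by_cases hL : L.length = 4
    swap
    · exact h2 (k + 1) (by omega) j L hL v hv
    by_cases hd : L.Nodup
    swap
    · rw [xiList_of_not_nodup hd, mul_zero, mul_zero, map_zero, LinearMap.zero_apply]
    -- A duplicate-free list of length `4` containing every index would force `N = 4`. This is the
    -- only use of that hypothesis.
    obtain ⟨i, hi⟩ : ∃ i, i ∉ L := by
      by_contra! hall
      have h5 : L.toFinset = Finset.univ := Finset.eq_univ_of_forall fun i => by simpa using hall i
      have h6 := List.toFinset_card_of_nodup hd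
      rw [h5, Finset.card_univ, Fintype.card_fin] at h6
      omega
    -- The exponent `j + ε_i` compensates the factor `t^{-ε_i}` produced by `contactBracket_xi_mul`.
    have hw : pdxi i (tau ^ (k + 2) * (tpow (j + ε i) * xiList L)) = 0 := by
      rw [pdxi_tau_pow_mul, pdxi_mul, pdxi_tpow, pdxi_xiList_of_notMem hi]
      simp
    have h5 := contactBracket_xi_mul ε i hw
    have e1 : xi i * (tau ^ (k + 2) * (tpow (j + ε i) * xiList L))
        = tau ^ (k + 2) * (tpow (j + ε i) * xiList (i :: L)) := by
      rw [xiList_cons, ← mul_assoc, ← tau_pow_mul_comm, mul_assoc, xi_tpow_mul]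
    have e2 : tpow (-ε i) * (tau * parity (tau ^ (k + 2) * (tpow (j + ε i) * xiList L)))
        = tau ^ (k + 3) * (tpow j * xiList L) := by
      rw [map_mul, map_mul, map_pow, parity_tau, parity_tpow, parity_xiList, hL, ← mul_assoc tau,
        ← pow_succ', ← mul_assoc, tpow_mul_comm, mul_assoc, tpow_mul_tpow_mul]
      norm_num
    rw [e1, e2] at h5
    obtain ⟨p, hp⟩ := exists_homog_monomial (k + 2) (j + ε i) (i :: L)
    have hq : tau * xi i ∈ homog 1 := by
      have := mul_mem_homog (tau_pow_mem_homog 1) (xi_mem_homog i)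
      rwa [pow_one, zero_add] at this
    have h6 := Q.ham_contactBracket hp hq v
    have hl : (i :: L).length ≠ 4 := by rw [List.length_cons, hL]; decide
    -- The degree `5` monomial already acts by zero, both on `v` and on its image under `τ ξ_i`, so
    -- the bracket does too.
    rw [h2 k hk _ _ hl v hv, h2 k hk _ _ hl _ (hU _ (tau_mul_mem_stab _) v hv), h5] at h6
    simpa using h6
  refine ⟨n + 3, fun k hk f v hv => ?_⟩
  obtain ⟨k, rfl⟩ : ∃ l, k = l + 3 := ⟨k - 3, by omega⟩
  refine monomial_induction (C := fun f => Q.ham (tau ^ (k + 3) * f) v = 0) (by simp)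
    (fun f g hf hg => by rw [mul_add, map_add, LinearMap.add_apply, hf, hg, add_zero])
    (fun c f hf => by rw [mul_smul_comm, map_smul, LinearMap.smul_apply, hf, smul_zero])
    (fun j L => h4 k (by omega) j L v hv) f

/-- A highest weight vector argument for `D_τ`: a monomial of order at least `3` raises the
eigenvalue by its order minus `2`, modulo terms with more factors `τ`. Since high powers of `τ` act
by zero, these error terms are removed by descending induction on the exponent of `τ`. -/
theorem exists_ham_higher_eq_zero (hN4 : N ≠ 4) (Q : AKModule ε X) (U : Submodule ℂ X)
    [FiniteDimensional ℂ U] (hU : ∀ f ∈ stab N, ∀ v ∈ U, Q.ham f v ∈ U) (hU0 : U ≠ ⊥) :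
    ∃ v ∈ U, v ≠ 0 ∧ ∀ f ∈ higher N, Q.ham f v = 0 := by
  obtain ⟨n, hn⟩ := Q.exists_ham_tau_pow_mul_eq_zero hN4 U hU
  have hs : (tau ^ 1 : SA N) ∈ stab N := by simpa using tau_mul_mem_stab (1 : SA N)
  let Z : Module.End ℂ U := (Q.ham (tau ^ 1)).restrict (hU _ hs)
  have : Nontrivial U := (Submodule.nontrivial_iff_ne_bot).2 hU0
  obtain ⟨μ, hμ, hmax⟩ := Set.exists_max_image _ Complex.re Z.finite_hasEigenvalue
    Z.exists_eigenvalue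
  obtain ⟨v, hv⟩ := Module.End.HasEigenvalue.exists_hasEigenvector hμ
  have hZ : Q.ham (tau ^ 1) v.1 = μ • v.1 := congrArg Subtype.val hv.apply_eq_smul
  -- Here `d` bounds how far the exponent `k` falls short of `n`, turning the descending induction
  -- on `k` into an ordinary one.
  have key : ∀ d k : ℕ, n ≤ k + d → ∀ (j : ℤ) (L : List (Fin N)), 3 ≤ 2 * k + L.length →
      Q.ham (tau ^ k * (tpow j * xiList L)) v.1 = 0 := by
    intro d
    induction d with
    | zero => intro k hk j L _; exact hn k hk _ _ v.2
    | succ d ih =>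
      intro k hk j L h
      by_contra hne
      have hF : tau ^ k * (tpow j * xiList L) ∈ stab N :=
        (higher_le (Submodule.subset_span ⟨k, j, L, h, rfl⟩)).1
      obtain ⟨c, hc⟩ := contactBracket_tau_monomial ε k j L
      have h1 := Q.ham_contactBracket_even (tau_pow_mem_homog 1) (tau ^ k * (tpow j * xiList L)) v.1
      rw [hc, map_add, map_smul, map_smul, LinearMap.add_apply, LinearMap.smul_apply,
        LinearMap.smul_apply, ih (k + 1) (by omega) (j - 1) L (by omega), smul_zero, add_zero, hZ,
        map_smul] at h1
      -- If the image of `v` is nonzero it is an eigenvector whose eigenvalue has real part at least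
      -- `1` above that of `μ`, contradicting maximality.
      have h2 : Z ⟨_, hU _ hF _ v.2⟩ = (2 * (k : ℂ) + (L.length : ℂ) - 2 + μ) •
          (⟨_, hU _ hF _ v.2⟩ : U) := Subtype.ext (by
        rw [Submodule.coe_smul, add_smul, h1]
        exact (sub_add_cancel _ _).symm)
      have h3 := hmax _ (Module.End.hasEigenvalue_of_hasEigenvector (Module.End.hasEigenvector_iff.2
        ⟨Module.End.mem_eigenspace_iff.2 h2, fun h0 => hne (congrArg Subtype.val h0)⟩))
      have h4 : (3 : ℝ) ≤ 2 * k + L.length := by exact_mod_cast h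
      simp at h3
      linarith
  refine ⟨v.1, v.2, fun h => hv.2 (Subtype.ext h), fun f hf => ?_⟩
  exact higher_induction (C := fun f => Q.ham f v.1 = 0) (by simp)
    (fun f g hf hg => by rw [map_add, LinearMap.add_apply, hf, hg, add_zero])
    (fun c f hf => by rw [map_smul, LinearMap.smul_apply, hf, smul_zero])
    (fun k j L h => key n k (by omega) j L h) hf

/-- The vectors of `U` killed by `D_f` for all `f` of higher order. -/
def highestPart (Q : AKModule ε X) (U : Submodule ℂ X) : Submodule ℂ X where
  carrier := {v | v ∈ U ∧ ∀ f ∈ higher N, Q.ham f v = 0}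
  add_mem' := by
    rintro v w ⟨hv, hv'⟩ ⟨hw, hw'⟩
    exact ⟨add_mem hv hw, fun f hf => by rw [map_add, hv' f hf, hw' f hf, add_zero]⟩
  zero_mem' := ⟨zero_mem _, fun f _ => map_zero _⟩
  smul_mem' := by
    rintro c v ⟨hv, hv'⟩
    exact ⟨U.smul_mem c hv, fun f hf => by rw [map_smul, hv' f hf, smul_zero]⟩

/-- For `g` of higher order, `D_g D_f v` differs by a sign and an order change from the action of
`{g, f}`, and this bracket is again of higher order because its symbol vanishes. -/
theorem ham_mem_highestPart (hN : 1 ≤ N) (Q : AKModule ε X) {U : Submodule ℂ X}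
    (hU : ∀ f ∈ stab N, ∀ v ∈ U, Q.ham f v ∈ U) {f : SA N} (hf : f ∈ stab N) {v : X}
    (hv : v ∈ Q.highestPart U) : Q.ham f v ∈ Q.highestPart U := by
  refine stab_induction (C := fun f => Q.ham f v ∈ Q.highestPart U)
    (fun f g hf hg => by rw [map_add]; exact add_mem hf hg) (fun p f hp hf => ?_) hf
  refine ⟨hU f hf v hv.1, fun g hg => ?_⟩
  refine higher_induction (C := fun g => Q.ham g (Q.ham f v) = 0) (by simp)
    (fun f g hf hg => by rw [map_add, LinearMap.add_apply, hf, hg, add_zero])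
    (fun c f hf => by rw [map_smul, LinearMap.smul_apply, hf, smul_zero])
    (fun k j L h => ?_) hg
  have hF : tau ^ k * (tpow j * xiList L) ∈ higher N := Submodule.subset_span ⟨k, j, L, h, rfl⟩
  obtain ⟨q, hq⟩ := exists_homog_monomial k j L
  have h1 := Q.ham_contactBracket hq hp v
  have h2 : contactBracket ε (tau ^ k * (tpow j * xiList L)) f ∈ higher N :=
    mem_higher_iff.2 ⟨contactBracket_mem_stab ε (higher_le hF).1 hf, by
      rw [symbol_contactBracket hN ε hq hp (higher_le hF).1 hf, (higher_le hF).2, zero_lie]⟩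
  rw [hv.2 _ h2, hv.2 _ hF, map_zero, smul_zero, sub_zero] at h1
  exact h1.symm

theorem par_mem_highestPart (Q : AKModule ε X) {U : Submodule ℂ X} (hU : ∀ v ∈ U, Q.par v ∈ U)
    {v : X} (hv : v ∈ Q.highestPart U) : Q.par v ∈ Q.highestPart U := by
  refine ⟨hU v hv.1, fun f hf => ?_⟩
  have h1 : parity f ∈ higher N :=
    mem_higher_iff.2 ⟨parity_mem_stab (higher_le hf).1, by rw [symbol_parity, (higher_le hf).2]⟩
  have := Q.par_ham (parity f) v
  rw [hv.2 _ h1, map_zero, parity_parity] at this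
  exact this.symm

/-- `f` and the chosen lift of its symbol differ by a function of higher order, which kills `v`.
Thus the action factors through the symbol. -/
theorem ham_eq_ham_symbolSection (Q : AKModule ε X) {U : Submodule ℂ X} {f : SA N}
    (hf : f ∈ stab N) {v : X} (hv : v ∈ Q.highestPart U) :
    Q.ham f v = Q.ham (symbolSection (symbol f)) v := by
  have h : f - symbolSection (symbol f) ∈ higher N :=
    mem_higher_iff.2 ⟨sub_mem hf (symbolSection_mem_stab _), by
      rw [map_sub, symbol_symbolSection, sub_self]⟩
  have := hv.2 _ h
  rwa [map_sub, LinearMap.sub_apply, sub_eq_zero] at this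

/-- The section of the symbol is only linear, but its failure to respect brackets has symbol zero
and is invisible on `highestPart`. -/
theorem ham_symbolSection_lie (hN : 1 ≤ N) (Q : AKModule ε X) {U : Submodule ℂ X} (x y : Levi N)
    {v : X} (hv : v ∈ Q.highestPart U) : Q.ham (symbolSection ⁅x, y⁆) v
      = Q.ham (symbolSection x) (Q.ham (symbolSection y) v)
        - Q.ham (symbolSection y) (Q.ham (symbolSection x) v) := by
  have hx := symbolSection_mem_stab x
  have hy := symbolSection_mem_stab y
  rw [← Q.ham_contactBracket_even (symbolSection_mem_homog x),
    Q.ham_eq_ham_symbolSection (contactBracket_mem_stab ε hx hy) hv,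
    symbol_contactBracket hN ε (symbolSection_mem_homog x) (symbolSection_mem_homog y) hx hy,
    symbol_symbolSection, symbol_symbolSection]

end AKModule


namespace AKModule

/-! ### Vectors on which `𝒜` acts by evaluation at the point -/

section

variable {ε : Fin N → ℤ} {X : Type*} [AddCommGroup X] [Module ℂ X]

theorem fn_eq_evalPt_smul (Q : AKModule ε X) {v : X} (ht : Q.fn (tpow 1) v = v)
    (hx : ∀ i, Q.fn (xi i) v = 0) (h : SA N) : Q.fn h v = evalPt h • v := by
  induction h using SA_induction with
  | hc c => simp
  | ht k =>
    rw [evalPt_tpow, one_smul]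
    have e : ∀ k : ℤ, Q.fn (tpow (k + 1)) v = Q.fn (tpow k) v := fun k => by
      rw [tpow_add, map_mul, Module.End.mul_apply, ht]
    induction k using Int.induction_on with
    | zero => rw [tpow_zero, map_one, Module.End.one_apply]
    | succ n ih => rw [e, ih]
    | pred n ih => rw [← e, sub_add_cancel, ih]
  | hx i => rw [hx, evalPt_xi, zero_smul]
  | hadd f g hf hg => rw [map_add, LinearMap.add_apply, hf, hg, map_add, add_smul]
  | hmul f g hf hg =>
    rw [map_mul, Module.End.mul_apply, hg, map_smul, hf, map_mul, smul_smul, mul_comm]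

/-- Treat the odd variables one at a time, replacing `v` by `ξ_a v` whenever this is nonzero. Since
`ξ_a^2 = 0` and the `ξ_i` anticommute, variables already dealt with still kill the new vector. -/
theorem exists_fn_xi_eq_zero (Q : AKModule ε X) {E : Submodule ℂ X}
    (hE : ∀ i, ∀ v ∈ E, Q.fn (xi i) v ∈ E) (hE0 : E ≠ ⊥) :
    ∃ v ∈ E, v ≠ 0 ∧ ∀ i, Q.fn (xi i) v = 0 := by
  suffices h : ∀ s : Finset (Fin N), ∃ v ∈ E, v ≠ 0 ∧ ∀ i ∈ s, Q.fn (xi i) v = 0 by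
    obtain ⟨v, hv, hv0, h⟩ := h Finset.univ
    exact ⟨v, hv, hv0, fun i => h i (Finset.mem_univ i)⟩
  intro s
  induction s using Finset.induction_on with
  | empty =>
    obtain ⟨v, hv, hv0⟩ := E.exists_mem_ne_zero_of_ne_bot hE0
    exact ⟨v, hv, hv0, by simp⟩
  | insert a s _ ih =>
    obtain ⟨v, hv, hv0, h⟩ := ih
    by_cases ha : Q.fn (xi a) v = 0
    · refine ⟨v, hv, hv0, fun i hi => ?_⟩
      rcases Finset.mem_insert.1 hi with rfl | hi
      · exact ha
      · exact h i hi
    · refine ⟨_, hE a v hv, ha, fun i hi => ?_⟩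
      rw [← Module.End.mul_apply, ← map_mul]
      rcases Finset.mem_insert.1 hi with rfl | hi
      · rw [xi_mul_self, map_zero, LinearMap.zero_apply]
      · rw [xi_mul_xi, map_neg, LinearMap.neg_apply, map_mul, Module.End.mul_apply, h i hi, map_zero,
          neg_zero]

/-- The vectors on which `𝒜` acts by evaluation at the point. -/
def evalPart (Q : AKModule ε X) : Submodule ℂ X where
  carrier := {v | ∀ h, Q.fn h v = evalPt h • v}
  add_mem' := by
    intro v w hv hw h
    rw [map_add, hv, hw, smul_add]
  zero_mem' := fun h => by simp
  smul_mem' := by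
    intro c v hv h
    rw [map_smul, hv, smul_comm]

/-- Moving `h` past `D_f` produces the function `D_f(h)`, which evaluates to zero because `D_f`
vanishes at the point. The sign is harmless since odd functions also evaluate to zero. -/
theorem ham_mem_evalPart (Q : AKModule ε X) {f : SA N} (hf : f ∈ stab N) {v : X}
    (hv : v ∈ Q.evalPart) : Q.ham f v ∈ Q.evalPart := by
  refine stab_induction (C := fun f => Q.ham f v ∈ Q.evalPart)
    (fun f g hf hg => by rw [map_add]; exact add_mem hf hg) (fun p f hp hf => ?_) hf
  have key : ∀ {q : ZMod 2} {h : SA N}, h ∈ homog q →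
      Q.fn h (Q.ham f v) = evalPt h • Q.ham f v := by
    intro q h hq
    have h1 := Q.lie_fn (contactField_mem_part ε hp) hq v
    rw [← Q.ham_of_homog hp, hv, hv, evalPt_contactField ε hf, zero_smul, map_smul] at h1
    rcases parity_cases q with rfl | rfl
    · rw [mul_zero, sgn_zero, one_smul] at h1
      exact (sub_eq_zero.1 h1.symm).symm
    · rw [evalPt_of_odd hq, zero_smul, zero_sub, zero_eq_neg, ← Module.End.mul_apply] at h1
      rw [evalPt_of_odd hq, zero_smul]
      have h2 := congrArg (fun x => sgn (p * 1) • x) h1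
      simpa [smul_smul, sgn_mul_self] using h2
  intro h
  obtain ⟨h₀, e₀, h₁, e₁, rfl⟩ := exists_homog h
  rw [map_add, LinearMap.add_apply, key e₀, key e₁, map_add, add_smul]

theorem par_mem_evalPart (Q : AKModule ε X) {v : X} (hv : v ∈ Q.evalPart) :
    Q.par v ∈ Q.evalPart := by
  have key : ∀ {q : ZMod 2} {h : SA N}, h ∈ homog q → Q.fn h (Q.par v) = evalPt h • Q.par v := by
    intro q h hq
    have h1 := Q.par_fn hq v
    rw [hv, map_smul] at h1
    rcases parity_cases q with rfl | rfl
    · rw [h1, sgn_zero, one_smul]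
    · rw [evalPt_of_odd hq, zero_smul] at h1 ⊢
      rw [sgn_one, neg_one_smul, zero_eq_neg] at h1
      exact h1
  intro h
  obtain ⟨h₀, e₀, h₁, e₁, rfl⟩ := exists_homog h
  rw [map_add, LinearMap.add_apply, key e₀, key e₁, map_add, add_smul]

end

/-! ### The completion of a weight module -/

section

variable {ε : Fin N → ℤ} {M : Type*} [AddCommGroup M] [Module ℂ M]

/-- The operator on sequences given by an operator on `M` and a shift of the index by `s`. -/
def seqShift (M : Type*) [AddCommGroup M] [Module ℂ M] (s : ℤ) :
    Module.End ℂ M →ₗ[ℂ] Module.End ℂ (ℤ → M) where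
  toFun T := LinearMap.pi fun m => T ∘ₗ LinearMap.proj (m - s)
  map_add' _ _ := rfl
  map_smul' _ _ := rfl

theorem seqShift_apply (s : ℤ) (T : Module.End ℂ M) (v : ℤ → M) (m : ℤ) :
    seqShift M s T v m = T (v (m - s)) := rfl

theorem seqShift_mul (s r : ℤ) (T T' : Module.End ℂ M) :
    seqShift M s T * seqShift M r T' = seqShift M (s + r) (T * T') := by
  refine LinearMap.ext fun v => funext fun m => ?_
  simp only [Module.End.mul_apply, seqShift_apply, sub_sub]

/-- With the shift written in the other order, both products in a supercommutator carry the same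
index shift and can be combined. -/
theorem seqShift_mul' (s r : ℤ) (T T' : Module.End ℂ M) :
    seqShift M s T * seqShift M r T' = seqShift M (r + s) (T * T') := by
  rw [seqShift_mul, add_comm]

/-- The action of `𝒜` on sequences. -/
def seqFn (P : AKModule ε M) : SA N →ₗ[ℂ] Module.End ℂ (ℤ → M) :=
  DirectSum.toModule ℂ ℤ _ (fun s => seqShift M s ∘ₗ P.fn.toLinearMap ∘ₗ
    (weightPart ε (Dt ε) s).subtype) ∘ₗ (gradeSA ε).toLinearMap

/-- The action of `𝒦(N; ε)` on sequences. -/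
def seqLie (P : AKModule ε M) : contactAlgebra ε →ₗ[ℂ] Module.End ℂ (ℤ → M) :=
  DirectSum.toModule ℂ ℤ _ (fun s => seqShift M s ∘ₗ
    P.lie.domRestrict (weightPart (X := contactAlgebra ε) ε (adDt ε) s)) ∘ₗ (gradeContact ε).toLinearMap

theorem seqFn_of_mem (P : AKModule ε M) {s : ℤ} {f : SA N} (hf : f ∈ weightPart ε (Dt ε) s) :
    P.seqFn f = seqShift M s (P.fn f) := by
  have := gradeSA_coe ε ⟨f, hf⟩
  simp only [seqFn, LinearMap.comp_apply, LinearEquiv.coe_coe]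
  rw [this, DirectSum.toModule_lof]
  rfl

theorem seqLie_of_mem (P : AKModule ε M) {s : ℤ} {x : contactAlgebra ε}
    (hx : x ∈ weightPart (X := contactAlgebra ε) ε (adDt ε) s) :
    P.seqLie x = seqShift M s (P.lie x) := by
  have := gradeContact_coe ε ⟨x, hx⟩
  simp only [seqLie, LinearMap.comp_apply, LinearEquiv.coe_coe]
  rw [this, DirectSum.toModule_lof]
  rfl

/-- The parity operator on sequences. -/
def seqPar (P : AKModule ε M) : Module.End ℂ (ℤ → M) := seqShift M 0 P.par

theorem seqPar_apply (P : AKModule ε M) (v : ℤ → M) (m : ℤ) : P.seqPar v m = P.par (v m) := by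
  rw [seqPar, seqShift_apply, sub_zero]

theorem seqFn_one (P : AKModule ε M) : P.seqFn 1 = 1 := by
  have h1 : (1 : SA N) ∈ weightPart ε (Dt ε) 0 := mem_weightPart.2 (by
    rw [superDer_one (Dt_mem ε).1]; simp)
  rw [P.seqFn_of_mem h1, map_one]
  refine LinearMap.ext fun v => funext fun m => ?_
  rw [seqShift_apply, sub_zero]
  rfl

theorem seqFn_mul (P : AKModule ε M) (f g : SA N) : P.seqFn (f * g) = P.seqFn f * P.seqFn g := by
  revert g
  refine SA_weight_induction (ε := ε) (C := fun f => ∀ g, P.seqFn (f * g) = P.seqFn f * P.seqFn g)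
    (by simp) (fun f f' h h' g => by rw [add_mul, map_add, h, h', map_add, add_mul])
    (fun s f hs g => ?_) f
  refine SA_weight_induction (ε := ε) (C := fun g => P.seqFn (f * g) = P.seqFn f * P.seqFn g)
    (by simp) (fun g g' h h' => by rw [mul_add, map_add, h, h', map_add, mul_add])
    (fun r g hr => ?_) g
  rw [P.seqFn_of_mem (mul_mem_weightPart hs hr), P.seqFn_of_mem hs, P.seqFn_of_mem hr, map_mul,
    seqShift_mul]

/-- The `𝒜𝒦(N; ε)` module of sequences of vectors of `P`, where elements of degree `s` shift the
index by `s`. -/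
def seqModule (P : AKModule ε M) : AKModule ε (ℤ → M) where
  par := P.seqPar
  fn := AlgHom.ofLinearMap P.seqFn P.seqFn_one P.seqFn_mul
  lie := P.seqLie
  par_par w := funext fun m => by rw [seqPar_apply, seqPar_apply, P.par_par]
  par_fn {p f} hf w := by
    suffices h : P.seqPar * P.seqFn f = sgn p • (P.seqFn f * P.seqPar) from LinearMap.congr_fun h w
    refine homog_induction (ε := ε) (C := fun f =>
      P.seqPar * P.seqFn f = sgn p • (P.seqFn f * P.seqPar)) (by simp) (fun f g _ _ h h' => ?_)
      (fun s f hf hs => ?_) hf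
    · rw [map_add, mul_add, h, h', add_mul, smul_add]
    -- On weight vectors both sides are the same index shift applied to an operator on `M`, so the
    -- identity is the corresponding axiom of `P`. The remaining axioms follow the same pattern.
    · rw [P.seqFn_of_mem hs, seqPar, seqShift_mul, seqShift_mul', ← map_smul]
      exact congrArg _ (LinearMap.ext fun v => P.par_fn hf v)
  par_lie {p D} hD w := by
    suffices h : P.seqPar * P.seqLie (toK hD) = sgn p • (P.seqLie (toK hD) * P.seqPar) from
      LinearMap.congr_fun h w
    refine contactPart_induction (ε := ε) (C := fun D hD =>
      P.seqPar * P.seqLie (toK hD) = sgn p • (P.seqLie (toK hD) * P.seqPar)) (by simp [toK_zero])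
      (fun D E hD hE h h' => ?_) (fun s D hD hs => ?_) hD
    · rw [toK_add, map_add, mul_add, h, h', add_mul, smul_add]
    · rw [P.seqLie_of_mem hs, seqPar, seqShift_mul, seqShift_mul', ← map_smul]
      exact congrArg _ (LinearMap.ext fun v => P.par_lie hD v)
  lie_lie {p q D E} hD hE w := by
    suffices h : P.seqLie (toK (superBracket_mem hD hE))
        = P.seqLie (toK hD) * P.seqLie (toK hE)
          - sgn (p * q) • (P.seqLie (toK hE) * P.seqLie (toK hD)) from LinearMap.congr_fun h w
    revert E
    refine contactPart_induction (ε := ε) (C := fun D hD => ∀ {E} (hE : E ∈ contactPart ε q),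
      P.seqLie (toK (superBracket_mem hD hE)) = P.seqLie (toK hD) * P.seqLie (toK hE)
        - sgn (p * q) • (P.seqLie (toK hE) * P.seqLie (toK hD)))
      (fun {E} hE => ?_) (fun D D' hD hD' h h' {E} hE => ?_) (fun s D hD hs {E} hE => ?_) hD
    · have : toK (superBracket_mem (zero_mem (contactPart ε p)) hE) = 0 :=
        Subtype.ext (by simp [toK, superBracket])
      rw [this, toK_zero]
      simp only [map_zero, zero_mul, mul_zero, smul_zero]
      exact (sub_zero _).symm
    · have : toK (superBracket_mem (add_mem hD hD') hE)
          = toK (superBracket_mem hD hE) + toK (superBracket_mem hD' hE) :=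
        Subtype.ext (by
          simp only [toK, superBracket, Submodule.coe_add, add_mul, mul_add, smul_add]; abel)
      rw [this, map_add, h hE, h' hE, toK_add hD hD', map_add]
      simp only [add_mul, mul_add, smul_add]
      abel
    · refine contactPart_induction (ε := ε) (C := fun E hE =>
        P.seqLie (toK (superBracket_mem hD hE)) = P.seqLie (toK hD) * P.seqLie (toK hE)
          - sgn (p * q) • (P.seqLie (toK hE) * P.seqLie (toK hD)))
        ?_ (fun E E' hE hE' h h' => ?_) (fun r E hE hr => ?_) hE
      · have : toK (superBracket_mem hD (zero_mem (contactPart ε q))) = 0 :=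
          Subtype.ext (by simp [toK, superBracket])
        rw [this, toK_zero]
        simp only [map_zero, zero_mul, mul_zero, smul_zero]
        exact (sub_zero _).symm
      · have : toK (superBracket_mem hD (add_mem hE hE'))
            = toK (superBracket_mem hD hE) + toK (superBracket_mem hD hE') :=
          Subtype.ext (by
            simp only [toK, superBracket, Submodule.coe_add, add_mul, mul_add, smul_add]; abel)
        rw [this, map_add, h, h', toK_add hE hE', map_add]
        simp only [add_mul, mul_add, smul_add]
        abel
      · rw [P.seqLie_of_mem (toK_superBracket_mem hs hr), P.seqLie_of_mem hs, P.seqLie_of_mem hr,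
          seqShift_mul, seqShift_mul', ← map_smul, ← map_sub]
        exact congrArg _ (LinearMap.ext fun v => P.lie_lie hD hE v)
  lie_fn {p q D f} hD hf w := by
    suffices h : P.seqFn (D f) = P.seqLie (toK hD) * P.seqFn f
          - sgn (p * q) • (P.seqFn f * P.seqLie (toK hD)) from LinearMap.congr_fun h w
    revert f
    refine contactPart_induction (ε := ε) (C := fun D hD => ∀ {f} (hf : f ∈ homog q),
      P.seqFn (D f) = P.seqLie (toK hD) * P.seqFn f
          - sgn (p * q) • (P.seqFn f * P.seqLie (toK hD)))
      (fun {E} hE => ?_) (fun D D' hD hD' h h' {E} hE => ?_) (fun s D hD hs {f} hf => ?_) hD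
    · rw [toK_zero]
      simp only [map_zero, zero_mul, mul_zero, smul_zero, LinearMap.zero_apply]
      exact (sub_zero _).symm
    · rw [LinearMap.add_apply, map_add, h hE, h' hE, toK_add hD hD', map_add]
      simp only [add_mul, mul_add, smul_add]
      abel
    · refine homog_induction (ε := ε) (C := fun f =>
        P.seqFn (D f) = P.seqLie (toK hD) * P.seqFn f
          - sgn (p * q) • (P.seqFn f * P.seqLie (toK hD)))
        (by
          simp only [map_zero, zero_mul, mul_zero, smul_zero]
          exact (sub_zero _).symm)
        (fun E E' hE hE' h h' => ?_) (fun r f hf hr => ?_) hf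
      · rw [map_add, map_add, h, h', map_add]
        simp only [add_mul, mul_add, smul_add]
        abel
      · rw [P.seqFn_of_mem (apply_mem_weightPart hs hr), P.seqLie_of_mem hs, P.seqFn_of_mem hr,
          seqShift_mul, seqShift_mul', ← map_smul, ← map_sub]
        exact congrArg _ (LinearMap.ext fun v => P.lie_fn hD hf v)

theorem seqModule_fn_of_mem (P : AKModule ε M) {s : ℤ} {f : SA N}
    (hf : f ∈ weightPart ε (Dt ε) s) (v : ℤ → M) (m : ℤ) :
    P.seqModule.fn f v m = P.fn f (v (m - s)) := by
  have := P.seqFn_of_mem hf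
  exact congrFun (LinearMap.congr_fun this v) m

theorem seqModule_lie_of_mem (P : AKModule ε M) {s : ℤ} {x : contactAlgebra ε}
    (hx : x ∈ weightPart (X := contactAlgebra ε) ε (adDt ε) s) (v : ℤ → M) (m : ℤ) :
    P.seqModule.lie x v m = P.lie x (v (m - s)) := by
  have := P.seqLie_of_mem hx
  exact congrFun (LinearMap.congr_fun this v) m

/-- The completion `∏_m P_{a + s m}`, as a space of sequences. -/
def weightSeq (P : AKModule ε M) (a : ℂ) : Submodule ℂ (ℤ → M) where
  carrier := {v | ∀ m, P.lie (DtK ε) (v m) = (a + (step ε : ℂ) * m) • v m}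
  add_mem' := by
    intro v w hv hw m
    rw [Pi.add_apply, map_add, hv, hw, smul_add]
  zero_mem' := fun m => by simp
  smul_mem' := by
    intro c v hv m
    rw [Pi.smul_apply, map_smul, hv, smul_comm]

/-- An operator of degree `s` changes the `D_t`-weight by exactly the amount by which the index is
shifted, so the completion is a submodule of the module of all sequences. -/
theorem seqShift_mem_weightSeq (P : AKModule ε M) (a : ℂ) {s : ℤ} {T : Module.End ℂ M}
    (hT : T ∈ P.homogOps s) {v : ℤ → M} (hv : v ∈ P.weightSeq a) :
    seqShift M s T v ∈ P.weightSeq a := by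
  intro m
  have h := LinearMap.congr_fun (show P.lie (DtK ε) * T - T * P.lie (DtK ε)
    = ((step ε : ℂ) * s) • T from hT) (v (m - s))
  simp only [LinearMap.sub_apply, Module.End.mul_apply, LinearMap.smul_apply] at h
  rw [seqShift_apply, eq_add_of_sub_eq h, hv, map_smul]
  push_cast
  module

theorem fn_mem_weightSeq (P : AKModule ε M) (a : ℂ) (f : SA N) {v : ℤ → M}
    (hv : v ∈ P.weightSeq a) : P.seqModule.fn f v ∈ P.weightSeq a := by
  refine SA_weight_induction (ε := ε) (C := fun f => P.seqModule.fn f v ∈ P.weightSeq a)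
    (by rw [map_zero]; exact zero_mem _)
    (fun f g hf hg => by rw [map_add]; exact add_mem hf hg) (fun s f hs => ?_) f
  rw [show P.seqModule.fn f = _ from P.seqFn_of_mem hs]
  exact P.seqShift_mem_weightSeq a (P.fn_mem_homogOps hs) hv

theorem contact_weight_induction {C : contactAlgebra ε → Prop} (h0 : C 0)
    (hadd : ∀ x y, C x → C y → C (x + y))
    (hC : ∀ s, ∀ x ∈ weightPart (X := contactAlgebra ε) ε (adDt ε) s, C x)
    (x : contactAlgebra ε) : C x :=
  Submodule.iSup_induction (weightPart (X := contactAlgebra ε) ε (adDt ε)) (motive := C)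
    (iSup_weightPart_contact ε ▸ Submodule.mem_top) hC h0 hadd

theorem lie_mem_weightSeq (P : AKModule ε M) (a : ℂ) (x : contactAlgebra ε) {v : ℤ → M}
    (hv : v ∈ P.weightSeq a) : P.seqModule.lie x v ∈ P.weightSeq a := by
  refine contact_weight_induction (ε := ε) (C := fun x => P.seqModule.lie x v ∈ P.weightSeq a)
    (by rw [map_zero]; exact zero_mem _)
    (fun f g hf hg => by rw [map_add]; exact add_mem hf hg) (fun s x hs => ?_) x
  rw [show P.seqModule.lie x = _ from P.seqLie_of_mem hs]
  exact P.seqShift_mem_weightSeq a (P.lie_mem_homogOps hs) hv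

theorem par_mem_weightSeq (P : AKModule ε M) (a : ℂ) {v : ℤ → M}
    (hv : v ∈ P.weightSeq a) : P.seqModule.par v ∈ P.weightSeq a :=
  P.seqShift_mem_weightSeq a P.par_mem_homogOps hv

/-- The vectors of the completion on which `𝒜` acts by evaluation at the point. -/
def fiber (P : AKModule ε M) (a : ℂ) : Submodule ℂ (ℤ → M) :=
  P.weightSeq a ⊓ P.seqModule.evalPart

/-! ### The fiber of the completion is finite-dimensional and nonzero -/

theorem exists_tpow_mem_weightPart (ε : Fin N → ℤ) : ∃ r : ℤ, (r = 1 ∨ r = 2) ∧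
    ∀ k, (tpow k : SA N) ∈ weightPart ε (Dt ε) (r * k) := by
  obtain ⟨r, hr, h⟩ : ∃ r : ℤ, (r = 1 ∨ r = 2) ∧ (2 : ℂ) = (step ε : ℂ) * r := by
    unfold step
    split_ifs
    · exact ⟨1, Or.inl rfl, by simp⟩
    · exact ⟨2, Or.inr rfl, by simp⟩
  refine ⟨r, hr, fun k => mem_weightPart.2 ?_⟩
  rw [Dt_tpow, h]
  push_cast
  rw [mul_assoc]

/-- Vectors of the fiber are fixed by `t`, which moves the index by `r`, equal to `1` or `2`. Two
consecutive components therefore determine all others in either case. -/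
theorem finiteDimensional_fiber {P : AKModule ε M} {a : ℂ} (hJ : P.IsJet a) :
    FiniteDimensional ℂ (P.fiber a) := by
  obtain ⟨r, hr, hw⟩ := exists_tpow_mem_weightPart ε
  have hq := hJ.quasifinite
  let F : ∀ m : ℤ, P.fiber a →ₗ[ℂ] P.weightSpace (a + (step ε : ℂ) * m) := fun m =>
    LinearMap.codRestrict _ (LinearMap.proj m ∘ₗ (P.fiber a).subtype) fun v =>
      Module.End.mem_eigenspace_iff.2 (v.2.1 m)
  have hstep : ∀ v : P.fiber a, ∀ k m : ℤ, v.1 m = P.fn (tpow k) (v.1 (m - r * k)) := fun v k m => by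
    rw [← P.seqModule_fn_of_mem (hw k), v.2.2, evalPt_tpow, one_smul]
  refine FiniteDimensional.of_injective ((F 0).prod (F 1))
    ((injective_iff_map_eq_zero _).2 fun v hv => ?_)
  have h0 : v.1 0 = 0 := congrArg (fun x => (x.1 : M)) hv
  have h1 : v.1 1 = 0 := congrArg (fun x => (x.2 : M)) hv
  have key : ∀ m : ℤ, v.1 m = 0 ∧ v.1 (m + 1) = 0 := by
    intro m
    induction m using Int.induction_on with
    | zero => exact ⟨h0, by rw [zero_add]; exact h1⟩
    | succ n ih =>
      refine ⟨ih.2, ?_⟩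
      rw [hstep v 1]
      rcases hr with rfl | rfl
      · rw [show (n : ℤ) + 1 + 1 - 1 * 1 = n + 1 by ring, ih.2, map_zero]
      · rw [show (n : ℤ) + 1 + 1 - 2 * 1 = n by ring, ih.1, map_zero]
    | pred n ih =>
      rw [sub_add_cancel]
      refine ⟨?_, ih.1⟩
      rw [hstep v (-1)]
      rcases hr with rfl | rfl
      · rw [show -(n : ℤ) - 1 - 1 * -1 = -n by ring, ih.1, map_zero]
      · rw [show -(n : ℤ) - 1 - 2 * -1 = -n + 1 by ring, ih.2, map_zero]
  exact Subtype.ext (funext fun m => (key m).1)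

/-- The completion, unlike `P`, contains infinite sums, so a vector fixed by `t` can be built from
any nonzero weight vector. The space `E` of all such fixed vectors is stable under the `ξ_i`, and
one of its nonzero vectors is killed by all of them. -/
theorem fiber_ne_bot [Nontrivial M] {P : AKModule ε M} {a : ℂ} (hJ : P.IsJet a) :
    P.fiber a ≠ ⊥ := by
  obtain ⟨r, hr, hw⟩ := exists_tpow_mem_weightPart ε
  have hr0 : r ≠ 0 := by rcases hr with rfl | rfl <;> decide
  obtain ⟨μ, hμ⟩ : ∃ μ, P.weightSpace μ ≠ ⊥ := by
    by_contra! h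
    have := hJ.diagonalizable
    simp only [h, iSup_bot] at this
    exact bot_ne_top this
  obtain ⟨m₀, rfl⟩ := hJ.support μ hμ
  obtain ⟨w, hw', hw0⟩ := Submodule.exists_mem_ne_zero_of_ne_bot hμ
  have hw1 : P.lie (DtK ε) w = (a + (step ε : ℂ) * m₀) • w := Module.End.mem_eigenspace_iff.1 hw'
  let E : Submodule ℂ (ℤ → M) :=
    P.weightSeq a ⊓ LinearMap.ker (P.seqModule.fn (tpow 1) - LinearMap.id)
  have hE : ∀ i, ∀ v ∈ E, P.seqModule.fn (xi i) v ∈ E := by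
    rintro i v ⟨hv, hv'⟩
    refine ⟨P.fn_mem_weightSeq a _ hv, ?_⟩
    have hv2 : P.seqModule.fn (tpow 1) v = v := sub_eq_zero.1 hv'
    show _ = _
    rw [LinearMap.sub_apply, LinearMap.id_apply, ← Module.End.mul_apply, ← map_mul, tpow_mul_comm,
      map_mul, Module.End.mul_apply, hv2, sub_self]
  have hE0 : E ≠ ⊥ := by
    -- The formal sum of all `t^k w`, with `t^k w` in index `m₀ + r k`; indices in the other residue
    -- classes modulo `r` carry zero. Its component of index `m₀` is `w`.
    let v : ℤ → M := fun m => if r ∣ m - m₀ then P.fn (tpow ((m - m₀) / r)) w else 0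
    refine (Submodule.ne_bot_iff _).2 ⟨v, ⟨fun m => ?_, ?_⟩, fun h => hw0 ?_⟩
    · by_cases hm : r ∣ m - m₀
      · obtain ⟨k, hk⟩ := hm
        have e : v m = P.fn (tpow k) w := by
          simp only [v, hk, dvd_mul_right, if_true, Int.mul_ediv_cancel_left _ hr0]
        have h := LinearMap.congr_fun (show P.lie (DtK ε) * P.fn (tpow k) - P.fn (tpow k) *
          P.lie (DtK ε) = ((step ε : ℂ) * (r * k : ℤ)) • P.fn (tpow k) from
            P.fn_mem_homogOps (hw k)) w
        simp only [LinearMap.sub_apply, Module.End.mul_apply, LinearMap.smul_apply] at h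
        rw [e, eq_add_of_sub_eq h, hw1, map_smul, ← hk]
        push_cast
        module
      · simp [v, hm]
    · show _ = _
      rw [LinearMap.sub_apply, LinearMap.id_apply, sub_eq_zero]
      refine funext fun m => ?_
      rw [P.seqModule_fn_of_mem (hw 1), mul_one]
      by_cases hm : r ∣ m - m₀
      · obtain ⟨k, hk⟩ := hm
        have hk' : m - r - m₀ = r * (k - 1) := by rw [mul_sub, ← hk]; ring
        simp only [v, hk, hk', dvd_mul_right, if_true, Int.mul_ediv_cancel_left _ hr0]
        rw [← Module.End.mul_apply, ← map_mul, ← tpow_add, add_sub_cancel]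
      · have hm' : ¬ r ∣ m - r - m₀ := by
          rw [show m - r - m₀ = m - m₀ - r by ring, dvd_sub_self_right]
          exact hm
        simp only [v, hm, hm', if_false, map_zero]
    · have := congrFun h m₀
      simpa [v, tpow_zero] using this
  obtain ⟨v, hv, hv0, hx⟩ := P.seqModule.exists_fn_xi_eq_zero hE hE0
  exact (Submodule.ne_bot_iff _).2 ⟨v, ⟨hv.1, fun h =>
    P.seqModule.fn_eq_evalPt_smul (sub_eq_zero.1 hv.2) hx h⟩, hv0⟩

theorem ham_mem_fiber (P : AKModule ε M) (a : ℂ) {f : SA N} (hf : f ∈ stab N) {v : ℤ → M}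
    (hv : v ∈ P.fiber a) : P.seqModule.ham f v ∈ P.fiber a :=
  ⟨P.lie_mem_weightSeq a _ hv.1, P.seqModule.ham_mem_evalPart hf hv.2⟩

theorem par_mem_fiber (P : AKModule ε M) (a : ℂ) {v : ℤ → M} (hv : v ∈ P.fiber a) :
    P.seqModule.par v ∈ P.fiber a :=
  ⟨P.par_mem_weightSeq a hv.1, P.seqModule.par_mem_evalPart hv.2⟩

end

end AKModule


/-! ### Irreducible representations inside finite-dimensional ones -/

theorem exists_minimal_invariant {L X : Type*} [AddCommGroup X] [Module ℂ X] (W : Submodule ℂ X) [FiniteDimensional ℂ W] (hW0 : W ≠ ⊥)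
    (ρ : L → Module.End ℂ X) (hW : ∀ x, ∀ v ∈ W, ρ x v ∈ W) :
    ∃ Y ≤ W, Y ≠ ⊥ ∧ (∀ x, ∀ v ∈ Y, ρ x v ∈ Y) ∧
      ∀ Z ≤ Y, Z ≠ ⊥ → (∀ x, ∀ v ∈ Z, ρ x v ∈ Z) → Z = Y := by
  obtain ⟨Y, ⟨hY, hY0, hYi⟩, hmin⟩ := WellFounded.has_min
    (measure fun Y : Submodule ℂ X => Module.finrank ℂ Y).wf
    {Y | Y ≤ W ∧ Y ≠ ⊥ ∧ ∀ x, ∀ v ∈ Y, ρ x v ∈ Y} ⟨W, le_rfl, hW0, hW⟩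
  refine ⟨Y, hY, hY0, hYi, fun Z hZ hZ0 hZi => ?_⟩
  have : FiniteDimensional ℂ Y := Submodule.finiteDimensional_of_le hY
  exact Submodule.eq_of_le_of_finrank_le hZ (not_lt.1 (hmin Z ⟨hZ.trans hY, hZ0, hZi⟩))

section

variable {L : Type*} [LieRing L] [LieAlgebra ℂ L] {X : Type*} [AddCommGroup X] [Module ℂ X]

/-- `ρ` respects brackets only on `W`, so `X` itself is not a module over `L`. A minimal invariant
subspace is irreducible, and transporting it to a coordinate space gives a module in `Type` whatever
the universe of `X`. -/
theorem exists_irreducible_rep (W : Submodule ℂ X) [FiniteDimensional ℂ W] (hW0 : W ≠ ⊥)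
    (ρ : L →ₗ[ℂ] Module.End ℂ X) (hW : ∀ x, ∀ v ∈ W, ρ x v ∈ W)
    (hρ : ∀ x y, ∀ v ∈ W, ρ ⁅x, y⁆ v = ρ x (ρ y v) - ρ y (ρ x v)) {z : L}
    (hz : ∀ x : L, ⁅x, z⁆ = 0) :
    ∃ (V : Type) (_ : AddCommGroup V) (_ : Module ℂ V) (_ : LieRingModule L V)
      (_ : LieModule ℂ L V) (c : ℂ) (ι : V →ₗ[ℂ] X), FiniteDimensional ℂ V ∧
      LieModule.IsIrreducible ℂ L V ∧ (∀ v : V, ⁅z, v⁆ = c • v) ∧ Function.Injective ι ∧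
      (∀ v, ι v ∈ W) ∧ ∀ (x : L) (v : V), ι ⁅x, v⁆ = ρ x (ι v) := by
  obtain ⟨Y, hY, hY0, hYi, hmin⟩ := exists_minimal_invariant W hW0 ρ hW
  have : FiniteDimensional ℂ Y := Submodule.finiteDimensional_of_le hY
  have hnt : Nontrivial Y := (Submodule.nontrivial_iff_ne_bot).2 hY0
  obtain ⟨e⟩ : Nonempty ((Fin (Module.finrank ℂ Y) → ℂ) ≃ₗ[ℂ] Y) :=
    ⟨(Module.finBasis ℂ Y).equivFun.symm⟩
  -- Schur's lemma: an eigenspace of the central element is invariant and nonzero, so by minimality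
  -- it is all of `Y`.
  obtain ⟨c, hc⟩ : ∃ c : ℂ, ∀ v ∈ Y, ρ z v = c • v := by
    obtain ⟨c, hc⟩ := Module.End.exists_eigenvalue ((ρ z).restrict (hYi z))
    obtain ⟨v, hv⟩ := hc.exists_hasEigenvector
    have h1 := hmin (Y ⊓ (ρ z).eigenspace c) inf_le_left
      ((Submodule.ne_bot_iff _).2 ⟨v.1, ⟨v.2, Module.End.mem_eigenspace_iff.2
        (congrArg Subtype.val hv.apply_eq_smul)⟩, fun h => hv.2 (Subtype.ext h)⟩)
      (fun x w hw => ⟨hYi x w hw.1, Module.End.mem_eigenspace_iff.2 (by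
        have h2 := hρ x z w (hY hw.1)
        rw [hz, map_zero, LinearMap.zero_apply, Module.End.mem_eigenspace_iff.1 hw.2, map_smul] at h2
        exact (sub_eq_zero.1 h2.symm).symm)⟩)
    refine ⟨c, fun v hv => Module.End.mem_eigenspace_iff.1 ?_⟩
    rw [← h1] at hv
    exact hv.2
  let ι : (Fin (Module.finrank ℂ Y) → ℂ) →ₗ[ℂ] X := Y.subtype ∘ₗ e.toLinearMap
  have hι : Function.Injective ι := Y.injective_subtype.comp e.injective
  have hιY : ∀ v, ι v ∈ Y := fun v => (e v).2
  let br : Bracket L (Fin (Module.finrank ℂ Y) → ℂ) :=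
    ⟨fun x v => e.symm ⟨ρ x (ι v), hYi x _ (hιY v)⟩⟩
  have hbr : ∀ (x : L) (v : Fin (Module.finrank ℂ Y) → ℂ), ι ⁅x, v⁆ = ρ x (ι v) := fun x v =>
    congrArg Subtype.val (e.apply_symm_apply _)
  -- All module axioms are checked after applying the injective map `ι`, where they become
  -- properties of `ρ` on `Y`.
  let lrm : LieRingModule L (Fin (Module.finrank ℂ Y) → ℂ) :=
    { br with
      add_lie := fun x y m => hι (by
        rw [map_add]; exact (hbr _ _).trans (by
          rw [map_add, LinearMap.add_apply]; exact congrArg₂ _ (hbr _ _).symm (hbr _ _).symm))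
      lie_add := fun x m n => hι (by
        rw [map_add]; exact (hbr _ _).trans (by
          rw [map_add, map_add]; exact congrArg₂ _ (hbr _ _).symm (hbr _ _).symm))
      leibniz_lie := fun x y m => hι (by
        rw [map_add]
        have h1 := hρ x y _ (hY (hιY m))
        rw [eq_sub_iff_add_eq] at h1
        refine ((hbr _ _).trans (congrArg _ (hbr _ _))).trans (h1.symm.trans ?_)
        exact congrArg₂ _ (hbr _ _).symm ((hbr _ _).trans (congrArg _ (hbr _ _))).symm) }
  have hbr' : ∀ (x : L) (v : Fin (Module.finrank ℂ Y) → ℂ), ι ⁅x, v⁆ = ρ x (ι v) := hbr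
  have lm : LieModule ℂ L (Fin (Module.finrank ℂ Y) → ℂ) :=
    { smul_lie := fun t x m => hι (by
        rw [map_smul, hbr', hbr', map_smul, LinearMap.smul_apply])
      lie_smul := fun t x m => hι (by
        rw [map_smul, hbr', hbr', map_smul, map_smul]) }
  have hV : Nontrivial (Fin (Module.finrank ℂ Y) → ℂ) := e.toEquiv.nontrivial
  refine ⟨Fin (Module.finrank ℂ Y) → ℂ, inferInstance, inferInstance, lrm, lm, c, ι, inferInstance,
    LieModule.IsIrreducible.mk fun A hA => ?_, fun v => hι ?_, hι, fun v => hY (hιY v), hbr'⟩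
  · have h1 := hmin (A.toSubmodule.map ι) (by rintro _ ⟨v, _, rfl⟩; exact hιY v)
      (fun h => hA (by
        rw [← LieSubmodule.toSubmodule_eq_bot]
        exact Submodule.map_injective_of_injective hι (h.trans (Submodule.map_bot _).symm)))
      (by
        rintro x _ ⟨v, hv, rfl⟩
        exact ⟨⁅x, v⁆, A.lie_mem hv, hbr' x v⟩)
    rw [← LieSubmodule.toSubmodule_eq_top]
    refine (Submodule.eq_top_iff').2 fun v => ?_
    obtain ⟨w, hw, hwv⟩ := h1.ge (hιY v)
    rwa [← hι hwv]
  · rw [hbr', map_smul, hc _ (hιY v)]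

end

/-! ### Modules over the enveloping algebra and maps out of induced modules -/

namespace AKModule

section

variable {ε : Fin N → ℤ} {X : Type*} [AddCommGroup X] [Module ℂ X]

/-- The action of the enveloping algebra on an `𝒜𝒦(N; ε)` module. -/
def envRep (Q : AKModule ε X) : Env ε →ₐ[ℂ] Module.End ℂ X :=
  (RingQuot.liftAlgHom ℂ ⟨TensorAlgebra.lift ℂ (LinearMap.coprod Q.lie Q.fn.toLinearMap), by
    intro x y h
    cases h with
    | lie_lie hD hE =>
      simp only [genLie, LinearMap.comp_apply, map_mul, map_add, map_smul,
        TensorAlgebra.lift_ι_apply, LinearMap.coprod_apply, LinearMap.inl_apply, map_zero, add_zero]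
      refine LinearMap.ext fun v => ?_
      rw [LinearMap.add_apply, Q.lie_lie hD hE]
      exact (add_sub_cancel _ _).symm
    | lie_fn hD hf =>
      simp only [genLie, genFn, LinearMap.comp_apply, map_mul, map_add, map_smul,
        TensorAlgebra.lift_ι_apply, LinearMap.coprod_apply, LinearMap.inl_apply,
        LinearMap.inr_apply, map_zero, add_zero, zero_add, AlgHom.toLinearMap_apply]
      refine LinearMap.ext fun v => ?_
      rw [LinearMap.add_apply, Q.lie_fn hD hf]
      exact (add_sub_cancel _ _).symm
    -- The action of `𝒜` is associative and `𝒜` is supercommutative, so the abelian relations of the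
    -- enveloping algebra hold.
    | fn_fn hf hg =>
      simp only [genFn, LinearMap.comp_apply, map_mul, map_smul, TensorAlgebra.lift_ι_apply,
        LinearMap.coprod_apply, LinearMap.inr_apply, map_zero, zero_add, AlgHom.toLinearMap_apply]
      rw [← map_mul, mul_eq_sgn_smul_mul hf hg, map_smul, map_mul]⟩ :
    RingQuot (EnvRel ε) →ₐ[ℂ] Module.End ℂ X)

theorem envRep_mk (Q : AKModule ε X) (x : Tens ε) : Q.envRep (Env.mk ε x)
    = TensorAlgebra.lift ℂ (LinearMap.coprod Q.lie Q.fn.toLinearMap) x :=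
  RingQuot.liftAlgHom_mkAlgHom_apply ℂ _ _ x

theorem envRep_lie (Q : AKModule ε X) (x : contactAlgebra ε) :
    Q.envRep (Env.lie ε x) = Q.lie x := by
  rw [Env.lie, LinearMap.comp_apply, AlgHom.toLinearMap_apply, envRep_mk]
  simp [genLie]

theorem envRep_fn (Q : AKModule ε X) (f : SA N) : Q.envRep (Env.fn ε f) = Q.fn f := by
  rw [Env.fn, LinearMap.comp_apply, AlgHom.toLinearMap_apply, envRep_mk]
  simp [genFn]

theorem envRep_mem (Q : AKModule ε X) {S : Submodule ℂ X} (hf : ∀ f, ∀ v ∈ S, Q.fn f v ∈ S)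
    (hl : ∀ x, ∀ v ∈ S, Q.lie x v ∈ S) (u : Env ε) : ∀ v ∈ S, Q.envRep u v ∈ S := by
  induction u using Env.induction with
  | hc c => intro v hv; rw [AlgHom.commutes]; exact S.smul_mem c hv
  | hl hD => intro v hv; rw [envRep_lie]; exact hl _ v hv
  | hf f => intro v hv; rw [envRep_fn]; exact hf f v hv
  | hadd x y hx hy => intro v hv; rw [map_add]; exact add_mem (hx v hv) (hy v hv)
  | hmul x y hx hy => intro v hv; rw [map_mul]; exact hx _ (hy v hv)

theorem par_envRep (Q : AKModule ε X) (u : Env ε) :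
    ∀ v, Q.par (Q.envRep u v) = Q.envRep (Env.par ε u) (Q.par v) := by
  induction u using Env.induction with
  | hc c => intro v; simp
  | hl hD =>
    intro v
    rw [Env.par_lie, parityK_toK, map_smul, map_smul, envRep_lie, Q.par_lie]
    rfl
  | hf f =>
    intro v
    obtain ⟨f₀, h₀, f₁, h₁, rfl⟩ := exists_homog f
    rw [Env.par_fn, envRep_fn, envRep_fn, map_add, map_add, LinearMap.add_apply, map_add,
      Q.par_fn h₀, Q.par_fn h₁, show parity f₀ = sgn 0 • f₀ from h₀,
      show parity f₁ = sgn 1 • f₁ from h₁, map_add, map_smul, map_smul]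
    rfl
  | hadd x y hx hy => intro v; simp only [map_add, LinearMap.add_apply, hx, hy]
  | hmul x y hx hy => intro v; simp only [map_mul, Module.End.mul_apply, hx, hy]

variable {V : Type*} [AddCommGroup V] [Module ℂ V] [LieRingModule (Levi N) V]

/-- The map out of the induced module given by Frobenius reciprocity. -/
def indLift (Q : AKModule ε X) (ι : V →ₗ[ℂ] X)
    (h1 : ∀ f ∈ isotropySpace N, ∀ v, ι ⁅symbol f, v⁆ = Q.ham f (ι v))
    (h2 : ∀ v, ι v ∈ Q.evalPart) : Ind ε V →ₗ[ℂ] X :=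
  ((indRel ε V).liftQ (TensorProduct.lift ((LinearMap.lcomp ℂ X ι) ∘ₗ Q.envRep.toLinearMap)) (by
    refine Submodule.span_le.2 ?_
    -- The two families of relations are respected by `h1`, for `𝒦_0`, and by `h2`, for `𝒜`.
    rintro _ (⟨u, f, v, hf, rfl⟩ | ⟨u, h, v, rfl⟩)
    · have : Q.ham f (ι v) = Q.lie (contactEquiv ε f) (ι v) := rfl
      simp [h1 f hf, envRep_lie, this]
    · simp [envRep_fn, h2 v h]) : ((Env ε ⊗[ℂ] V) ⧸ indRel ε V) →ₗ[ℂ] X)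

variable (Q : AKModule ε X) (ι : V →ₗ[ℂ] X)
    (h1 : ∀ f ∈ isotropySpace N, ∀ v, ι ⁅symbol f, v⁆ = Q.ham f (ι v))
    (h2 : ∀ v, ι v ∈ Q.evalPart)

theorem indLift_mk (u : Env ε) (v : V) :
    Q.indLift ι h1 h2 (Ind.mk ε V (u ⊗ₜ v)) = Q.envRep u (ι v) := rfl

theorem indLift_act (w : Env ε) (x : Ind ε V) :
    Q.indLift ι h1 h2 (Ind.act ε V w x) = Q.envRep w (Q.indLift ι h1 h2 x) := by
  suffices h : Q.indLift ι h1 h2 ∘ₗ Ind.act ε V w = Q.envRep w ∘ₗ Q.indLift ι h1 h2 from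
    LinearMap.congr_fun h x
  refine Ind.hom_ext fun u v => ?_
  simp only [LinearMap.comp_apply, Ind.act_mk, indLift_mk, map_mul, Module.End.mul_apply]

theorem indLift_par {p : ZMod 2} (h3 : ∀ v, Q.par (ι v) = sgn p • ι v) (x : Ind ε V) :
    Q.indLift ι h1 h2 ((indModule ε V p).par x) = Q.par (Q.indLift ι h1 h2 x) := by
  suffices h : Q.indLift ι h1 h2 ∘ₗ Ind.par ε V p = Q.par ∘ₗ Q.indLift ι h1 h2 from
    LinearMap.congr_fun h x
  refine Ind.hom_ext fun u v => ?_
  simp only [LinearMap.comp_apply, Ind.par, Ind.map_mk, TensorProduct.map_tmul,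
    AlgHom.toLinearMap_apply, indLift_mk, LinearMap.smul_apply, LinearMap.id_apply, map_smul,
    par_envRep, h3]

theorem indLift_fn {p : ZMod 2} (f : SA N) (x : Ind ε V) :
    Q.indLift ι h1 h2 ((indModule ε V p).fn f x) = Q.fn f (Q.indLift ι h1 h2 x) :=
  (Q.indLift_act ι h1 h2 (Env.fn ε f) x).trans (by rw [envRep_fn])

theorem indLift_lie {p : ZMod 2} (y : contactAlgebra ε) (x : Ind ε V) :
    Q.indLift ι h1 h2 ((indModule ε V p).lie y x) = Q.lie y (Q.indLift ι h1 h2 x) :=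
  (Q.indLift_act ι h1 h2 (Env.lie ε y) x).trans (by rw [envRep_lie])

theorem indLift_mem {S : Submodule ℂ X} (hf : ∀ f, ∀ v ∈ S, Q.fn f v ∈ S)
    (hl : ∀ x, ∀ v ∈ S, Q.lie x v ∈ S) (hι : ∀ v, ι v ∈ S) (x : Ind ε V) :
    Q.indLift ι h1 h2 x ∈ S := by
  obtain ⟨y, rfl⟩ : ∃ y, Ind.mk ε V y = x := Submodule.mkQ_surjective _ x
  induction y with
  | zero => rw [map_zero, map_zero]; exact zero_mem _
  | tmul u v => exact Q.envRep_mem hf hl u _ (hι v)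
  | add a b ha hb => rw [map_add, map_add]; exact add_mem ha hb

end

/-! ### Maps out of the weighting functor, and simple quotients -/

section

variable {ε : Fin N → ℤ} {M : Type*} [AddCommGroup M] [Module ℂ M]
  {Y : Type*} [AddCommGroup Y] [Module ℂ Y]

theorem DtK_mem_weightPart (ε : Fin N → ℤ) :
    DtK ε ∈ weightPart (X := contactAlgebra ε) ε (adDt ε) 0 := by
  refine mem_weightPart.2 (Subtype.ext ?_)
  rw [Int.cast_zero, mul_zero, zero_smul]
  exact sub_self _

/-- A homomorphism from `R` to the completion of `P` induces a map from `𝔚^{(a)}(R)` to `P`. -/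
def weightedLift (P : AKModule ε M) (R : AKModule ε Y) (a : ℂ) (φ : Y →ₗ[ℂ] (ℤ → M))
    (hl : ∀ x v, φ (R.lie x v) = P.seqModule.lie x (φ v)) (hw : ∀ v, φ v ∈ P.weightSeq a) :
    R.Weighted a →ₗ[ℂ] M :=
  R.wlift a fun m => (R.wsub a m).liftQ (LinearMap.proj m ∘ₗ φ) (by
    -- The `m`-th component of a vector of the completion has `D_t`-weight `a + s m`, where `s` is
    -- `step ε`; this is what makes projection to that component factor through the `m`-th quotient.
    rintro _ ⟨v, rfl⟩
    have h := hw v m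
    simp only [LinearMap.mem_ker, LinearMap.comp_apply, LinearMap.sub_apply, LinearMap.smul_apply,
      LinearMap.id_apply, map_sub, map_smul, hl, LinearMap.proj_apply]
    rw [P.seqModule_lie_of_mem (DtK_mem_weightPart ε), sub_zero, h, sub_self])

variable (P : AKModule ε M) (R : AKModule ε Y) (a : ℂ) (φ : Y →ₗ[ℂ] (ℤ → M))
    (hl : ∀ x v, φ (R.lie x v) = P.seqModule.lie x (φ v)) (hw : ∀ v, φ v ∈ P.weightSeq a)

theorem weightedLift_wmk (m : ℤ) (v : Y) :
    P.weightedLift R a φ hl hw (R.wmk a m v) = φ v m := by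
  rw [weightedLift, wmk, LinearMap.comp_apply, wlift_wincl]
  rfl

theorem weightedLift_par (hp : ∀ v, φ (R.par v) = P.seqModule.par (φ v)) (w : R.Weighted a) :
    P.weightedLift R a φ hl hw ((R.weighting a).par w) = P.par (P.weightedLift R a φ hl hw w) := by
  suffices h : P.weightedLift R a φ hl hw ∘ₗ R.wpar a = P.par ∘ₗ P.weightedLift R a φ hl hw from
    LinearMap.congr_fun h w
  refine weighted_ext fun m v => ?_
  rw [LinearMap.comp_apply, LinearMap.comp_apply, wpar_wmk, weightedLift_wmk, weightedLift_wmk, hp]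
  exact P.seqPar_apply _ m

theorem weightedLift_fn (hf : ∀ f v, φ (R.fn f v) = P.seqModule.fn f (φ v)) (f : SA N)
    (w : R.Weighted a) : P.weightedLift R a φ hl hw ((R.weighting a).fn f w)
      = P.fn f (P.weightedLift R a φ hl hw w) := by
  suffices h : P.weightedLift R a φ hl hw ∘ₗ R.wfn a f = P.fn f ∘ₗ P.weightedLift R a φ hl hw from
    LinearMap.congr_fun h w
  refine SA_weight_induction (ε := ε) (C := fun f => P.weightedLift R a φ hl hw ∘ₗ R.wfn a f
    = P.fn f ∘ₗ P.weightedLift R a φ hl hw) (by simp)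
    (fun f g hf hg => by
      rw [map_add, map_add, LinearMap.comp_add, hf, hg, LinearMap.add_comp]) (fun s f hs => ?_) f
  refine weighted_ext fun m v => ?_
  rw [LinearMap.comp_apply, LinearMap.comp_apply, R.wfn_wmk a hs, weightedLift_wmk,
    weightedLift_wmk, hf, P.seqModule_fn_of_mem hs, add_sub_cancel_right]

theorem weightedLift_lie (x : contactAlgebra ε) (w : R.Weighted a) :
    P.weightedLift R a φ hl hw ((R.weighting a).lie x w)
      = P.lie x (P.weightedLift R a φ hl hw w) := by
  suffices h : P.weightedLift R a φ hl hw ∘ₗ R.wlie a x = P.lie x ∘ₗ P.weightedLift R a φ hl hw from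
    LinearMap.congr_fun h w
  refine contact_weight_induction (ε := ε) (C := fun x => P.weightedLift R a φ hl hw ∘ₗ R.wlie a x
    = P.lie x ∘ₗ P.weightedLift R a φ hl hw) (by simp)
    (fun f g hf hg => by
      rw [map_add, map_add, LinearMap.comp_add, hf, hg, LinearMap.add_comp]) (fun s x hs => ?_) x
  refine weighted_ext fun m v => ?_
  rw [LinearMap.comp_apply, LinearMap.comp_apply, R.wlie_wmk a hs, weightedLift_wmk,
    weightedLift_wmk, hl, P.seqModule_lie_of_mem hs, add_sub_cancel_right]

/-- A simple module is a simple quotient of every module with a nonzero map to it. -/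
theorem exists_simple_quotient {P : AKModule ε M} (hs : P.IsSimple) (R : AKModule ε Y)
    (F : Y →ₗ[ℂ] M) (hp : ∀ v, F (R.par v) = P.par (F v)) (hf : ∀ f v, F (R.fn f v) = P.fn f (F v))
    (hl : ∀ x v, F (R.lie x v) = P.lie x (F v)) (hF : F ≠ 0) :
    ∃ (S : Submodule ℂ Y) (hS : R.IsSub S),
      (R.quotient S hS).IsSimple ∧ P.Isomorphic (R.quotient S hS) := by
  -- The image is a nonzero submodule of a simple module.
  have hsurj : LinearMap.range F = ⊤ := by
    refine (hs.2 _ ⟨?_, ?_, ?_⟩).resolve_left fun h => hF (LinearMap.range_eq_bot.1 h)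
    · rintro _ ⟨v, rfl⟩; exact ⟨_, hp v⟩
    · rintro f _ ⟨v, rfl⟩; exact ⟨_, hf f v⟩
    · rintro x _ ⟨v, rfl⟩; exact ⟨_, hl x v⟩
  have hS : R.IsSub (LinearMap.ker F) :=
    ⟨fun v hv => by rw [LinearMap.mem_ker, hp, LinearMap.mem_ker.1 hv, map_zero],
      fun f v hv => by rw [LinearMap.mem_ker, hf, LinearMap.mem_ker.1 hv, map_zero],
      fun x v hv => by rw [LinearMap.mem_ker, hl, LinearMap.mem_ker.1 hv, map_zero]⟩
  let e : (Y ⧸ LinearMap.ker F) ≃ₗ[ℂ] M :=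
    F.quotKerEquivOfSurjective (LinearMap.range_eq_top.1 hsurj)
  have e1 : ∀ v, e ((R.quotient _ hS).par v) = P.par (e v) := by rintro ⟨v⟩; exact hp v
  have e2 : ∀ f v, e ((R.quotient _ hS).fn f v) = P.fn f (e v) := by rintro f ⟨v⟩; exact hf f v
  have e3 : ∀ x v, e ((R.quotient _ hS).lie x v) = P.lie x (e v) := by rintro x ⟨v⟩; exact hl x v
  have hM := hs.1
  refine ⟨_, hS, ⟨e.toEquiv.nontrivial, fun T hT => ?_⟩, e.symm, fun v => ?_, fun f v => ?_,
    fun x v => ?_⟩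
  · have hT' : P.IsSub (T.map e.toLinearMap) := by
      refine ⟨?_, ?_, ?_⟩
      · rintro _ ⟨v, hv, rfl⟩; exact ⟨_, hT.par v hv, e1 v⟩
      · rintro f _ ⟨v, hv, rfl⟩; exact ⟨_, hT.fn f v hv, e2 f v⟩
      · rintro x _ ⟨v, hv, rfl⟩; exact ⟨_, hT.lie x v hv, e3 x v⟩
    refine (hs.2 _ hT').imp (fun h => ?_) fun h => ?_
    · exact Submodule.map_injective_of_injective e.injective (h.trans (Submodule.map_bot _).symm)
    · refine (Submodule.eq_top_iff').2 fun v => ?_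
      obtain ⟨w, hw, hwv⟩ : e v ∈ T.map e.toLinearMap := h ▸ Submodule.mem_top
      rwa [← e.injective hwv]
  · rw [LinearEquiv.symm_apply_eq, e1, e.apply_symm_apply]
  · rw [LinearEquiv.symm_apply_eq, e2, e.apply_symm_apply]
  · rw [LinearEquiv.symm_apply_eq, e3, e.apply_symm_apply]

end

end AKModule


/-! ### Homogeneous highest components -/

namespace AKModule

variable {ε : Fin N → ℤ}

/-- The vectors of `highestPart` that are homogeneous of parity `p`. -/
def highestHomog {X : Type*} [AddCommGroup X] [Module ℂ X] (Q : AKModule ε X) (U : Submodule ℂ X)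
    (p : ZMod 2) : Submodule ℂ X :=
  Q.highestPart U ⊓ LinearMap.ker (Q.par - sgn p • LinearMap.id)

section

variable {X : Type*} [AddCommGroup X] [Module ℂ X] {Q : AKModule ε X} {U : Submodule ℂ X}

theorem mem_highestHomog {p : ZMod 2} {v : X} :
    v ∈ Q.highestHomog U p ↔ v ∈ Q.highestPart U ∧ Q.par v = sgn p • v := by
  simp [highestHomog, sub_eq_zero]

/-- Either `v + par v` is a nonzero even vector, or it vanishes and `v` itself is odd. -/
theorem exists_highestHomog_ne_bot (hU : ∀ v ∈ U, Q.par v ∈ U) (h : Q.highestPart U ≠ ⊥) :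
    ∃ p, Q.highestHomog U p ≠ ⊥ := by
  obtain ⟨v, hv, hv0⟩ := Submodule.exists_mem_ne_zero_of_ne_bot h
  have hp := Q.par_mem_highestPart hU hv
  by_cases h0 : v + Q.par v = 0
  · refine ⟨1, (Submodule.ne_bot_iff _).2 ⟨v, mem_highestHomog.2 ⟨hv, ?_⟩, hv0⟩⟩
    rw [sgn_one, neg_one_smul]
    exact eq_neg_of_add_eq_zero_right h0
  · refine ⟨0, (Submodule.ne_bot_iff _).2 ⟨_, mem_highestHomog.2 ⟨add_mem hv hp, ?_⟩, h0⟩⟩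
    rw [sgn_zero, one_smul, map_add, Q.par_par, add_comm]

/-- Lifts of elements of `ℂ z ⊕ 𝔰𝔬_N` are even functions, so their action preserves parity. This is
why `V` may be placed in a single parity. -/
theorem ham_symbolSection_mem_highestHomog (hN : 1 ≤ N)
    (hU : ∀ f ∈ stab N, ∀ v ∈ U, Q.ham f v ∈ U) {p : ZMod 2} (x : Levi N) {v : X}
    (hv : v ∈ Q.highestHomog U p) : Q.ham (symbolSection x) v ∈ Q.highestHomog U p := by
  obtain ⟨h1, h2⟩ := mem_highestHomog.1 hv
  refine mem_highestHomog.2 ⟨Q.ham_mem_highestPart hN hU (symbolSection_mem_stab x) h1, ?_⟩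
  have h3 : parity (symbolSection x) = sgn 0 • symbolSection x := symbolSection_mem_homog x
  rw [Q.par_ham, h3, sgn_zero, one_smul, h2, map_smul]

/-- A finite-dimensional subspace stable under the stabilizer of the point and the parity operator
contains a simple homogeneous representation of `ℂ z ⊕ 𝔰𝔬_N`, on which the stabilizer acts through
the symbol. -/
theorem exists_irreducible_symbol_rep (hN : 1 ≤ N) (hN4 : N ≠ 4) [FiniteDimensional ℂ U]
    (hU : ∀ f ∈ stab N, ∀ v ∈ U, Q.ham f v ∈ U) (hp : ∀ v ∈ U, Q.par v ∈ U) (hU0 : U ≠ ⊥) :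
    ∃ (V : Type) (_ : AddCommGroup V) (_ : Module ℂ V) (_ : LieRingModule (Levi N) V)
      (_ : LieModule ℂ (Levi N) V) (p : ZMod 2) (c : ℂ) (ι : V →ₗ[ℂ] X), FiniteDimensional ℂ V ∧
      LieModule.IsIrreducible ℂ (Levi N) V ∧ (∀ v : V, ⁅((1, 0) : Levi N), v⁆ = c • v) ∧
      Function.Injective ι ∧ (∀ v, ι v ∈ U) ∧ (∀ v, Q.par (ι v) = sgn p • ι v) ∧
      ∀ f ∈ isotropySpace N, ∀ v, ι ⁅symbol f, v⁆ = Q.ham f (ι v) := by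
  obtain ⟨v, hv, hv0, hv'⟩ := Q.exists_ham_higher_eq_zero hN4 U hU hU0
  obtain ⟨p, hW0⟩ := exists_highestHomog_ne_bot (Q := Q) hp
    ((Submodule.ne_bot_iff _).2 ⟨v, ⟨hv, hv'⟩, hv0⟩)
  have hWU : Q.highestHomog U p ≤ U := fun v hv => hv.1.1
  have : FiniteDimensional ℂ (Q.highestHomog U p) := Submodule.finiteDimensional_of_le hWU
  let ρ : Levi N →ₗ[ℂ] Module.End ℂ X := Q.ham ∘ₗ
    { toFun := symbolSection, map_add' := symbolSection_add, map_smul' := symbolSection_smul }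
  have hz : ∀ x : Levi N, ⁅x, ((1, 0) : Levi N)⁆ = 0 := fun x => Prod.ext (levi_lie x _).1
    (Subtype.ext ((levi_lie x _).2.trans (by simp)))
  obtain ⟨V, i1, i2, i3, i4, c, ι, hfd, hirr, hc, hι, hιW, hρ⟩ :=
    exists_irreducible_rep (Q.highestHomog U p) hW0 ρ
      (fun x v hv => ham_symbolSection_mem_highestHomog hN hU x hv)
      (fun x y v hv => Q.ham_symbolSection_lie hN x y hv.1) hz
  exact ⟨V, i1, i2, i3, i4, p, c, ι, hfd, hirr, hc, hι, fun v => hWU (hιW v),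
    fun v => (mem_highestHomog.1 (hιW v)).2, fun f hf v => (hρ _ _).trans
      (Q.ham_eq_ham_symbolSection (isotropySpace_le_stab hf) (hιW v).1).symm⟩

end

end AKModule


end ContactSuper

end

/-! ### Simple jet modules as quotients of tensor modules -/

theorem mainTheorem3 (N : ℕ) (hN : 1 ≤ N) (hN4 : N ≠ 4) (ε : Fin N → ℤ) (a : ℂ)
    {M : Type*} [AddCommGroup M] [Module ℂ M] (P : ContactSuper.AKModule ε M)
    (hJ : P.IsJet a) (hs : P.IsSimple) :
    ∃ (V : Type) (_ : AddCommGroup V) (_ : Module ℂ V)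
      (_ : LieRingModule (ContactSuper.Levi N) V) (_ : LieModule ℂ (ContactSuper.Levi N) V)
      (p : ZMod 2) (c : ℂ),
      FiniteDimensional ℂ V ∧ LieModule.IsIrreducible ℂ (ContactSuper.Levi N) V ∧
      (∀ v : V, ⁅((1, 0) : ContactSuper.Levi N), v⁆ = c • v) ∧
      ∃ (S : Submodule ℂ ((ContactSuper.indModule ε V p).Weighted a))
        (hS : (ContactSuper.tensorModule ε V a p).IsSub S),
        ((ContactSuper.tensorModule ε V a p).quotient S hS).IsSimple ∧
          P.Isomorphic ((ContactSuper.tensorModule ε V a p).quotient S hS) := by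
  have := hs.1
  have := ContactSuper.AKModule.finiteDimensional_fiber hJ
  -- The representation theory of the stabilizer is applied to the fiber of the completion.
  obtain ⟨V, i1, i2, i3, i4, p, c, ι, hfd, hirr, hc, hι, hιU, h3, h1⟩ :=
    ContactSuper.AKModule.exists_irreducible_symbol_rep (Q := P.seqModule) (U := P.fiber a) hN hN4
      (fun f hf v hv => P.ham_mem_fiber a hf hv) (fun v hv => P.par_mem_fiber a hv)
      (ContactSuper.AKModule.fiber_ne_bot hJ)
  have h2 : ∀ v, ι v ∈ P.seqModule.evalPart := fun v => (hιU v).2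
  refine ⟨V, i1, i2, i3, i4, p, c, hfd, hirr, hc, ?_⟩
  have hl : ∀ x v, P.seqModule.indLift ι h1 h2 ((ContactSuper.indModule ε V p).lie x v)
      = P.seqModule.lie x (P.seqModule.indLift ι h1 h2 v) := P.seqModule.indLift_lie ι h1 h2
  have hw : ∀ v, P.seqModule.indLift ι h1 h2 v ∈ P.weightSeq a :=
    P.seqModule.indLift_mem ι h1 h2 (fun f v => P.fn_mem_weightSeq a f)
      (fun x v => P.lie_mem_weightSeq a x) fun v => (hιU v).1
  refine ContactSuper.AKModule.exists_simple_quotient hs (ContactSuper.tensorModule ε V a p)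
    (P.weightedLift (ContactSuper.indModule ε V p) a _ hl hw)
    (P.weightedLift_par _ a _ hl hw (P.seqModule.indLift_par ι h1 h2 h3))
    (P.weightedLift_fn _ a _ hl hw (P.seqModule.indLift_fn ι h1 h2))
    (P.weightedLift_lie _ a _ hl hw) fun h => ?_
  have : Nontrivial V := (LieSubmodule.nontrivial_iff ℂ (ContactSuper.Levi N) V).1 inferInstance
  obtain ⟨v, hv⟩ := exists_ne (0 : V)
  -- The map to `P` sends the class of `1 ⊗ v` in index `m` to the `m`-th component of `ι v`. If it
  -- were zero, all components of `ι v` would vanish, against injectivity of `ι`.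
  refine hv (hι ((funext fun m => ?_).trans (map_zero ι).symm))
  have h4 := LinearMap.congr_fun h ((ContactSuper.indModule ε V p).wmk a m
    (ContactSuper.Ind.mk ε V (1 ⊗ₜ v)))
  rwa [P.weightedLift_wmk, P.seqModule.indLift_mk, map_one] at h4
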